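/- For a space $M$ with universal covering $p\colon \widetilde M\to M$ and deck group $\mathbb Z^d$, and for $A\subseteq M$, regard $H_1(p^{-1}(A);\mathbb Z)$ as a module over $\mathbb Z[\mathbb Z^d]$ through the deck transformations, and let $I\subset\mathbb Z[\mathbb Z^d]$ be the augmentation ideal. If $G\subset M$ and $L\subset M\smallsetminus G$ is a link, put $J=H_1(p^{-1}(G))$ and $H=H_1(p^{-1}(M\smallsetminus L))$. The inclusion $G\subset M\smallsetminus L$ induces a linear map $J\to H$, and hence maps $i_j\colon I^jJ/I^{j+1}J\to I^jH/I^{j+1}H$ for all $j\ge 0$. For $v\in\mathbb Z^d$, a $v$-curve in $T^d=\mathbb R^d/\mathbb Z^d$ is a straight closed curve $t\mapsto c+tv$, $t\in\mathbb R/\mathbb Z$, with $c\in T^d$. (1) Let $M=T^2\times[0,1]$ with covering $\mathbb R^2\times[0,1]\to T^2\times[0,1]$ and deck group $\mathbb Z^2$, and let $G=(\{0\}\times[0,1])\cup(T^2\times\{0,1\})$. For every $k\ge 0$ there is a link $L_k\subset T^2\times(0,1)$ disjoint from $G$ that consists of one $(1,-j)$-curve for each $j=0,\dots,k$ and one $(0,1)$-curve,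 each in its own torus $T^2\times\{h\}$, the $k+2$ levels $h\in(0,1)$ being pairwise distinct, such that $i_j\colon I^jJ/I^{j+1}J\to I^jH/I^{j+1}H$ is injective for all $1\le j\le k$. (2) Let $M=T^3$ with covering $\mathbb R^3\to T^3$ and deck group $\mathbb Z^3$, and let $G$ be the union of the three coordinate circles through $0$. For every $k\ge 0$ there is a $(2k+3)$-component link $L_k\subset T^3$ disjoint from $G$ that consists of one curve in each of the three coordinate directions and one $(1,0,-j)$-curve and one $(0,1,-j)$-curve for each $j=1,\dots,k$, such that $i_j\colon I^jJ/I^{j+1}J\to I^jH/I^{j+1}H$ is injective for all $1\le j\le k$. -/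

import Mathlib

open CategoryTheory Set

/-! ### Coverings with a lattice of deck transformations, and their first homology -/

/-- A map `proj : E → M` together with an action of `ℤᵈ` (written multiplicatively) on `E` by
homeomorphisms that preserve the fibres of `proj`. It is used only for the universal coverings
`ℝ² × I → T² × I` and `ℝ³ → T³` with the integer translations, which are constructed below. -/
structure LatticeCover (d : ℕ) (E M : Type) [TopologicalSpace E] [TopologicalSpace M] where
  proj : C(E, M)
  deck : Multiplicative (Fin d → ℤ) →* (E ≃ₜ E)
  proj_deck : ∀ g e, proj (deck g e) = proj e

/-- The group ring `ℤ[ℤᵈ]` (Laurent polynomials in `d` commuting variables). -/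
abbrev LatticeRing (d : ℕ) : Type := MonoidAlgebra ℤ (Multiplicative (Fin d → ℤ))

/-- The augmentation ideal of `ℤ[ℤᵈ]`: the kernel of the ring homomorphism to `ℤ` that sends every
group element to `1`. -/
noncomputable def augIdeal (d : ℕ) : Ideal (LatticeRing d) :=
  RingHom.ker (MonoidAlgebra.lift ℤ ℤ (Multiplicative (Fin d → ℤ)) 1)

/-- Singular homology `H₁( - ; ℤ)` as a functor on topological spaces. -/
noncomputable abbrev singularH1 : TopCat.{0} ⥤ ModuleCat.{0} ℤ :=
  (AlgebraicTopology.singularHomologyFunctor (ModuleCat.{0} ℤ) 1).obj (ModuleCat.of ℤ ℤ)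

namespace LatticeCover

variable {d : ℕ} {E M : Type} [TopologicalSpace E] [TopologicalSpace M] (P : LatticeCover d E M)

/-- The preimage of `A ⊆ M` in the covering space `E`. -/
def lift (A : Set M) : TopCat.{0} := TopCat.of (P.proj ⁻¹' A : Set E)

/-- The deck transformation `g`, restricted to the preimage of `A`. -/
def deckMap (A : Set M) (g : Multiplicative (Fin d → ℤ)) : P.lift A ⟶ P.lift A :=
  TopCat.ofHom
    ⟨fun e : (P.proj ⁻¹' A : Set E) => (⟨P.deck g e.1, by
        have h : P.proj e.1 ∈ A := e.2
        simpa [P.proj_deck] using h⟩ : (P.proj ⁻¹' A : Set E)),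
      by fun_prop⟩

/-- The inclusion of the preimage of `A` into the preimage of `B`. -/
def inclMap {A B : Set M} (h : A ⊆ B) : P.lift A ⟶ P.lift B :=
  TopCat.ofHom
    ⟨fun e : (P.proj ⁻¹' A : Set E) => (⟨e.1, h e.2⟩ : (P.proj ⁻¹' B : Set E)), by fun_prop⟩

theorem deckMap_one (A : Set M) : P.deckMap A 1 = 𝟙 (P.lift A) := by
  apply TopCat.hom_ext
  refine ContinuousMap.ext fun e => Subtype.ext ?_
  change P.deck 1 e.1 = e.1
  rw [map_one]
  rfl

theorem deckMap_mul (A : Set M) (g h : Multiplicative (Fin d → ℤ)) :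
    P.deckMap A (g * h) = P.deckMap A h ≫ P.deckMap A g := by
  apply TopCat.hom_ext
  refine ContinuousMap.ext fun e => Subtype.ext ?_
  change P.deck (g * h) e.1 = P.deck g (P.deck h e.1)
  rw [map_mul]
  rfl

theorem deckMap_inclMap {A B : Set M} (h : A ⊆ B) (g : Multiplicative (Fin d → ℤ)) :
    P.deckMap A g ≫ P.inclMap h = P.inclMap h ≫ P.deckMap B g := rfl

/-- The action of the deck group on the first homology of the preimage of `A`. -/
noncomputable def homologyRep (A : Set M) :
    Representation ℤ (Multiplicative (Fin d → ℤ)) (singularH1.obj (P.lift A)) where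
  toFun g := (singularH1.map (P.deckMap A g)).hom
  map_one' := by
    rw [deckMap_one, CategoryTheory.Functor.map_id]
    rfl
  map_mul' g h := by
    rw [deckMap_mul, CategoryTheory.Functor.map_comp]
    rfl

/-- The first homology of the preimage of `A`, as a module over `ℤ[ℤᵈ]` through the deck
transformations. -/
abbrev H1 (A : Set M) : Type := (P.homologyRep A).asModule

/-- The `ℤ[ℤᵈ]`-linear map `H₁` of the preimage of `A` → `H₁` of the preimage of `B` that is induced
by an inclusion `A ⊆ B`. -/
noncomputable def H1Map {A B : Set M} (h : A ⊆ B) : P.H1 A →ₗ[LatticeRing d] P.H1 B :=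
  Representation.IntertwiningMap.equivLinearMapAsModule (P.homologyRep A) (P.homologyRep B)
    ⟨(singularH1.map (P.inclMap h)).hom, fun g => by
      have := congrArg ModuleCat.Hom.hom
        (congrArg (fun f => singularH1.map f) (P.deckMap_inclMap h g))
      rw [CategoryTheory.Functor.map_comp, CategoryTheory.Functor.map_comp,
        ModuleCat.hom_comp, ModuleCat.hom_comp] at this
      exact this⟩

end LatticeCover

/-! ### Graded pieces -/

section Graded

variable {R : Type*} [CommRing R] (I : Ideal R) {M N : Type*} [AddCommGroup M] [Module R M]
  [AddCommGroup N] [Module R N]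

/-- `Iʲ M`. -/
def powSub (M : Type*) [AddCommGroup M] [Module R M] (j : ℕ) : Submodule R M :=
  I ^ j • (⊤ : Submodule R M)

/-- `Iʲ M / Iʲ⁺¹ M`. -/
abbrev GrPiece (M : Type*) [AddCommGroup M] [Module R M] (j : ℕ) : Type _ :=
  powSub I M j ⧸ (powSub I M (j + 1)).submoduleOf (powSub I M j)

theorem map_mem_powSub (f : M →ₗ[R] N) (j : ℕ) {m : M} (hm : m ∈ powSub I M j) :
    f m ∈ powSub I N j := by
  have h : (powSub I M j).map f ≤ powSub I N j := by
    rw [powSub, powSub, Submodule.map_smul'']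
    exact Submodule.smul_mono le_rfl le_top
  exact h (Submodule.mem_map_of_mem hm)

/-- The map `Iʲ M / Iʲ⁺¹ M → Iʲ N / Iʲ⁺¹ N` induced by a linear map `M → N`. -/
def grMap (f : M →ₗ[R] N) (j : ℕ) : GrPiece I M j →ₗ[R] GrPiece I N j :=
  Submodule.mapQ _ _ (f.restrict fun _ hm => map_mem_powSub I f j hm) fun _ hm =>
    map_mem_powSub I f (j + 1) hm

end Graded

/-! ### Tori and links -/

/-- The `d`-dimensional torus `(ℝ/ℤ)ᵈ`. -/
abbrev Torus (d : ℕ) : Type := Fin d → UnitAddCircle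

/-- Reduction modulo `ℤᵈ`. -/
def torusProj (d : ℕ) : C(Fin d → ℝ, Torus d) :=
  ⟨fun v i => (v i : UnitAddCircle), by fun_prop⟩

/-- The universal covering `ℝᵈ → Tᵈ` with the integer translations. -/
def torusCover (d : ℕ) : LatticeCover d (Fin d → ℝ) (Torus d) where
  proj := torusProj d
  deck :=
    { toFun := fun g => Homeomorph.addLeft (fun i => (g.toAdd i : ℝ))
      map_one' := by ext v i; simp
      map_mul' := fun g h => by ext v i; simp [add_assoc] }
  proj_deck g v := by ext i; simp [torusProj]

/-- The thickened torus `T² × I`. -/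
abbrev ThickTorus : Type := Torus 2 × unitInterval

/-- The universal covering `ℝ² × I → T² × I` with the integer translations of `ℝ²`. -/
def thickTorusCover : LatticeCover 2 ((Fin 2 → ℝ) × unitInterval) ThickTorus where
  proj := ⟨fun e => (torusProj 2 e.1, e.2), by fun_prop⟩
  deck :=
    { toFun := fun g => ((torusCover 2).deck g).prodCongr (Homeomorph.refl unitInterval)
      map_one' := by rw [map_one]; rfl
      map_mul' := fun g h => by rw [map_mul]; rfl }
  proj_deck g e := Prod.ext ((torusCover 2).proj_deck g e.1) rfl

/-- The straight closed curve `t ↦ c + t v` in `Tᵈ`, for `v ∈ ℤᵈ` and `t ∈ ℝ/ℤ`. -/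
def torusCurve {d : ℕ} (v : Fin d → ℤ) (c : Torus d) : C(UnitAddCircle, Torus d) :=
  ⟨fun t i => c i + v i • t, by fun_prop⟩

/-- The straight closed curve with direction `v`, placed at the level `h` of `T² × I`. -/
def levelCurve (v : Fin 2 → ℤ) (c : Torus 2) (h : unitInterval) : C(UnitAddCircle, ThickTorus) :=
  ⟨fun t => (torusCurve v c t, h), by fun_prop⟩

/-- The union of the components of a family of closed curves. -/
def linkSupport {M ι : Type} [TopologicalSpace M] (γ : ι → C(UnitAddCircle, M)) : Set M :=
  ⋃ i, range (γ i)

/-- A finite family of closed curves is a link: the curves are embedded circles, and they are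
pairwise disjoint. -/
def IsLink {M ι : Type} [TopologicalSpace M] [Finite ι] (γ : ι → C(UnitAddCircle, M)) : Prop :=
  (∀ i, Topology.IsEmbedding (γ i)) ∧ Pairwise fun i j => Disjoint (range (γ i)) (range (γ j))

/-- The standard relative spine `({*} × I) ∪ (T² × ∂I)` of `T² × I`, with `* = 0`. -/
def relSpine : Set ThickTorus := {p | p.1 = 0 ∨ p.2 = 0 ∨ p.2 = 1}

/-- The standard `1`-spine of `T³`: the union of the three coordinate circles through `0`. Its
preimage in `ℝ³` is the `1`-skeleton of the cubical lattice. -/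
def torusSpine : Set (Torus 3) := {p | ∃ i, ∀ j, j ≠ i → p j = 0}

/-- Directions of the `k + 2` components in `T² × I`: `(1, -j)` for `j = 0, …, k`, and `(0, 1)`. -/
def relDirection (k : ℕ) : Option (Fin (k + 1)) → Fin 2 → ℤ
  | some j => ![1, -(j : ℤ)]
  | none => ![0, 1]

/-- Directions of the `2k + 3` components in `T³`: the three coordinate directions, and `(1, 0, -j)`
and `(0, 1, -j)` for `j = 1, …, k`. -/
def torusDirection (k : ℕ) : Fin 3 ⊕ (Fin k ⊕ Fin k) → Fin 3 → ℤ
  | .inl i => Pi.single i 1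
  | .inr (.inl j) => ![1, 0, -((j : ℤ) + 1)]
  | .inr (.inr j) => ![0, 1, -((j : ℤ) + 1)]

/-!
The source `J` is described by generators and relations, and the target `H` is tested by winding
numbers.

*Source.* The module `J` is generated over `ℤ[ℤᵈ]` by explicit loops: two loops that go over
to a neighbouring vertical line and back, for `T² × I` (`RelSpine.span_gen`), and the boundaries of
the three coordinate squares, for `T³` (`CubicalSkeleton.span_gen`). A single relation
between them is needed: going around a square in two ways, and the boundary of a cube
(`RelSpine.gen_relation`, `CubicalSkeleton.gen_relation`).
Modulo `Iʲ⁺¹J`, an element of `IʲJ` is a combination of these generators whose coefficients are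
forms of degree `j` in the variables `xᵢ - 1`.

*Target.* The projection of the universal covering along one component of the link is a map `F` to
the plane for which the preimage of the Gaussian integers is that of this component, equivariant
under a homomorphism `l` from `ℤᵈ` to `ℤ[i]`. A class `h` in `H` has a winding number around every
`p`, almost all of them zero, and for every additive weight `w` the sum
`∑ₚ windₚ(h) (1 + X)^(w p)` is an additive map `H → ℂ⟦X⟧` on which `g ∈ ℤᵈ` acts as
multiplication by `(1 + X)^(w (l g))` (`LatticeCover.latticeTest`). It maps `Iʲ⁺¹H` into `(Xʲ⁺¹)`.
On a generator of `J` its constant coefficient is `2πi` times the signed number of lattice points in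
a parallelogram, because `F` maps the generator to the boundary of that parallelogram
(`MapsToParallelogram.latticeTotal_eq`).

*Comparison.* If forms `F_b` of degree `j` are the coefficients of an element that dies in the
graded piece of `H`, then every component, with direction `v`, gives a linear equation between the
values of the `F_b` on the hyperplane orthogonal to `v`. By `grMap_injective_of_tests` it remains to
see that the solutions are the multiples of the one relation. This is elementary for polynomials of
degree at most `k` (`exists_eq_mul_of_eval_two`, `exists_eq_mul_of_eval_three`): the coordinate
directions make forms `F_b` divisible by variables, and what has to vanish after division vanishes
on more hyperplanes `xᵢ = m xₗ` than its degree allows.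

Homology classes are handled as `1`-chains modulo boundaries of `2`-chains (`ChainQuot`), in which
every path has a class (`pathClass`), and which contains `H₁` as the kernel of the boundary map
(`range_h1Incl`).
-/

/-! ### Singular chains modulo boundaries -/

section

open AlgebraicTopology unitInterval Simplicial

/-- The singular chain complex of `X` with integral coefficients. -/
noncomputable abbrev singChain (X : TopCat.{0}) : ChainComplex (ModuleCat.{0} ℤ) ℕ :=
  ((singularChainComplexFunctor (ModuleCat.{0} ℤ)).obj (ModuleCat.of ℤ ℤ)).obj X

/-- Singular `1`-chains of `X` modulo boundaries of `2`-chains. -/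
noncomputable abbrev ChainQuot (X : TopCat.{0}) : ModuleCat.{0} ℤ := (singChain X).opcycles 1

/-- The singular `n`-simplex given by a continuous map. -/
noncomputable def mkSimplex (X : TopCat.{0}) (n : ℕ) (f : C(stdSimplex ℝ (Fin (n + 1)), X)) :
    (TopCat.toSSet.obj X) _⦋n⦌ :=
  (TopCat.toSSetObjEquiv X (.op ⦋n⦌)).symm f

/-- The class of a path in the quotient of chains by boundaries. -/
noncomputable def pathClass (X : TopCat.{0}) (γ : C(I, X)) : ChainQuot X :=
  ((singChain X).pOpcycles 1).hom
    (((TopCat.toSSet.obj X).ιChainComplex (R := ModuleCat.of ℤ ℤ)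
      (mkSimplex X 1 (γ.comp ⟨_, stdSimplexHomeomorphUnitInterval.continuous⟩))).hom (1 : ℤ))

/-- The edge of the standard triangle opposite to the vertex `i`, as a path. -/
noncomputable def simplexEdge (i : Fin 3) : C(I, stdSimplex ℝ (Fin 3)) :=
  ContinuousMap.comp ⟨_, stdSimplex.continuous_map (Fin.succAbove i)⟩
    ⟨_, stdSimplexHomeomorphUnitInterval.symm.continuous⟩

theorem exists_mkSimplex (X : TopCat.{0}) (n : ℕ) (x : (TopCat.toSSet.obj X) _⦋n⦌) :
    ∃ f, x = mkSimplex X n f :=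
  ⟨TopCat.toSSetObjEquiv X (.op ⦋n⦌) x, by simp [mkSimplex]⟩

/-- The `n`-chain of a singular simplex. -/
noncomputable def simplexChain (X : TopCat.{0}) {n : ℕ} (f : C(stdSimplex ℝ (Fin (n + 1)), X)) :
    (singChain X).X n :=
  ((TopCat.toSSet.obj X).ιChainComplex (R := ModuleCat.of ℤ ℤ) (mkSimplex X n f)).hom (1 : ℤ)

theorem pathClass_def (X : TopCat.{0}) (γ : C(I, X)) : pathClass X γ =
    ((singChain X).pOpcycles 1).hom
      (simplexChain X (γ.comp ⟨_, stdSimplexHomeomorphUnitInterval.continuous⟩)) := rfl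

theorem d_simplexChain (X : TopCat.{0}) (n : ℕ) (f : C(stdSimplex ℝ (Fin (n + 2)), X)) :
    ((singChain X).d (n + 1) n).hom (simplexChain X f) =
      ∑ i : Fin (n + 2), (-1 : ℤ) ^ i.val •
        simplexChain X (f.comp ⟨_, stdSimplex.continuous_map (Fin.succAbove i)⟩) := by
  have h := congrArg (fun φ => φ.hom (1 : ℤ))
    ((TopCat.toSSet.obj X).ιChainComplex_d (R := ModuleCat.of ℤ ℤ) (mkSimplex X (n + 1) f))
  simp only [ModuleCat.hom_comp, LinearMap.comp_apply] at h
  refine h.trans ?_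
  rw [ModuleCat.hom_sum, LinearMap.sum_apply]
  rfl

theorem d_simplexChain_two (X : TopCat.{0}) (f : C(stdSimplex ℝ (Fin 3), X)) :
    ((singChain X).d 2 1).hom (simplexChain X f) =
      simplexChain X (f.comp ⟨_, stdSimplex.continuous_map (Fin.succAbove 0)⟩) -
      simplexChain X (f.comp ⟨_, stdSimplex.continuous_map (Fin.succAbove 1)⟩) +
      simplexChain X (f.comp ⟨_, stdSimplex.continuous_map (Fin.succAbove 2)⟩) := by
  rw [d_simplexChain, Fin.sum_univ_three]
  simp [sub_eq_add_neg]

theorem d_simplexChain_one (X : TopCat.{0}) (f : C(stdSimplex ℝ (Fin 2), X)) :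
    ((singChain X).d 1 0).hom (simplexChain X f) =
      simplexChain X (f.comp ⟨_, stdSimplex.continuous_map (Fin.succAbove 0)⟩) -
      simplexChain X (f.comp ⟨_, stdSimplex.continuous_map (Fin.succAbove 1)⟩) := by
  rw [d_simplexChain, Fin.sum_univ_two]
  simp [sub_eq_add_neg]

/-- Homomorphisms out of the singular chains are determined by their values on simplices. -/
noncomputable def chainDesc (X : TopCat.{0}) (n : ℕ) {G : Type} [AddCommGroup G]
    (φ : C(stdSimplex ℝ (Fin (n + 1)), X) → G) : (singChain X).X n ⟶ ModuleCat.of ℤ G :=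
  Limits.Cofan.IsColimit.desc
    ((TopCat.toSSet.obj X).isColimitChainComplexXCofan (ModuleCat.of ℤ ℤ) n)
    fun x => ModuleCat.ofHom (LinearMap.toSpanSingleton ℤ G
      (φ (TopCat.toSSetObjEquiv X (.op ⦋n⦌) x)))

theorem chainDesc_simplexChain (X : TopCat.{0}) (n : ℕ) {G : Type} [AddCommGroup G]
    (φ : C(stdSimplex ℝ (Fin (n + 1)), X) → G) (f) :
    (chainDesc X n φ).hom (simplexChain X f) = φ f := by
  have h := congrArg (fun ψ => ψ.hom (1 : ℤ)) (Limits.Cofan.IsColimit.fac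
    ((TopCat.toSSet.obj X).isColimitChainComplexXCofan (ModuleCat.of ℤ ℤ) n)
    (fun x => ModuleCat.ofHom (LinearMap.toSpanSingleton ℤ G
      (φ (TopCat.toSSetObjEquiv X (.op ⦋n⦌) x)))) (mkSimplex X n f))
  refine h.trans ?_
  simp [mkSimplex]

theorem chain_hom_ext {X : TopCat.{0}} {n : ℕ} {M : ModuleCat.{0} ℤ} {φ ψ : (singChain X).X n ⟶ M}
    (h : ∀ f, φ.hom (simplexChain X f) = ψ.hom (simplexChain X f)) : φ = ψ := by
  refine (TopCat.toSSet.obj X).chainComplex_hom_ext fun x => ?_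
  obtain ⟨f, rfl⟩ := exists_mkSimplex X n x
  refine ModuleCat.hom_ext (LinearMap.ext_ring ?_)
  exact h f

/-- An additive map is `ℤ`-linear for any `ℤ`-module structure on its domain. -/
theorem AddMonoidHom.exists_int_linearMap {M N : Type*} [AddCommGroup M] [h : Module ℤ M]
    [AddCommGroup N] (φ : M →+ N) : ∃ f : M →ₗ[ℤ] N, ∀ x, f x = φ x := by
  refine ⟨⟨φ.toAddHom, fun c y => ?_⟩, fun x => rfl⟩
  change φ (h.smul c y) = c • φ y
  rw [int_smul_eq_zsmul h c y, map_zsmul]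

theorem chain_induction {X : TopCat.{0}} {n : ℕ} {S : AddSubgroup ((singChain X).X n)}
    (h : ∀ f, simplexChain X f ∈ S) (x : (singChain X).X n) : x ∈ S := by
  obtain ⟨f, hf⟩ := (QuotientAddGroup.mk' S).exists_int_linearMap
  have : (ModuleCat.ofHom f : (singChain X).X n ⟶ ModuleCat.of ℤ _) = 0 := by
    apply chain_hom_ext
    intro g
    exact (hf _).trans ((QuotientAddGroup.eq_zero_iff _).2 (h g))
  have h2 := congrArg (fun φ => φ.hom x) this
  exact (QuotientAddGroup.eq_zero_iff x).1 ((hf x).symm.trans h2)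

theorem pOpcycles_surjective (X : TopCat.{0}) :
    Function.Surjective ((singChain X).pOpcycles 1).hom :=
  (ModuleCat.epi_iff_surjective _).1 inferInstance

theorem comp_homeo (X : TopCat.{0}) (f : C(stdSimplex ℝ (Fin 2), X)) :
    ((f.comp ⟨_, stdSimplexHomeomorphUnitInterval.symm.continuous⟩).comp
      ⟨_, stdSimplexHomeomorphUnitInterval.continuous⟩) = f := by
  ext x; simp

theorem ChainQuot.induction {X : TopCat.{0}} {S : AddSubgroup (ChainQuot X)}
    (h : ∀ γ, pathClass X γ ∈ S) (x : ChainQuot X) : x ∈ S := by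
  obtain ⟨c, rfl⟩ := pOpcycles_surjective X x
  refine chain_induction (S := S.comap ((singChain X).pOpcycles 1).hom.toAddMonoidHom) ?_ c
  intro f
  have := h (f.comp ⟨_, stdSimplexHomeomorphUnitInterval.symm.continuous⟩)
  rw [pathClass_def, comp_homeo] at this
  exact this

theorem ChainQuot.hom_ext {X : TopCat.{0}} {G : Type*} [AddCommGroup G] {φ ψ : ChainQuot X →+ G}
    (h : ∀ γ, φ (pathClass X γ) = ψ (pathClass X γ)) : φ = ψ := by
  ext x
  have := ChainQuot.induction (S := (φ - ψ).ker) (fun γ => by simp [AddMonoidHom.mem_ker, h]) x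
  simpa [AddMonoidHom.mem_ker, sub_eq_zero] using this

/-- The boundary of a singular triangle vanishes in the quotient. -/
theorem pathClass_triangle (X : TopCat.{0}) (f : C(stdSimplex ℝ (Fin 3), X)) :
    pathClass X (f.comp (simplexEdge 2)) + pathClass X (f.comp (simplexEdge 0)) =
      pathClass X (f.comp (simplexEdge 1)) := by
  have h := congrArg (fun φ => φ.hom (simplexChain X f)) ((singChain X).d_pOpcycles 2 1)
  simp only [ModuleCat.hom_comp, LinearMap.comp_apply] at h
  rw [d_simplexChain_two, map_add, map_sub] at h
  have e (i : Fin 3) : pathClass X (f.comp (simplexEdge i)) = ((singChain X).pOpcycles 1).hom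
      (simplexChain X (f.comp ⟨_, stdSimplex.continuous_map (Fin.succAbove i)⟩)) := by
    rw [pathClass_def]
    congr 2
    ext x
    simp [simplexEdge]
  rw [← e 0, ← e 1, ← e 2] at h
  have h' : pathClass X (f.comp (simplexEdge 0)) - pathClass X (f.comp (simplexEdge 1)) +
    pathClass X (f.comp (simplexEdge 2)) = 0 := h
  rw [add_comm, ← sub_eq_zero, ← h']
  abel

theorem d_chainDesc_eq_zero (X : TopCat.{0}) {G : Type} [AddCommGroup G] (φ : C(I, X) → G)
    (hφ : ∀ f : C(stdSimplex ℝ (Fin 3), X),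
      φ (f.comp (simplexEdge 2)) + φ (f.comp (simplexEdge 0)) = φ (f.comp (simplexEdge 1))) :
    (singChain X).d 2 1 ≫ chainDesc X 1 (fun f =>
      φ (f.comp ⟨_, stdSimplexHomeomorphUnitInterval.symm.continuous⟩)) = 0 := by
  apply chain_hom_ext
  intro f
  rw [ModuleCat.hom_comp, LinearMap.comp_apply, d_simplexChain_two, map_add, map_sub,
    chainDesc_simplexChain, chainDesc_simplexChain, chainDesc_simplexChain]
  change φ (f.comp (simplexEdge 0)) - φ (f.comp (simplexEdge 1)) + φ (f.comp (simplexEdge 2)) = 0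
  rw [← hφ f]
  abel

/-- A function on paths that is additive along the edges of every singular triangle extends to a
homomorphism on chains modulo boundaries. -/
noncomputable def chainQuotLift (X : TopCat.{0}) {G : Type} [AddCommGroup G] (φ : C(I, X) → G)
    (hφ : ∀ f : C(stdSimplex ℝ (Fin 3), X),
      φ (f.comp (simplexEdge 2)) + φ (f.comp (simplexEdge 0)) = φ (f.comp (simplexEdge 1))) :
    ChainQuot X →+ G :=
  ((singChain X).descOpcycles _ 2 (by simp) (d_chainDesc_eq_zero X φ hφ)).hom.toAddMonoidHom

theorem chainQuotLift_pathClass (X : TopCat.{0}) {G : Type} [AddCommGroup G] (φ : C(I, X) → G)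
    (hφ) (γ : C(I, X)) : chainQuotLift X φ hφ (pathClass X γ) = φ γ := by
  have h := congrArg (fun ψ => ψ.hom
    (simplexChain X (γ.comp ⟨_, stdSimplexHomeomorphUnitInterval.continuous⟩)))
    ((singChain X).p_descOpcycles _ 2 (by simp) (d_chainDesc_eq_zero X φ hφ))
  rw [ModuleCat.hom_comp, LinearMap.comp_apply, chainDesc_simplexChain] at h
  refine h.trans (congrArg φ ?_)
  ext x
  simp

/-- The map on chains modulo boundaries that is induced by a continuous map. -/
noncomputable def chainQuotMap {X Y : TopCat.{0}} (g : X ⟶ Y) : ChainQuot X →+ ChainQuot Y :=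
  (HomologicalComplex.opcyclesMap (((singularChainComplexFunctor (ModuleCat.{0} ℤ)).obj
    (ModuleCat.of ℤ ℤ)).map g) 1).hom.toAddMonoidHom

theorem chainQuotMap_pathClass {X Y : TopCat.{0}} (g : X ⟶ Y) (γ : C(I, X)) :
    chainQuotMap g (pathClass X γ) = pathClass Y (g.hom.comp γ) := by
  have h := congrArg (fun ψ => ψ.hom
    (simplexChain X (γ.comp ⟨_, stdSimplexHomeomorphUnitInterval.continuous⟩)))
    (HomologicalComplex.p_opcyclesMap (((singularChainComplexFunctor (ModuleCat.{0} ℤ)).obj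
    (ModuleCat.of ℤ ℤ)).map g) 1)
  rw [ModuleCat.hom_comp, LinearMap.comp_apply, ModuleCat.hom_comp, LinearMap.comp_apply] at h
  refine h.trans ?_
  rw [pathClass_def]
  congr 1
  exact congrArg (fun ψ => ψ.hom (1 : ℤ)) (SSet.ι_chainComplexMap_f _ _
    (f := TopCat.toSSet.map g) (R := ModuleCat.of ℤ ℤ)
    (mkSimplex X 1 (γ.comp ⟨_, stdSimplexHomeomorphUnitInterval.continuous⟩)))

/-- The first homology embeds into chains modulo boundaries. -/
noncomputable def h1Incl (X : TopCat.{0}) : singularH1.obj X →+ ChainQuot X :=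
  ((singChain X).homologyι 1).hom.toAddMonoidHom

theorem h1Incl_injective (X : TopCat.{0}) : Function.Injective (h1Incl X) :=
  (ModuleCat.mono_iff_injective ((singChain X).homologyι 1)).1 inferInstance

theorem h1Incl_map {X Y : TopCat.{0}} (g : X ⟶ Y) (x : singularH1.obj X) :
    h1Incl Y ((singularH1.map g).hom x) = chainQuotMap g (h1Incl X x) :=
  congrArg (fun ψ => ψ.hom x) (HomologicalComplex.homologyι_naturality
    (((singularChainComplexFunctor (ModuleCat.{0} ℤ)).obj (ModuleCat.of ℤ ℤ)).map g) 1)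

theorem edge_vertices {X : Type*} [TopologicalSpace X] (f : C(stdSimplex ℝ (Fin 3), X)) :
    (f.comp (simplexEdge 2)) 0 = (f.comp (simplexEdge 1)) 0 ∧
    (f.comp (simplexEdge 2)) 1 = (f.comp (simplexEdge 0)) 0 ∧
    (f.comp (simplexEdge 0)) 1 = (f.comp (simplexEdge 1)) 1 := by
  have h0 : stdSimplexHomeomorphUnitInterval.symm 0 = stdSimplex.vertex 0 :=
    (Homeomorph.symm_apply_eq _).2 stdSimplexHomeomorphUnitInterval_zero.symm
  have h1 : stdSimplexHomeomorphUnitInterval.symm 1 = stdSimplex.vertex 1 :=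
    (Homeomorph.symm_apply_eq _).2 stdSimplexHomeomorphUnitInterval_one.symm
  simp only [simplexEdge, ContinuousMap.comp_apply, ContinuousMap.coe_mk, h0, h1,
    stdSimplex.map_vertex]
  exact ⟨rfl, rfl, rfl⟩

/-- The boundary of a `1`-chain. -/
noncomputable def chainBoundary (X : TopCat.{0}) : ChainQuot X →+ (X →₀ ℤ) :=
  chainQuotLift X (fun γ => Finsupp.single (γ 1) 1 - Finsupp.single (γ 0) 1) fun f => by
    obtain ⟨h1, h2, h3⟩ := edge_vertices f
    rw [h1, h2, h3]
    abel

theorem chainBoundary_pathClass (X : TopCat.{0}) (γ : C(I, X)) : chainBoundary X (pathClass X γ) =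
    Finsupp.single (γ 1) 1 - Finsupp.single (γ 0) 1 :=
  chainQuotLift_pathClass _ _ _ _

/-- A class of chains modulo boundaries is a homology class if and only if its boundary, a finite
formal combination of points, vanishes. -/
theorem range_h1Incl (X : TopCat.{0}) : (h1Incl X).range = (chainBoundary X).ker := by
  -- The boundary factors through the injection of `0`-chains into finitely supported functions.
  let v (x : X) : (singChain X).X 0 := simplexChain X (ContinuousMap.const _ x)
  let ev : (singChain X).X 0 ⟶ ModuleCat.of ℤ (X →₀ ℤ) :=
    chainDesc X 0 fun f => Finsupp.single (f (stdSimplex.vertex (S := ℝ) 0)) 1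
  let back : (X →₀ ℤ) →+ (singChain X).X 0 :=
    Finsupp.liftAddHom fun x => (zmultiplesHom _ (v x))
  have hv (f : C(stdSimplex ℝ (Fin 1), X)) :
      simplexChain X f = v (f (stdSimplex.vertex (S := ℝ) 0)) := by
    refine congrArg _ (ContinuousMap.ext fun x => congrArg f ?_)
    exact Subsingleton.elim (α := stdSimplex ℝ (Fin 1)) _ _
  have hback (c : (singChain X).X 0) : back (ev.hom c) = c := by
    have : c ∈ (back.comp ev.hom.toAddMonoidHom - AddMonoidHom.id _).ker := by
      refine chain_induction (fun f => ?_) c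
      have : ev.hom (simplexChain X f) = Finsupp.single (f (stdSimplex.vertex (S := ℝ) 0)) 1 :=
        chainDesc_simplexChain X 0 _ f
      simp [AddMonoidHom.mem_ker, this, back, ← hv]
    simpa [AddMonoidHom.mem_ker, sub_eq_zero] using this
  have hbd (x : ChainQuot X) : chainBoundary X x =
      ev.hom (((singChain X).fromOpcycles 1 0).hom x) := by
    refine DFunLike.congr_fun (f := chainBoundary X)
      (g := ev.hom.toAddMonoidHom.comp ((singChain X).fromOpcycles 1 0).hom.toAddMonoidHom)
      (ChainQuot.hom_ext fun γ => ?_) x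
    rw [chainBoundary_pathClass]
    have h := congrArg (fun ψ => ψ.hom
      (simplexChain X (γ.comp ⟨_, stdSimplexHomeomorphUnitInterval.continuous⟩)))
      ((singChain X).p_fromOpcycles 1 0)
    rw [d_simplexChain_one] at h
    refine Eq.trans ?_ (congrArg ev.hom h).symm
    rw [map_sub]
    erw [chainDesc_simplexChain, chainDesc_simplexChain]
    simp only [ContinuousMap.comp_apply, ContinuousMap.coe_mk, stdSimplex.map_vertex]
    rw [show Fin.succAbove (0 : Fin 2) 0 = 1 from rfl,
      show Fin.succAbove (1 : Fin 2) 0 = 0 from rfl,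
      stdSimplexHomeomorphUnitInterval_zero, stdSimplexHomeomorphUnitInterval_one]
  have hex : Function.Exact ((singChain X).homologyι 1).hom ((singChain X).fromOpcycles 1 0).hom :=
    (ShortComplex.ShortExact.moduleCat_exact_iff_function_exact _).1
      (ShortComplex.exact_of_f_is_kernel (ShortComplex.mk _ _
        ((singChain X).homologyι_comp_fromOpcycles 1 0))
        ((singChain X).homologyIsKernel 1 0 (by simp)))
  ext x
  rw [AddMonoidHom.mem_ker, hbd]
  constructor
  · rintro ⟨y, rfl⟩
    have := (hex _).2 ⟨y, rfl⟩
    exact (congrArg ev.hom this).trans (map_zero _)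
  · intro h
    refine (hex x).1 ?_
    rw [← hback (((singChain X).fromOpcycles 1 0).hom x), h, map_zero]

end

/-! ### Homologies between paths -/

section

open AlgebraicTopology unitInterval

theorem simplexEdge_apply (t : I) :
    (∀ j, (simplexEdge 2 t).1 j = ![1 - (t : ℝ), t, 0] j) ∧
    (∀ j, (simplexEdge 0 t).1 j = ![0, 1 - (t : ℝ), t] j) ∧
    (∀ j, (simplexEdge 1 t).1 j = ![1 - (t : ℝ), 0, t] j) := by
  have h (i j : Fin 3) : (simplexEdge i t).1 j =
      ∑ k : Fin 2, if Fin.succAbove i k = j then ![1 - (t : ℝ), t] k else 0 := by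
    rw [← Finset.sum_filter]
    simp only [simplexEdge, stdSimplex.map, FunOnFinite.linearMap_apply_apply,
      ContinuousMap.comp_apply, ContinuousMap.coe_mk]
    rfl
  refine ⟨fun j => ?_, fun j => ?_, fun j => ?_⟩ <;> rw [h, Fin.sum_univ_two] <;>
    fin_cases j <;> simp [Fin.succAbove, Fin.lt_def]

theorem stdSimplex.continuous_coord (i : Fin 3) :
    Continuous fun x : stdSimplex ℝ (Fin 3) => x.1 i :=
  (continuous_apply i).comp continuous_subtype_val

/-- Opposite sides of a singular square: the boundary of a square vanishes. -/
theorem pathClass_square (X : TopCat.{0}) (K : C(I × I, X)) :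
    pathClass X (K.comp ⟨fun t => (t, 0), by fun_prop⟩) +
      pathClass X (K.comp ⟨fun t => (1, t), by fun_prop⟩) =
    pathClass X (K.comp ⟨fun t => (0, t), by fun_prop⟩) +
      pathClass X (K.comp ⟨fun t => (t, 1), by fun_prop⟩) := by
  have hmem (x : stdSimplex ℝ (Fin 3)) : x.1 1 + x.1 2 ∈ I ∧ x.1 2 ∈ I := by
    have h := x.2.2
    rw [Fin.sum_univ_three] at h
    have h0 := x.2.1 0
    have h1 := x.2.1 1
    have h2 := x.2.1 2
    exact ⟨⟨by linarith, by linarith⟩, ⟨by linarith, by linarith⟩⟩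
  -- the two triangles into which the diagonal divides the square
  let a : C(stdSimplex ℝ (Fin 3), I × I) :=
    ⟨fun x => (⟨_, (hmem x).1⟩, ⟨_, (hmem x).2⟩),
      (((stdSimplex.continuous_coord 1).add (stdSimplex.continuous_coord 2)).subtype_mk _).prodMk <|
      (stdSimplex.continuous_coord 2).subtype_mk _⟩
  let b : C(stdSimplex ℝ (Fin 3), I × I) :=
    ⟨fun x => (⟨_, (hmem x).2⟩, ⟨_, (hmem x).1⟩),
      ((stdSimplex.continuous_coord 2).subtype_mk _).prodMk <|
      ((stdSimplex.continuous_coord 1).add (stdSimplex.continuous_coord 2)).subtype_mk _⟩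
  have ha := pathClass_triangle X (K.comp a)
  have hb := pathClass_triangle X (K.comp b)
  have hd : (K.comp a).comp (simplexEdge 1) = (K.comp b).comp (simplexEdge 1) := by
    ext t
    obtain ⟨_, _, h⟩ := simplexEdge_apply t
    simp [a, b, h]
  rw [hd, ← hb] at ha
  convert ha using 3 <;>
  · ext t
    obtain ⟨h2, h0, _⟩ := simplexEdge_apply t
    refine congrArg K (Prod.ext (Subtype.ext ?_) (Subtype.ext ?_)) <;> simp [a, b, h2, h0]

theorem pathClass_const (X : TopCat.{0}) (x : X) : pathClass X (.const _ x) = 0 := by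
  have h := pathClass_triangle X (.const _ x)
  exact left_eq_add.1 h.symm

/-- The straight segment from `a` to `b`. -/
def segmentPath {E : Type*} [AddCommGroup E] [Module ℝ E] [TopologicalSpace E]
    [IsTopologicalAddGroup E] [ContinuousSMul ℝ E] (a b : E) : C(I, E) :=
  ⟨fun t => a + (t : ℝ) • (b - a), by fun_prop⟩

section Segment

variable {X : TopCat.{0}} {E : Type*} [AddCommGroup E] [Module ℝ E] [TopologicalSpace E]
    [IsTopologicalAddGroup E] [ContinuousSMul ℝ E] (φ : C(E, X))

theorem pathClass_segment_add (a b c : E) :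
    pathClass X (φ.comp (segmentPath a b)) + pathClass X (φ.comp (segmentPath b c)) =
      pathClass X (φ.comp (segmentPath a c)) := by
  let T : C(stdSimplex ℝ (Fin 3), E) :=
    ⟨fun x => x.1 0 • a + x.1 1 • b + x.1 2 • c,
      (((stdSimplex.continuous_coord 0).smul continuous_const).add
        ((stdSimplex.continuous_coord 1).smul continuous_const)).add
        ((stdSimplex.continuous_coord 2).smul continuous_const)⟩
  convert pathClass_triangle X (φ.comp T) using 3 <;>
  · ext t
    obtain ⟨h2, h0, h1⟩ := simplexEdge_apply t
    refine congrArg φ ?_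
    simp [T, h2, h0, h1, segmentPath, smul_sub, sub_smul]
    try abel

theorem pathClass_segment_self (a : E) : pathClass X (φ.comp (segmentPath a a)) = 0 := by
  have h := pathClass_segment_add φ a a a
  exact left_eq_add.1 h.symm

end Segment

/-! ### Logarithms along paths and winding numbers -/

/-- A nowhere vanishing function on a simply connected space has a continuous logarithm. -/
theorem exists_continuous_log {A : Type*} [TopologicalSpace A] [SimplyConnectedSpace A]
    [LocallyPathConnectedSpace A] (f : C(A, ℂ)) (hf : ∀ a, f a ≠ 0) :
    ∃ G : C(A, ℂ), ∀ a, Complex.exp (G a) = f a := by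
  obtain ⟨a₀⟩ : Nonempty A := inferInstance
  obtain ⟨G, ⟨-, hG⟩, -⟩ := Complex.isCoveringMapOn_exp.existsUnique_continuousMap_lifts f
    (a₀ := a₀) (Complex.exp_log (hf a₀)) (by simpa using hf)
  exact ⟨G, congrFun hG⟩

/-- The increment of a continuous logarithm along a path in the punctured plane; the value `0` if
the path is not in the punctured plane plays no role. -/
noncomputable def logIncrement (γ : C(I, ℂ)) : ℂ :=
  open Classical in
  if h : ∃ G : C(I, ℂ), ∀ t, Complex.exp (G t) = γ t then h.choose 1 - h.choose 0 else 0

instance : SimplyConnectedSpace I :=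
  have := (convex_Icc (0 : ℝ) 1).contractibleSpace ⟨0, by simp⟩
  inferInstanceAs (SimplyConnectedSpace (Icc (0 : ℝ) 1))

instance : LocallyPathConnectedSpace I :=
  (convex_Icc (0 : ℝ) 1).locallyPathConnectedSpace

theorem logIncrement_eq {γ G : C(I, ℂ)} (hG : ∀ t, Complex.exp (G t) = γ t) :
    logIncrement γ = G 1 - G 0 := by
  have h : ∃ G : C(I, ℂ), ∀ t, Complex.exp (G t) = γ t := ⟨G, hG⟩
  rw [logIncrement, dif_pos h]
  have hs := h.choose_spec
  set H := h.choose
  have h0 : Complex.exp (H 0 - G 0) = 1 := by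
    rw [Complex.exp_sub, hs, hG, div_self]
    rw [← hG]
    exact Complex.exp_ne_zero _
  have key : H = G + .const _ (H 0 - G 0) := by
    obtain ⟨K, -, hK⟩ := Complex.isCoveringMapOn_exp.existsUnique_continuousMap_lifts γ
      (a₀ := 0) (hs 0) (fun t => by rw [← hG]; simp)
    refine (hK H ⟨rfl, funext hs⟩).trans (hK _ ⟨by simp, funext fun t => ?_⟩).symm
    simp [Complex.exp_add, h0, hG]
  have := DFunLike.congr_fun key 1
  simp only [ContinuousMap.add_apply, ContinuousMap.const_apply] at this
  rw [this]
  ring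

instance : SimplyConnectedSpace (stdSimplex ℝ (Fin 3)) :=
  have := (convex_stdSimplex ℝ (Fin 3)).contractibleSpace ⟨_, single_mem_stdSimplex ℝ 0⟩
  inferInstance

instance : LocallyPathConnectedSpace (stdSimplex ℝ (Fin 3)) :=
  (convex_stdSimplex ℝ (Fin 3)).locallyPathConnectedSpace

/-- `2πi` times the winding number around `0`, as a cocycle, of a nowhere vanishing function. -/
noncomputable def winding {X : TopCat.{0}} (f : C(X, ℂ)) (hf : ∀ x, f x ≠ 0) : ChainQuot X →+ ℂ :=
  chainQuotLift X (fun γ => logIncrement (f.comp γ)) fun s => by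
    obtain ⟨G, hG⟩ := exists_continuous_log (f.comp s) fun a => hf _
    have h (i) : logIncrement (f.comp (s.comp (simplexEdge i))) =
        (G.comp (simplexEdge i)) 1 - (G.comp (simplexEdge i)) 0 :=
      logIncrement_eq fun t => hG _
    obtain ⟨h1, h2, h3⟩ := edge_vertices G
    rw [h, h, h, h1, h2, h3]
    ring

theorem winding_pathClass {X : TopCat.{0}} {f : C(X, ℂ)} (hf : ∀ x, f x ≠ 0) {γ : C(I, X)}
    (G : C(I, ℂ)) (hG : ∀ t, Complex.exp (G t) = f (γ t)) :
    winding f hf (pathClass X γ) = G 1 - G 0 :=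
  (chainQuotLift_pathClass _ _ _ _).trans (logIncrement_eq hG)

theorem winding_pathClass' {X : TopCat.{0}} {f : C(X, ℂ)} (hf : ∀ x, f x ≠ 0) (γ : C(I, X)) :
    winding f hf (pathClass X γ) = logIncrement (f.comp γ) :=
  chainQuotLift_pathClass _ _ _ _

theorem winding_chainQuotMap {X Y : TopCat.{0}} (g : X ⟶ Y) {f : C(Y, ℂ)} (hf : ∀ x, f x ≠ 0)
    {f' : C(X, ℂ)} (hf' : ∀ x, f' x ≠ 0) (h : ∀ x, f' x = f (g x)) (c : ChainQuot X) :
    winding f hf (chainQuotMap g c) = winding f' hf' c := by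
  refine DFunLike.congr_fun (f := (winding f hf).comp (chainQuotMap g)) (g := winding f' hf')
    (ChainQuot.hom_ext fun γ => ?_) c
  rw [AddMonoidHom.comp_apply, chainQuotMap_pathClass, winding_pathClass', winding_pathClass']
  congr 1
  ext t
  exact (h _).symm

end

/-! ### Winding numbers of parallelograms -/

section

open AlgebraicTopology unitInterval

theorem logIncrement_square (K : C(I × I, ℂ)) (hK : ∀ x, K x ≠ 0) :
    logIncrement (K.comp ⟨fun t => (t, 0), by fun_prop⟩) +
      logIncrement (K.comp ⟨fun t => (1, t), by fun_prop⟩) =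
    logIncrement (K.comp ⟨fun t => (0, t), by fun_prop⟩) +
      logIncrement (K.comp ⟨fun t => (t, 1), by fun_prop⟩) := by
  have h := congrArg (winding (X := TopCat.of (I × I)) K hK)
    (pathClass_square (TopCat.of (I × I)) (.id _))
  rw [map_add, map_add] at h
  erw [winding_pathClass', winding_pathClass', winding_pathClass', winding_pathClass'] at h
  exact h

theorem segmentPath_apply {E : Type*} [AddCommGroup E] [Module ℝ E] [TopologicalSpace E]
    [IsTopologicalAddGroup E] [ContinuousSMul ℝ E] (a b : E) (t : I) :
    segmentPath a b t = a + (t : ℝ) • (b - a) := rfl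

/-- The increment of the logarithm around the parallelogram at `a` spanned by `A` and `B`. -/
noncomputable def parallelogramIncrement (a A B : ℂ) : ℂ :=
  logIncrement (segmentPath a (a + A)) + logIncrement (segmentPath (a + A) (a + A + B)) -
    logIncrement (segmentPath (a + B) (a + A + B)) - logIncrement (segmentPath a (a + B))

theorem parallelogramIncrement_eq_zero {a A B : ℂ}
    (h : ∀ s t : I, a + (s : ℝ) * A + (t : ℝ) * B ≠ 0) : parallelogramIncrement a A B = 0 := by
  have := logIncrement_square ⟨fun x => a + (x.1 : ℝ) * A + (x.2 : ℝ) * B, by fun_prop⟩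
    fun x => h x.1 x.2
  rw [parallelogramIncrement, sub_sub, sub_eq_zero, add_comm (logIncrement _)
    (logIncrement (segmentPath a (a + B)))]
  convert this using 3 <;> ext t <;> simp [segmentPath]
  ring

theorem logIncrement_segment {a b : ℂ} (h : ∀ t : I, segmentPath a b t ∈ Complex.slitPlane) :
    logIncrement (segmentPath a b) = Complex.log b - Complex.log a := by
  rw [logIncrement_eq (G := ⟨fun t => Complex.log (segmentPath a b t),
    (segmentPath a b).continuous.clog h⟩) fun t =>
      Complex.exp_log (Complex.slitPlane_ne_zero (h t))]
  simp [segmentPath]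

theorem logIncrement_segment_neg {a b : ℂ}
    (h : ∀ t : I, -segmentPath a b t ∈ Complex.slitPlane) :
    logIncrement (segmentPath a b) = Complex.log (-b) - Complex.log (-a) := by
  rw [logIncrement_eq (G := ⟨fun t => Complex.log (-segmentPath a b t) + Real.pi * Complex.I,
    ((segmentPath a b).continuous.neg.clog h).add continuous_const⟩) fun t => ?_]
  · have h0 : segmentPath a b 0 = a := by simp [segmentPath]
    have h1 : segmentPath a b 1 = b := by simp [segmentPath]
    simp only [ContinuousMap.coe_mk, h0, h1]
    ring
  · simp [Complex.exp_add, Complex.exp_log (Complex.slitPlane_ne_zero (h t))]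

/-- The boundary of a rectangle around `0` winds once around `0`: the principal branch of the
logarithm serves on three sides, and its continuation to the negative half plane on the fourth. -/
theorem parallelogramIncrement_rectangle {a : ℂ} {m k : ℝ} (h1 : a.re < 0) (h2 : 0 < a.re + m)
    (h3 : a.im < 0) (h4 : 0 < a.im + k) :
    parallelogramIncrement a m (k * Complex.I) = 2 * Real.pi * Complex.I := by
  have e1 : logIncrement (segmentPath a (a + m)) = Complex.log (a + m) - Complex.log a := by
    refine logIncrement_segment fun t => Or.inr (ne_of_lt ?_)
    simpa [segmentPath] using h3
  have e2 : logIncrement (segmentPath (a + m) (a + m + k * Complex.I)) =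
      Complex.log (a + m + k * Complex.I) - Complex.log (a + m) := by
    refine logIncrement_segment fun t => Or.inl ?_
    simpa [segmentPath] using h2
  have e3 : logIncrement (segmentPath (a + k * Complex.I) (a + m + k * Complex.I)) =
      Complex.log (a + m + k * Complex.I) - Complex.log (a + k * Complex.I) := by
    refine logIncrement_segment fun t => Or.inr (ne_of_gt ?_)
    simpa [segmentPath] using h4
  have e4 : logIncrement (segmentPath a (a + k * Complex.I)) =
      Complex.log (-(a + k * Complex.I)) - Complex.log (-a) := by
    refine logIncrement_segment_neg fun t => Or.inl ?_
    simpa [segmentPath] using h1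
  have e5 : Complex.log (-(a + k * Complex.I)) =
      Complex.log (a + k * Complex.I) - Real.pi * Complex.I := by
    rw [Complex.log, Complex.log, norm_neg,
      Complex.arg_neg_eq_arg_sub_pi_of_im_pos (by simpa using h4)]
    push_cast
    ring
  have e6 : Complex.log (-a) = Complex.log a + Real.pi * Complex.I := by
    rw [Complex.log, Complex.log, norm_neg, Complex.arg_neg_eq_arg_add_pi_of_im_neg h3]
    push_cast
    ring
  rw [parallelogramIncrement, e1, e2, e3, e4, e5, e6]
  ring

/-! ### Winding numbers around the Gaussian integers -/

/-- The point `p₁ + p₂ i` of the Gaussian lattice. -/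
noncomputable def latticePoint : ℤ × ℤ →+ ℂ where
  toFun p := p.1 + p.2 * Complex.I
  map_zero' := by simp
  map_add' p q := by push_cast [Prod.fst_add, Prod.snd_add]; ring

theorem latticePoint_re (p : ℤ × ℤ) : (latticePoint p).re = p.1 := by simp [latticePoint]
theorem latticePoint_im (p : ℤ × ℤ) : (latticePoint p).im = p.2 := by simp [latticePoint]

theorem finite_latticePoint_norm_le (R : ℝ) : {p : ℤ × ℤ | ‖latticePoint p‖ ≤ R}.Finite := by
  refine Set.Finite.subset (s := Set.Icc (-⌈R⌉) ⌈R⌉ ×ˢ Set.Icc (-⌈R⌉) ⌈R⌉)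
    ((Set.finite_Icc _ _).prod (Set.finite_Icc _ _)) fun p hp => ?_
  have h1 := (Complex.abs_re_le_norm (latticePoint p)).trans (hp.trans (Int.le_ceil R))
  have h2 := (Complex.abs_im_le_norm (latticePoint p)).trans (hp.trans (Int.le_ceil R))
  rw [latticePoint_re] at h1
  rw [latticePoint_im] at h2
  exact ⟨abs_le.1 (by exact_mod_cast h1), abs_le.1 (by exact_mod_cast h2)⟩

section LatticeWinding

variable {X : TopCat.{0}} (F : C(X, ℂ)) (hF : ∀ x p, F x ≠ latticePoint p)

/-- The winding cocycle around a point of the Gaussian lattice. -/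
noncomputable def latticeWinding (p : ℤ × ℤ) : ChainQuot X →+ ℂ :=
  winding (F - .const _ (latticePoint p)) fun x => by simpa [sub_eq_zero] using hF x p

/-- Around a distant lattice point `p`, the logarithm of `F - p` has a branch on a given chain, so
the winding cocycle is a coboundary there. -/
theorem exists_latticeWinding_eq (c : ChainQuot X) : ∃ R : ℝ, ∀ p, R < ‖latticePoint p‖ →
    latticeWinding F hF p c = Finsupp.liftAddHom (fun x : X =>
      zmultiplesHom ℂ (Complex.log (1 + -(F x / latticePoint p)))) (chainBoundary X c) := by
  let S : AddSubgroup (ChainQuot X) :=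
    { carrier := {c | ∃ R : ℝ, ∀ p, R < ‖latticePoint p‖ →
        latticeWinding F hF p c = Finsupp.liftAddHom (fun x : X =>
          zmultiplesHom ℂ (Complex.log (1 + -(F x / latticePoint p)))) (chainBoundary X c)}
      zero_mem' := ⟨0, fun p _ => by simp only [map_zero]⟩
      add_mem' := by
        rintro c d ⟨R, hR⟩ ⟨R', hR'⟩
        refine ⟨max R R', fun p hp => ?_⟩
        rw [map_add, hR p ((le_max_left _ _).trans_lt hp),
          hR' p ((le_max_right _ _).trans_lt hp), map_add, map_add]
      neg_mem' := by
        rintro c ⟨R, hR⟩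
        refine ⟨R, fun p hp => ?_⟩
        rw [map_neg, hR p hp, map_neg, map_neg] }
  refine ChainQuot.induction (S := S) (fun γ => ?_) c
  obtain ⟨R, hR⟩ := (isCompact_range (F.comp γ).continuous).isBounded.exists_norm_le
  refine ⟨max R 0, fun p hp => ?_⟩
  have hp0 : latticePoint p ≠ 0 := norm_pos_iff.1 ((le_max_right _ _).trans_lt hp)
  have hs (t : I) : 1 + -(F (γ t) / latticePoint p) ∈ Complex.slitPlane := by
    refine Complex.mem_slitPlane_of_norm_lt_one ?_
    rw [norm_neg, norm_div, div_lt_one (norm_pos_iff.2 hp0)]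
    exact (hR _ ⟨t, rfl⟩).trans_lt ((le_max_left _ _).trans_lt hp)
  have hG := winding_pathClass (f := F - .const _ (latticePoint p))
    (fun x => by simpa [sub_eq_zero] using hF x p) (γ := γ)
    ⟨fun t => Complex.log (1 + -(F (γ t) / latticePoint p)) + Complex.log (-latticePoint p),
      (Continuous.clog (by fun_prop) hs).add continuous_const⟩ fun t => by
        simp only [ContinuousMap.coe_mk, Complex.exp_add,
          Complex.exp_log (Complex.slitPlane_ne_zero (hs t)), Complex.exp_log (neg_ne_zero.2 hp0),
          ContinuousMap.sub_apply, ContinuousMap.const_apply]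
        field_simp
        ring
  rw [chainBoundary_pathClass, map_sub]
  refine hG.trans ?_
  simp

theorem latticeWinding_finite {c : ChainQuot X} (hc : chainBoundary X c = 0) :
    (Function.support fun p => latticeWinding F hF p c).Finite := by
  obtain ⟨R, hR⟩ := exists_latticeWinding_eq F hF c
  refine (finite_latticePoint_norm_le R).subset fun p hp => ?_
  by_contra hlt
  exact hp ((hR p (not_le.1 hlt)).trans (by rw [hc, map_zero]))

theorem latticeWinding_chainQuotMap (g : X ⟶ X) {l : ℤ × ℤ}
    (hg : ∀ x, F (g x) = F x + latticePoint l) (p : ℤ × ℤ) (c : ChainQuot X) :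
    latticeWinding F hF p (chainQuotMap g c) = latticeWinding F hF (p - l) c := by
  refine winding_chainQuotMap g _ _ (fun x => ?_) c
  simp only [ContinuousMap.sub_apply, ContinuousMap.const_apply, hg, map_sub]
  ring

theorem latticeWinding_pathClass (p : ℤ × ℤ) {γ : C(I, X)} {a b : ℂ}
    (h : ∀ t, F (γ t) = segmentPath a b t) : latticeWinding F hF p (pathClass X γ) =
      logIncrement (segmentPath (a - latticePoint p) (b - latticePoint p)) := by
  rw [latticeWinding, winding_pathClass']
  congr 1
  ext t
  simp [h, segmentPath]
  ring

/-- A chain whose image under `F` is the boundary of a parallelogram. -/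
def MapsToParallelogram (c : ChainQuot X) (a A B : ℂ) : Prop :=
  ∃ γ₁ γ₂ γ₃ γ₄ : C(I, X),
    c = pathClass X γ₁ + pathClass X γ₂ - pathClass X γ₃ - pathClass X γ₄ ∧
    (∀ t, F (γ₁ t) = segmentPath a (a + A) t) ∧
    (∀ t, F (γ₂ t) = segmentPath (a + A) (a + A + B) t) ∧
    (∀ t, F (γ₃ t) = segmentPath (a + B) (a + A + B) t) ∧
    (∀ t, F (γ₄ t) = segmentPath a (a + B) t)

variable {F}

theorem MapsToParallelogram.latticeWinding {c : ChainQuot X} {a A B : ℂ}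
    (h : MapsToParallelogram F c a A B) (p : ℤ × ℤ) :
    latticeWinding F hF p c = parallelogramIncrement (a - latticePoint p) A B := by
  obtain ⟨γ₁, γ₂, γ₃, γ₄, rfl, h₁, h₂, h₃, h₄⟩ := h
  rw [map_sub, map_sub, map_add, latticeWinding_pathClass F hF p h₁,
    latticeWinding_pathClass F hF p h₂, latticeWinding_pathClass F hF p h₃,
    latticeWinding_pathClass F hF p h₄, parallelogramIncrement]
  congr 4 <;> ring_nf

/-- The total winding number around all lattice points. -/
noncomputable def latticeTotal (hF : ∀ x p, F x ≠ latticePoint p) (c : ChainQuot X) : ℂ :=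
  ∑ᶠ p, _root_.latticeWinding F hF p c

/-- The lattice points inside the rectangle are `0, …, n - 1`. -/
theorem MapsToParallelogram.latticeTotal_rectangle {c : ChainQuot X} {a : ℂ} {n : ℕ}
    (h : MapsToParallelogram F c a n Complex.I) (hre : -1 < a.re ∧ a.re < 0)
    (him : -1 < a.im ∧ a.im < 0) : latticeTotal hF c = n * (2 * Real.pi * Complex.I) := by
  have key (p : ℤ × ℤ) : _root_.latticeWinding F hF p c =
      if p ∈ Finset.Ico (0 : ℤ) n ×ˢ {(0 : ℤ)} then 2 * Real.pi * Complex.I else 0 := by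
    rw [h.latticeWinding hF p]
    split_ifs with hp
    · simp only [Finset.mem_product, Finset.mem_Ico, Finset.mem_singleton] at hp
      have h1 : (0 : ℝ) ≤ p.1 := by exact_mod_cast hp.1.1
      have h2 : (p.1 : ℝ) + 1 ≤ n := by exact_mod_cast hp.1.2
      have := parallelogramIncrement_rectangle (a := a - latticePoint p) (m := n) (k := 1)
        (by rw [Complex.sub_re, latticePoint_re]; linarith)
        (by rw [Complex.sub_re, latticePoint_re]; linarith)
        (by rw [Complex.sub_im, latticePoint_im, hp.2]; simpa using him.2)
        (by rw [Complex.sub_im, latticePoint_im, hp.2]; simp; linarith)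
      simpa using this
    · refine parallelogramIncrement_eq_zero fun s t hst => hp ?_
      have hr := congrArg Complex.re hst
      have hi := congrArg Complex.im hst
      simp [latticePoint_re, latticePoint_im] at hr hi
      have hs0 := s.2.1
      have hs1 := s.2.2
      have ht0 := t.2.1
      have ht1 := t.2.2
      have hn : (0 : ℝ) ≤ n := n.cast_nonneg
      have a1 : (-1 : ℝ) < p.1 := by nlinarith
      have a2 : (p.1 : ℝ) < n := by nlinarith
      have a3 : (-1 : ℝ) < p.2 := by linarith
      have a4 : (p.2 : ℝ) < 1 := by linarith
      have b1 : -1 < p.1 := by exact_mod_cast a1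
      have b2 : p.1 < n := by exact_mod_cast a2
      have b3 : -1 < p.2 := by exact_mod_cast a3
      have b4 : p.2 < 1 := by exact_mod_cast a4
      simp only [Finset.mem_product, Finset.mem_Ico, Finset.mem_singleton]
      omega
  rw [latticeTotal, finsum_congr key,
    finsum_eq_sum_of_support_subset (s := Finset.Ico (0 : ℤ) n ×ˢ {(0 : ℤ)})]
  · rw [Finset.sum_congr rfl fun p hp => if_pos hp]
    simp
  · intro p hp
    by_contra h
    exact hp (if_neg h)

theorem MapsToParallelogram.swap {c : ChainQuot X} {a A B : ℂ}
    (h : MapsToParallelogram F c a A B) : MapsToParallelogram F (-c) a B A := by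
  obtain ⟨γ₁, γ₂, γ₃, γ₄, rfl, h₁, h₂, h₃, h₄⟩ := h
  rw [add_right_comm] at h₂ h₃
  exact ⟨γ₄, γ₃, γ₂, γ₁, by abel, h₄, h₃, h₂, h₁⟩

theorem latticeTotal_neg (c : ChainQuot X) : latticeTotal hF (-c) = - latticeTotal hF c := by
  rw [latticeTotal, latticeTotal, ← finsum_neg_distrib]
  exact finsum_congr fun p => map_neg _ _

theorem MapsToParallelogram.latticeTotal_rectangle' {c : ChainQuot X} {a : ℂ} {n : ℕ}
    (h : MapsToParallelogram F c a Complex.I n) (hre : -1 < a.re ∧ a.re < 0)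
    (him : -1 < a.im ∧ a.im < 0) : latticeTotal hF c = -(n * (2 * Real.pi * Complex.I)) := by
  rw [← h.swap.latticeTotal_rectangle hF hre him, latticeTotal_neg, neg_neg]

/-- A degenerate parallelogram contributes nothing: it lies on a line that misses the lattice. -/
theorem MapsToParallelogram.latticeTotal_degenerate {c : ChainQuot X} {a A B : ℂ}
    (h : MapsToParallelogram F c a A B) (hre : -1 < a.re ∧ a.re < 0)
    (him : -1 < a.im ∧ a.im < 0) (hAB : A.im = 0 ∧ B.im = 0 ∨ A.re = 0 ∧ B.re = 0) :
    latticeTotal hF c = 0 := by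
  rw [latticeTotal, finsum_congr fun p => ?_, finsum_zero]
  rw [h.latticeWinding hF p]
  refine parallelogramIncrement_eq_zero fun s t hst => ?_
  have hr := congrArg Complex.re hst
  have hi := congrArg Complex.im hst
  simp [latticePoint_re, latticePoint_im] at hr hi
  obtain hAB | hAB := hAB
  · rw [hAB.1, hAB.2] at hi
    have a3 : (-1 : ℝ) < p.2 := by linarith
    have a4 : (p.2 : ℝ) < 0 := by linarith
    have b3 : -1 < p.2 := by exact_mod_cast a3
    have b4 : p.2 < 0 := by exact_mod_cast a4
    omega
  · rw [hAB.1, hAB.2] at hr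
    have a3 : (-1 : ℝ) < p.1 := by linarith
    have a4 : (p.1 : ℝ) < 0 := by linarith
    have b3 : -1 < p.1 := by exact_mod_cast a3
    have b4 : p.1 < 0 := by exact_mod_cast a4
    omega

end LatticeWinding

end

/-! ### Graded pieces and power series tests -/

section

open AlgebraicTopology

/-- The variable `xᵢ - 1` of the group ring. -/
noncomputable def augVar (d : ℕ) (i : Fin d) : LatticeRing d :=
  MonoidAlgebra.single (Multiplicative.ofAdd (Pi.single i 1)) 1 - 1

theorem single_sub_one_mem_augIdeal {d : ℕ} (g : Multiplicative (Fin d → ℤ)) :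
    (MonoidAlgebra.single g 1 - 1 : LatticeRing d) ∈ augIdeal d := by
  simp [augIdeal, RingHom.mem_ker]

/-- Modulo the square of the augmentation ideal, `g ↦ g - 1` is additive. -/
theorem exists_linear_single_sub_one {d : ℕ} (g : Fin d → ℤ) :
    ∃ F : MvPolynomial (Fin d) ℤ, F.IsHomogeneous 1 ∧
      (MonoidAlgebra.single (Multiplicative.ofAdd g) 1 - 1 : LatticeRing d) -
        MvPolynomial.aeval (augVar d) F ∈ augIdeal d ^ 2 := by
  let x (g : Fin d → ℤ) : LatticeRing d := MonoidAlgebra.single (Multiplicative.ofAdd g) 1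
  have hx (g h) : x (g + h) = x g * x h := by simp [x, MonoidAlgebra.single_mul_single]
  have hmem (g h) : (x g - 1) * (x h - 1) ∈ augIdeal d ^ 2 := by
    rw [pow_two]
    exact Ideal.mul_mem_mul (single_sub_one_mem_augIdeal _) (single_sub_one_mem_augIdeal _)
  let S : AddSubgroup (Fin d → ℤ) :=
    { carrier := {g | ∃ F : MvPolynomial (Fin d) ℤ, F.IsHomogeneous 1 ∧
        x g - 1 - MvPolynomial.aeval (augVar d) F ∈ augIdeal d ^ 2}
      zero_mem' := ⟨0, MvPolynomial.isHomogeneous_zero _ _ _, by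
        simp [x, MonoidAlgebra.one_def]⟩
      add_mem' := by
        rintro g h ⟨F, hF, hF'⟩ ⟨G, hG, hG'⟩
        refine ⟨F + G, hF.add hG, ?_⟩
        rw [hx, map_add]
        convert add_mem (add_mem hF' hG') (hmem g h) using 1
        ring
      neg_mem' := by
        rintro g ⟨F, hF, hF'⟩
        refine ⟨-F, hF.neg, ?_⟩
        have h1 : x g * x (-g) = 1 := by rw [← hx]; simp [x, MonoidAlgebra.one_def]
        rw [map_neg]
        convert add_mem (neg_mem hF') (neg_mem (hmem g (-g))) using 1
        linear_combination h1 }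
  have hS : ∀ i, Pi.single i 1 ∈ S := fun i =>
    ⟨MvPolynomial.X i, MvPolynomial.isHomogeneous_X _ _, by simp [x, augVar]⟩
  have : g ∈ S := by
    rw [pi_eq_sum_univ' g]
    refine sum_mem fun i _ => S.zsmul_mem ?_ _
    convert hS i using 1
  exact this

/-- Powers of the augmentation ideal are generated, modulo the next power, by forms in the
`xᵢ - 1` with integral coefficients. -/
theorem exists_homogeneous_of_mem_augIdeal_pow {d j : ℕ} {r : LatticeRing d}
    (hr : r ∈ augIdeal d ^ j) : ∃ F : MvPolynomial (Fin d) ℤ, F.IsHomogeneous j ∧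
      r - MvPolynomial.aeval (augVar d) F ∈ augIdeal d ^ (j + 1) := by
  have hsum (r : LatticeRing d) :
      r - MvPolynomial.aeval (augVar d)
        (MvPolynomial.C (MonoidAlgebra.lift ℤ ℤ (Multiplicative (Fin d → ℤ)) 1 r)) ∈ augIdeal d := by
    rw [augIdeal, RingHom.mem_ker]
    simp
  have h1 (r : LatticeRing d) (hr : r ∈ augIdeal d) : ∃ F : MvPolynomial (Fin d) ℤ,
      F.IsHomogeneous 1 ∧ r - MvPolynomial.aeval (augVar d) F ∈ augIdeal d ^ 2 := by
    have : ∃ F : MvPolynomial (Fin d) ℤ, F.IsHomogeneous 1 ∧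
        r - MonoidAlgebra.single 1 (MonoidAlgebra.lift ℤ ℤ (Multiplicative (Fin d → ℤ)) 1 r) -
          MvPolynomial.aeval (augVar d) F ∈ augIdeal d ^ 2 := by
      clear hr
      induction r using MonoidAlgebra.induction_linear with
      | zero => exact ⟨0, MvPolynomial.isHomogeneous_zero _ _ _, by simp⟩
      | add f g hf hg =>
        obtain ⟨F, hF, hF'⟩ := hf
        obtain ⟨G, hG, hG'⟩ := hg
        refine ⟨F + G, hF.add hG, ?_⟩
        convert add_mem hF' hG' using 1
        rw [map_add, map_add, MonoidAlgebra.single_add]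
        ring
      | single g c =>
        obtain ⟨F, hF, hF'⟩ := exists_linear_single_sub_one g.toAdd
        refine ⟨c • F, (MvPolynomial.homogeneousSubmodule _ _ 1).smul_mem c hF, ?_⟩
        convert zsmul_mem hF' c using 1
        rw [map_zsmul, smul_sub, smul_sub]
        simp [MonoidAlgebra.one_def]
    obtain ⟨F, hF, hF'⟩ := this
    refine ⟨F, hF, ?_⟩
    have h0 : MonoidAlgebra.lift ℤ ℤ (Multiplicative (Fin d → ℤ)) 1 r = 0 := hr
    simpa [h0] using hF'
  induction j generalizing r with
  | zero => exact ⟨_, MvPolynomial.isHomogeneous_C _ _, by simpa using hsum r⟩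
  | succ j ih =>
    rw [pow_succ] at hr
    refine Submodule.mul_induction_on hr (fun x hx y hy => ?_) ?_
    · obtain ⟨F, hF, hF'⟩ := ih hx
      obtain ⟨G, hG, hG'⟩ := h1 y hy
      refine ⟨F * G, hF.mul hG, ?_⟩
      have e : x * y - MvPolynomial.aeval (augVar d) (F * G) =
          (x - MvPolynomial.aeval (augVar d) F) * y + x * (y - MvPolynomial.aeval (augVar d) G) -
          (x - MvPolynomial.aeval (augVar d) F) * (y - MvPolynomial.aeval (augVar d) G) := by
        rw [map_mul]; ring
      rw [e]
      refine sub_mem (add_mem ?_ ?_) ?_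
      · rw [pow_succ]
        exact Ideal.mul_mem_mul hF' hy
      · rw [show j + 1 + 1 = j + 2 from rfl, pow_add]
        exact Ideal.mul_mem_mul hx hG'
      · refine Ideal.pow_le_pow_right (show j + 1 + 1 ≤ j + 1 + 2 by omega) ?_
        rw [pow_add _ (j + 1) 2]
        exact Ideal.mul_mem_mul hF' hG'
    · rintro x y ⟨F, hF, hF'⟩ ⟨G, hG, hG'⟩
      refine ⟨F + G, hF.add hG, ?_⟩
      convert add_mem hF' hG' using 1
      rw [map_add]
      ring

/-- Up to `Iʲ⁺¹M`, the elements of `IʲM` are combinations of the generators whose coefficients are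
forms of degree `j` in the `xᵢ - 1`. -/
theorem exists_homogeneous_of_mem_powSub {d j : ℕ} {M ι : Type*} [AddCommGroup M]
    [Module (LatticeRing d) M] [Fintype ι] {s : ι → M}
    (hs : Submodule.span (LatticeRing d) (range s) = ⊤) {a : M} (ha : a ∈ powSub (augIdeal d) M j) :
    ∃ F : ι → MvPolynomial (Fin d) ℤ, (∀ b, (F b).IsHomogeneous j) ∧
      a - ∑ b, MvPolynomial.aeval (augVar d) (F b) • s b ∈ powSub (augIdeal d) M (j + 1) := by
  refine Submodule.smul_induction_on ha (fun r hr m _ => ?_) ?_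
  · obtain ⟨c, rfl⟩ := (Submodule.mem_span_range_iff_exists_fun _).1
      (hs ▸ Submodule.mem_top : m ∈ _)
    choose F hF hF' using fun b => exists_homogeneous_of_mem_augIdeal_pow
      (Ideal.mul_mem_right (c b) _ hr)
    refine ⟨F, hF, ?_⟩
    rw [Finset.smul_sum, ← Finset.sum_sub_distrib]
    refine sum_mem fun b _ => ?_
    rw [smul_smul, ← sub_smul]
    exact Submodule.smul_mem_smul (hF' b) trivial
  · rintro x y ⟨F, hF, hF'⟩ ⟨G, hG, hG'⟩
    refine ⟨F + G, fun b => (hF b).add (hG b), ?_⟩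
    convert add_mem hF' hG' using 1
    simp only [Pi.add_apply, map_add, add_smul, Finset.sum_add_distrib]
    abel

theorem grMap_injective {R : Type*} [CommRing R] {I : Ideal R} {M N : Type*} [AddCommGroup M]
    [Module R M] [AddCommGroup N] [Module R N] (f : M →ₗ[R] N) (j : ℕ)
    (h : ∀ a ∈ powSub I M j, f a ∈ powSub I N (j + 1) → a ∈ powSub I M (j + 1)) :
    Function.Injective (grMap I f j) := by
  rw [injective_iff_map_eq_zero]
  intro x hx
  obtain ⟨a, rfl⟩ := Submodule.Quotient.mk_surjective _ x
  rw [Submodule.Quotient.mk_eq_zero]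
  refine h a.1 a.2 ?_
  exact (Submodule.Quotient.mk_eq_zero
    ((powSub I N (j + 1)).submoduleOf (powSub I N j))).1 hx

theorem MvPolynomial.IsHomogeneous.aeval_mul {σ R A : Type*} [Fintype σ] [CommSemiring R]
    [CommSemiring A] [Algebra R A] {j : ℕ} {F : MvPolynomial σ R} (hF : F.IsHomogeneous j) (x : A)
    (u : σ → A) : MvPolynomial.aeval (fun i => x * u i) F = x ^ j * MvPolynomial.aeval u F := by
  rw [aeval_def, aeval_def, eval₂_eq', eval₂_eq', Finset.mul_sum]
  refine Finset.sum_congr rfl fun m hm => ?_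
  have hj : ∑ i, m i = j := by
    rw [← hF (mem_support_iff.1 hm), Finsupp.weight_apply, Finsupp.sum_fintype _ _ (by simp)]
    simp
  simp_rw [mul_pow]
  rw [Finset.prod_mul_distrib, Finset.prod_pow_eq_pow_sum, hj]
  ring

/-! ### Power series with an action of the deck group -/

/-- The unit `1 + X`. -/
noncomputable def oneAddX : (PowerSeries ℂ)ˣ :=
  (PowerSeries.isUnit_iff_constantCoeff.2 (by simp) :
    IsUnit (1 + PowerSeries.X : PowerSeries ℂ)).unit

theorem oneAddX_zpow (n : ℤ) : ∃ u : PowerSeries ℂ,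
    ((oneAddX ^ n : (PowerSeries ℂ)ˣ) : PowerSeries ℂ) = 1 + PowerSeries.X * u ∧
      PowerSeries.constantCoeff u = n := by
  have h0 : (oneAddX : PowerSeries ℂ) = 1 + PowerSeries.X := rfl
  have h1 : ((oneAddX⁻¹ : (PowerSeries ℂ)ˣ) : PowerSeries ℂ) =
      1 - PowerSeries.X * ((oneAddX⁻¹ : (PowerSeries ℂ)ˣ) : PowerSeries ℂ) := by
    have := oneAddX.mul_inv
    rw [h0] at this
    linear_combination this
  have h2 : PowerSeries.constantCoeff ((oneAddX⁻¹ : (PowerSeries ℂ)ˣ) : PowerSeries ℂ) = 1 := by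
    rw [h1]; simp
  induction n using Int.induction_on with
  | zero => exact ⟨0, by simp⟩
  | succ n ih =>
    obtain ⟨u, hu, hu'⟩ := ih
    refine ⟨u + 1 + PowerSeries.X * u, ?_, by simp [hu']⟩
    rw [zpow_add_one, Units.val_mul, hu, h0]
    ring
  | pred n ih =>
    obtain ⟨u, hu, hu'⟩ := ih
    refine ⟨u - ((oneAddX⁻¹ : (PowerSeries ℂ)ˣ) : PowerSeries ℂ) -
      PowerSeries.X * u * ((oneAddX⁻¹ : (PowerSeries ℂ)ˣ) : PowerSeries ℂ), ?_, by simp [hu', h2]⟩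
    rw [zpow_sub_one, Units.val_mul, hu]
    linear_combination (1 + PowerSeries.X * u) * h1

/-- The homomorphism `ℤ[ℤᵈ] → ℂ⟦X⟧` with `x^g ↦ (1 + X)^(w g)`. -/
noncomputable def seriesHom {d : ℕ} (w : (Fin d → ℤ) →+ ℤ) : LatticeRing d →ₐ[ℤ] PowerSeries ℂ :=
  MonoidAlgebra.lift ℤ (PowerSeries ℂ) (Multiplicative (Fin d → ℤ))
    ((Units.coeHom _).comp ((zpowersHom _ oneAddX).comp w.toMultiplicative))

theorem seriesHom_single {d : ℕ} (w : (Fin d → ℤ) →+ ℤ) (g : Multiplicative (Fin d → ℤ)) :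
    seriesHom w (MonoidAlgebra.single g 1) = (oneAddX ^ (w g.toAdd) : (PowerSeries ℂ)ˣ) := by
  simp [seriesHom, zpowersHom_apply]
  exact one_smul _ _

theorem X_dvd_seriesHom {d : ℕ} (w : (Fin d → ℤ) →+ ℤ) {r : LatticeRing d} (hr : r ∈ augIdeal d) :
    PowerSeries.X ∣ seriesHom w r := by
  rw [PowerSeries.X_dvd_iff]
  have : (PowerSeries.constantCoeff (R := ℂ)).comp (seriesHom w : LatticeRing d →+* PowerSeries ℂ) =
      (Int.castRingHom ℂ).comp (MonoidAlgebra.lift ℤ ℤ (Multiplicative (Fin d → ℤ)) 1 :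
        LatticeRing d →+* ℤ) := by
    refine MonoidAlgebra.ringHom_ext' (RingHom.ext_int _ _) (MonoidHom.ext fun g => ?_)
    obtain ⟨u, hu, -⟩ := oneAddX_zpow (w g.toAdd)
    have := seriesHom_single w g
    simp_all
  have h0 : MonoidAlgebra.lift ℤ ℤ (Multiplicative (Fin d → ℤ)) 1 r = 0 := hr
  have h1 := DFunLike.congr_fun this r
  simp only [RingHom.comp_apply, RingHom.coe_coe, h0, map_zero] at h1
  exact h1

/-- An additive map to power series on which `g` acts as multiplication by `(1 + X)^(w g)`. -/
structure SeriesTest {d : ℕ} (H : Type*) [AddCommGroup H] [Module (LatticeRing d) H] where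
  weight : (Fin d → ℤ) →+ ℤ
  toFun : H →+ PowerSeries ℂ
  map_single_smul : ∀ (g : Multiplicative (Fin d → ℤ)) (h : H),
    toFun ((MonoidAlgebra.single g 1 : LatticeRing d) • h) =
      (oneAddX ^ (weight g.toAdd) : (PowerSeries ℂ)ˣ) * toFun h

namespace SeriesTest

variable {d : ℕ} {H : Type*} [AddCommGroup H] [Module (LatticeRing d) H] (Ψ : SeriesTest (d := d) H)

theorem map_smul (r : LatticeRing d) (h : H) :
    Ψ.toFun (r • h) = seriesHom Ψ.weight r * Ψ.toFun h := by
  induction r using MonoidAlgebra.induction_linear with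
  | zero => simp
  | add f g hf hg => rw [add_smul, map_add, map_add, hf, hg, add_mul]
  | single g c =>
    have : (MonoidAlgebra.single g c : LatticeRing d) = c • MonoidAlgebra.single g 1 := by simp
    rw [this, smul_assoc, map_zsmul, map_single_smul, map_zsmul, seriesHom_single, smul_mul_assoc]

theorem X_pow_dvd {j : ℕ} {h : H} (hh : h ∈ powSub (augIdeal d) H j) :
    PowerSeries.X ^ j ∣ Ψ.toFun h := by
  refine Submodule.smul_induction_on hh (fun r hr m _ => ?_) fun x y hx hy => ?_
  · rw [map_smul]
    refine Dvd.dvd.mul_right ?_ _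
    have h1 : augIdeal d ^ j ≤ (Ideal.span {(PowerSeries.X : PowerSeries ℂ) ^ j}).comap
        (seriesHom Ψ.weight : LatticeRing d →+* PowerSeries ℂ) := by
      rw [← Ideal.span_singleton_pow]
      refine le_trans (Ideal.pow_right_mono (fun r hr => ?_) j) (Ideal.le_comap_pow _ _)
      exact Ideal.mem_comap.2 (Ideal.mem_span_singleton.2 (X_dvd_seriesHom _ hr))
    exact Ideal.mem_span_singleton.1 (h1 hr)
  · rw [map_add]
    exact dvd_add hx hy

/-- The leading term of a form in the `xᵢ - 1` is its value at the weight. -/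
theorem coeff_aeval_smul {j : ℕ} {F : MvPolynomial (Fin d) ℤ} (hF : F.IsHomogeneous j) (h : H) :
    PowerSeries.coeff j (Ψ.toFun (MvPolynomial.aeval (augVar d) F • h)) =
      MvPolynomial.eval (fun i => Ψ.weight (Pi.single i 1)) F *
        PowerSeries.constantCoeff (Ψ.toFun h) := by
  choose u hu hu' using fun i : Fin d => oneAddX_zpow (Ψ.weight (Pi.single i 1))
  have hv (i) : seriesHom Ψ.weight (augVar d i) = PowerSeries.X * u i := by
    rw [augVar, map_sub, seriesHom_single, map_one, toAdd_ofAdd, hu]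
    ring
  have h1 : seriesHom Ψ.weight (MvPolynomial.aeval (augVar d) F) =
      PowerSeries.X ^ j * MvPolynomial.aeval u F := by
    rw [← AlgHom.comp_apply, MvPolynomial.comp_aeval]
    simp only [hv]
    exact hF.aeval_mul _ _
  have h2 : PowerSeries.constantCoeff (MvPolynomial.aeval u F) =
      ((MvPolynomial.eval (fun i => Ψ.weight (Pi.single i 1)) F : ℤ) : ℂ) := by
    refine DFunLike.congr_fun (f := PowerSeries.constantCoeff.comp
      (MvPolynomial.aeval u : MvPolynomial (Fin d) ℤ →ₐ[ℤ] _).toRingHom)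
      (g := (Int.castRingHom ℂ).comp (MvPolynomial.eval _))
      (MvPolynomial.ringHom_ext (fun n => by simp) fun i => ?_) F
    simp [hu']
  rw [map_smul, h1, mul_assoc, PowerSeries.coeff_X_pow_mul', if_pos le_rfl, Nat.sub_self,
    PowerSeries.coeff_zero_eq_constantCoeff_apply, map_mul, h2]

end SeriesTest

/-- Injectivity on graded pieces is detected by power series tests: the graded piece of the source
is described by tuples of forms, and a tuple that all tests annihilate has to be a relation. -/
theorem grMap_injective_of_tests {d : ℕ} {M H ι τ : Type*} [AddCommGroup M]
    [Module (LatticeRing d) M] [AddCommGroup H] [Module (LatticeRing d) H] [Fintype ι] {s : ι → M}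
    (hs : Submodule.span (LatticeRing d) (range s) = ⊤) (f : M →ₗ[LatticeRing d] H)
    (Ψ : τ → SeriesTest (d := d) H) (j : ℕ)
    (h : ∀ F : ι → MvPolynomial (Fin d) ℤ, (∀ b, (F b).IsHomogeneous j) →
      (∀ t, ∑ b, (MvPolynomial.eval (fun i => (Ψ t).weight (Pi.single i 1)) (F b) : ℂ) *
        PowerSeries.constantCoeff ((Ψ t).toFun (f (s b))) = 0) →
      ∑ b, MvPolynomial.aeval (augVar d) (F b) • s b = 0) :
    Function.Injective (grMap (augIdeal d) f j) := by
  refine grMap_injective f j fun a ha hfa => ?_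
  obtain ⟨F, hF, hF'⟩ := exists_homogeneous_of_mem_powSub hs ha
  have h0 := h F hF fun t => ?_
  · rwa [h0, sub_zero] at hF'
  · have h1 := (powSub (augIdeal d) H (j + 1)).sub_mem hfa (map_mem_powSub _ f _ hF')
    rw [map_sub, sub_sub_cancel, map_sum] at h1
    have h2 := (PowerSeries.X_pow_dvd_iff.1 ((Ψ t).X_pow_dvd h1)) j (Nat.lt_succ_self j)
    rw [map_sum, map_sum] at h2
    rw [← h2]
    refine Finset.sum_congr rfl fun b _ => ?_
    rw [f.map_smul, (Ψ t).coeff_aeval_smul (hF b)]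

end

/-! ### The first homology of a preimage: generation and tests -/

section

open AlgebraicTopology unitInterval

namespace LatticeCover

variable {d : ℕ} {E M : Type} [TopologicalSpace E] [TopologicalSpace M] (P : LatticeCover d E M)
  {A B : Set M}

/-- The first homology of the preimage of `A`, embedded into chains modulo boundaries. -/
noncomputable def toChain (A : Set M) : P.H1 A →+ ChainQuot (P.lift A) where
  toFun h := h1Incl (P.lift A) (show singularH1.obj (P.lift A) from h)
  map_zero' := map_zero (h1Incl (P.lift A))
  map_add' := map_add (h1Incl (P.lift A))

theorem toChain_injective (A : Set M) : Function.Injective (P.toChain A) :=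
  h1Incl_injective _

theorem toChain_single_smul (g : Multiplicative (Fin d → ℤ)) (h : P.H1 A) :
    P.toChain A ((MonoidAlgebra.single g 1 : LatticeRing d) • h) =
      chainQuotMap (P.deckMap A g) (P.toChain A h) := by
  rw [Representation.single_smul]
  erw [one_smul]
  exact h1Incl_map _ _

theorem toChain_H1Map (hAB : A ⊆ B) (h : P.H1 A) :
    P.toChain B (P.H1Map hAB h) = chainQuotMap (P.inclMap hAB) (P.toChain A h) :=
  h1Incl_map _ _

theorem chainBoundary_toChain (h : P.H1 A) : chainBoundary _ (P.toChain A h) = 0 := by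
  have : P.toChain A h ∈ (h1Incl (P.lift A)).range := ⟨_, rfl⟩
  rwa [range_h1Incl] at this

theorem exists_toChain_eq {c : ChainQuot (P.lift A)} (hc : chainBoundary _ c = 0) :
    ∃ h : P.H1 A, P.toChain A h = c := by
  have : c ∈ (h1Incl (P.lift A)).range := by rwa [range_h1Incl]
  exact this

section Generation

variable {X : TopCat.{0}}

/-- If the class of every short path agrees with the difference of the values of `Q` at its end
points modulo `T`, then so does the class of every path. -/
theorem pathClass_sub_mem (T : AddSubgroup (ChainQuot X)) (Q : X → ChainQuot X)
    (h : ∀ x : X, ∃ U : Set X, IsOpen U ∧ x ∈ U ∧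
      ∀ γ : C(I, X), (∀ t, γ t ∈ U) → pathClass X γ - (Q (γ 1) - Q (γ 0)) ∈ T)
    (γ : C(I, X)) : pathClass X γ - (Q (γ 1) - Q (γ 0)) ∈ T := by
  choose U hU hxU hT using h
  obtain ⟨t, ht0, htm, ⟨n, hn⟩, ht⟩ := exists_monotone_Icc_subset_open_cover_unitInterval
    (c := fun x => γ ⁻¹' U x) (fun x => (hU x).preimage γ.continuous)
    (fun s _ => mem_iUnion.2 ⟨γ s, hxU _⟩)
  let φ : C(ℝ, X) := γ.comp ⟨projIcc 0 1 zero_le_one, continuous_projIcc⟩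
  have hφ (s : I) : φ s = γ s := congrArg γ (projIcc_val zero_le_one s)
  have key (m : ℕ) : pathClass X (φ.comp (segmentPath (t 0 : ℝ) (t m))) -
      (Q (γ (t m)) - Q (γ (t 0))) ∈ T := by
    induction m with
    | zero => rw [pathClass_segment_self]; simp
    | succ m ih =>
      obtain ⟨x, hx⟩ := ht m
      have hle : (t m : ℝ) ≤ t (m + 1) := htm (Nat.le_succ m)
      have h1 := hT x (φ.comp (segmentPath (t m : ℝ) (t (m + 1)))) fun s => by
        have hs0 := s.2.1
        have hs1 := s.2.2
        have hmem : (t m : ℝ) + (s : ℝ) * (t (m + 1) - t m) ∈ Icc (t m : ℝ) (t (m + 1)) :=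
          ⟨by nlinarith, by nlinarith⟩
        have hI : (t m : ℝ) + (s : ℝ) * (t (m + 1) - t m) ∈ I :=
          ⟨(t m).2.1.trans hmem.1, hmem.2.trans (t (m + 1)).2.2⟩
        have := hx (show (⟨_, hI⟩ : I) ∈ Icc (t m) (t (m + 1)) from hmem)
        rw [mem_preimage, ← hφ] at this
        exact this
      have e0 : (φ.comp (segmentPath (t m : ℝ) (t (m + 1)))) 0 = γ (t m) := by
        rw [← hφ]; simp [segmentPath]
      have e1 : (φ.comp (segmentPath (t m : ℝ) (t (m + 1)))) 1 = γ (t (m + 1)) := by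
        rw [← hφ]; simp [segmentPath]
      rw [e0, e1] at h1
      rw [← pathClass_segment_add φ _ (t m : ℝ)]
      convert add_mem ih h1 using 1
      abel
  have h2 := key n
  rw [hn n le_rfl, ht0] at h2
  convert h2 using 2
  congr 1
  ext s
  rw [ContinuousMap.comp_apply, ← hφ]
  simp [segmentPath]

variable {ι : Type*}

/-- The homology of the preimage of `A` is generated by a family of classes, if modulo these classes
the class of every short path depends on its end points only. -/
theorem span_eq_top {s : ι → P.H1 A} (Q : P.lift A → ChainQuot (P.lift A))
    (h : ∀ x : P.lift A, ∃ U : Set (P.lift A), IsOpen U ∧ x ∈ U ∧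
      ∀ γ : C(I, P.lift A), (∀ t, γ t ∈ U) → pathClass _ γ - (Q (γ 1) - Q (γ 0)) ∈
        (Submodule.span (LatticeRing d) (range s)).toAddSubgroup.map (P.toChain A)) :
    Submodule.span (LatticeRing d) (range s) = ⊤ := by
  set T := (Submodule.span (LatticeRing d) (range s)).toAddSubgroup.map (P.toChain A) with hT
  refine eq_top_iff.2 fun x _ => ?_
  let Qh : (P.lift A →₀ ℤ) →+ ChainQuot (P.lift A) :=
    Finsupp.liftAddHom fun x => (zmultiplesHom _ (Q x))
  have key (c : ChainQuot (P.lift A)) : c - Qh (chainBoundary _ c) ∈ T := by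
    refine ChainQuot.induction
      (S := T.comap (AddMonoidHom.id _ - Qh.comp (chainBoundary _))) (fun γ => ?_) c
    have := pathClass_sub_mem T Q h γ
    rw [AddSubgroup.mem_comap, AddMonoidHom.sub_apply, AddMonoidHom.comp_apply,
      chainBoundary_pathClass, map_sub]
    simpa [Qh] using this
  have h1 := key (P.toChain A x)
  rw [chainBoundary_toChain, map_zero, sub_zero] at h1
  obtain ⟨y, hy, hxy⟩ := h1
  rwa [← P.toChain_injective A hxy]

end Generation

/-- Elements of the image of a submodule in chains are permuted by deck transformations. -/
theorem chainQuotMap_deckMap_mem (S : Submodule (LatticeRing d) (P.H1 A))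
    (g : Multiplicative (Fin d → ℤ)) {c : ChainQuot (P.lift A)}
    (hc : c ∈ S.toAddSubgroup.map (P.toChain A)) :
    chainQuotMap (P.deckMap A g) c ∈ S.toAddSubgroup.map (P.toChain A) := by
  obtain ⟨h, hh, rfl⟩ := hc
  exact ⟨MonoidAlgebra.single g 1 • h, S.smul_mem _ hh, P.toChain_single_smul g h⟩

/-- The generating series of the winding numbers around the lattice points `p`, weighted with
`(1 + X)^(w p)`. -/
noncomputable def latticeTest (F : C(P.lift A, ℂ)) (hF : ∀ x p, F x ≠ latticePoint p)
    (l : (Fin d → ℤ) →+ ℤ × ℤ)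
    (hl : ∀ g x, F (P.deckMap A g x) = F x + latticePoint (l g.toAdd)) (w : ℤ × ℤ →+ ℤ) :
    SeriesTest (d := d) (P.H1 A) where
  weight := w.comp l
  toFun :=
    { toFun := fun h => ∑ᶠ p, PowerSeries.C (latticeWinding F hF p (P.toChain A h)) *
        ((oneAddX ^ (w p) : (PowerSeries ℂ)ˣ) : PowerSeries ℂ)
      map_zero' := by simp
      map_add' := fun h h' => by
        rw [← finsum_add_distrib]
        · refine finsum_congr fun p => ?_
          rw [map_add, map_add, map_add, add_mul]
        · refine (latticeWinding_finite F hF (P.chainBoundary_toChain h)).subset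
            fun p hp h0 => hp ?_
          simp only at h0
          simp [h0]
        · refine (latticeWinding_finite F hF (P.chainBoundary_toChain h')).subset
            fun p hp h0 => hp ?_
          simp only at h0
          simp [h0] }
  map_single_smul g h := by
    simp only [AddMonoidHom.coe_mk, ZeroHom.coe_mk, AddMonoidHom.comp_apply]
    rw [mul_finsum, ← finsum_comp_equiv (Equiv.addRight (l g.toAdd))]
    refine finsum_congr fun p => ?_
    rw [toChain_single_smul, latticeWinding_chainQuotMap F hF _ (hl g), Equiv.coe_addRight,
      add_sub_cancel_right, map_add, zpow_add, Units.val_mul]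
    ring

theorem constantCoeff_latticeTest (F : C(P.lift A, ℂ)) (hF : ∀ x p, F x ≠ latticePoint p)
    (l : (Fin d → ℤ) →+ ℤ × ℤ)
    (hl : ∀ g x, F (P.deckMap A g x) = F x + latticePoint (l g.toAdd)) (w : ℤ × ℤ →+ ℤ)
    (h : P.H1 A) : PowerSeries.constantCoeff ((P.latticeTest F hF l hl w).toFun h) =
      latticeTotal hF (P.toChain A h) := by
  refine ((PowerSeries.constantCoeff (R := ℂ)).toAddMonoidHom.map_finsum ?_).trans ?_
  · refine (latticeWinding_finite F hF (P.chainBoundary_toChain h)).subset fun p hp h0 => hp ?_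
    simp only at h0
    simp [h0]
  · refine finsum_congr fun p => ?_
    obtain ⟨u, hu, -⟩ := oneAddX_zpow (w p)
    simp [hu]

end LatticeCover

end

/-! ### The preimage of the relative spine of `T² × I` -/

section

open AlgebraicTopology unitInterval

/-- In a vector space every path is homologous to the segment between its end points. -/
theorem pathClass_comp_eq_segment {X : TopCat.{0}} {E : Type*} [AddCommGroup E] [Module ℝ E]
    [TopologicalSpace E] [IsTopologicalAddGroup E] [ContinuousSMul ℝ E] (φ : C(E, X))
    (δ : C(I, E)) :
    pathClass X (φ.comp δ) = pathClass X (φ.comp (segmentPath (δ 0) (δ 1))) := by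
  have h := pathClass_square X (φ.comp ⟨fun x : I × I =>
    (1 - (x.2 : ℝ)) • segmentPath (δ 0) (δ 1) x.1 + (x.2 : ℝ) • δ x.1, by fun_prop⟩)
  have e1 : (φ.comp ⟨fun x : I × I => (1 - (x.2 : ℝ)) • segmentPath (δ 0) (δ 1) x.1 +
      (x.2 : ℝ) • δ x.1, by fun_prop⟩).comp ⟨fun t => (1, t), by fun_prop⟩ =
      .const _ (φ (δ 1)) := by
    ext t
    refine congrArg φ ?_
    simp only [ContinuousMap.coe_mk, segmentPath_apply, Icc.coe_one, one_smul, add_sub_cancel,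
      ← add_smul, sub_add_cancel]
  have e0 : (φ.comp ⟨fun x : I × I => (1 - (x.2 : ℝ)) • segmentPath (δ 0) (δ 1) x.1 +
      (x.2 : ℝ) • δ x.1, by fun_prop⟩).comp ⟨fun t => (0, t), by fun_prop⟩ =
      .const _ (φ (δ 0)) := by
    ext t
    refine congrArg φ ?_
    simp only [ContinuousMap.coe_mk, segmentPath_apply, Icc.coe_zero, zero_smul, add_zero,
      ← add_smul, sub_add_cancel, one_smul]
  rw [e0, e1, pathClass_const, pathClass_const, add_zero, zero_add] at h
  rw [show δ = ⟨fun t => δ t, δ.continuous⟩ from rfl]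
  convert h.symm using 2
  · ext t; simp
  · ext t; simp

/-- Sliding a path along a homotopy. -/
theorem pathClass_homotopy {X : TopCat.{0}} (K : C(I × I, X)) {γ δ τ₀ τ₁ : C(I, X)}
    (h0 : ∀ t, K (t, 0) = γ t) (h1 : ∀ t, K (t, 1) = δ t) (h2 : ∀ t, K (0, t) = τ₀ t)
    (h3 : ∀ t, K (1, t) = τ₁ t) :
    pathClass X γ + pathClass X τ₁ = pathClass X τ₀ + pathClass X δ := by
  convert pathClass_square X K using 3
  · ext t; exact (h0 t).symm
  · ext t; exact (h3 t).symm
  · ext t; exact (h2 t).symm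
  · ext t; exact (h1 t).symm

theorem torusProj_eq_zero {d : ℕ} {v : Fin d → ℝ} :
    torusProj d v = 0 ↔ ∃ g : Fin d → ℤ, v = fun i => (g i : ℝ) := by
  constructor
  · intro h
    choose g hg using fun i => (AddCircle.coe_eq_zero_iff (1 : ℝ)).1 (congrFun h i)
    exact ⟨g, funext fun i => by simpa using (hg i).symm⟩
  · rintro ⟨g, rfl⟩
    funext i
    exact (AddCircle.coe_eq_zero_iff (1 : ℝ)).2 ⟨g i, by simp⟩

namespace RelSpine

/-- The preimage of the relative spine in `ℝ² × I`. -/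
abbrev Cover : TopCat.{0} := thickTorusCover.lift relSpine

theorem mem_iff (e : (Fin 2 → ℝ) × I) :
    e ∈ thickTorusCover.proj ⁻¹' relSpine ↔
      (∃ g : Fin 2 → ℤ, e.1 = fun i => (g i : ℝ)) ∨ e.2 = 0 ∨ e.2 = 1 := by
  rw [← torusProj_eq_zero]
  rfl

/-- A lattice point, as a point of the plane. -/
def pt (g : Fin 2 → ℤ) : Fin 2 → ℝ := fun i => g i

/-- The bottom `ℝ² × {0}`. -/
def bot : C(Fin 2 → ℝ, Cover) :=
  ⟨fun p => (⟨(p, 0), (mem_iff _).2 (.inr (.inl rfl))⟩ :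
      (thickTorusCover.proj ⁻¹' relSpine : Set _)),
    by fun_prop⟩

/-- The top `ℝ² × {1}`. -/
def top : C(Fin 2 → ℝ, Cover) :=
  ⟨fun p => (⟨(p, 1), (mem_iff _).2 (.inr (.inr rfl))⟩ :
      (thickTorusCover.proj ⁻¹' relSpine : Set _)),
    by fun_prop⟩

/-- The vertical segment over a lattice point, extended by constants to a path indexed by `ℝ`. -/
noncomputable def vert (g : Fin 2 → ℤ) : C(ℝ, Cover) :=
  ⟨fun t => (⟨(pt g, projIcc 0 1 zero_le_one t), (mem_iff _).2 (.inl ⟨g, rfl⟩)⟩ :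
      (thickTorusCover.proj ⁻¹' relSpine : Set _)),
    (continuous_const.prodMk continuous_projIcc).subtype_mk _⟩

theorem bot_val (p : Fin 2 → ℝ) : (bot p).1 = (p, 0) := rfl
theorem top_val (p : Fin 2 → ℝ) : (top p).1 = (p, 1) := rfl
theorem vert_val (g : Fin 2 → ℤ) (t : ℝ) :
    (vert g t).1 = (pt g, projIcc 0 1 zero_le_one t) := rfl

/-- The loop that goes up at `0`, over to `g`, and down there. -/
noncomputable def loopChain (g : Fin 2 → ℤ) : ChainQuot Cover :=
  pathClass _ ((vert 0).comp (segmentPath 0 1)) + pathClass _ (top.comp (segmentPath 0 (pt g))) -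
    pathClass _ ((vert g).comp (segmentPath 0 1)) - pathClass _ (bot.comp (segmentPath 0 (pt g)))

theorem chainBoundary_loopChain (g : Fin 2 → ℤ) : chainBoundary _ (loopChain g) = 0 := by
  have hpt : pt 0 = 0 := by ext i; simp [pt]
  have ht (g : Fin 2 → ℤ) : vert g 1 = top (pt g) := Subtype.ext (by simp [vert_val, top_val])
  have hb (g : Fin 2 → ℤ) : vert g 0 = bot (pt g) := Subtype.ext (by simp [vert_val, bot_val])
  simp only [loopChain, map_sub, map_add, chainBoundary_pathClass, ContinuousMap.comp_apply,
    segmentPath_apply]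
  simp [ht, hb, hpt]

theorem deckMap_segment (g : Fin 2 → ℤ) (φ ψ : C(Fin 2 → ℝ, Cover))
    (h : ∀ p, thickTorusCover.deckMap relSpine (.ofAdd g) (φ p) = ψ (pt g + p)) (a b : Fin 2 → ℝ) :
    chainQuotMap (thickTorusCover.deckMap relSpine (.ofAdd g))
        (pathClass _ (φ.comp (segmentPath a b))) =
      pathClass _ (ψ.comp (segmentPath (pt g + a) (pt g + b))) := by
  rw [chainQuotMap_pathClass]
  congr 1
  ext t
  refine (h _).trans (congrArg ψ ?_)
  simp [segmentPath, add_assoc]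

theorem pt_add (g h : Fin 2 → ℤ) : pt (g + h) = pt g + pt h := by ext i; simp [pt]

/-- The loop at `g + h` is the loop at `g` followed by the translate of the loop at `h`. -/
theorem loopChain_add (g h : Fin 2 → ℤ) : loopChain (g + h) = loopChain g +
    chainQuotMap (thickTorusCover.deckMap relSpine (.ofAdd g)) (loopChain h) := by
  have hb := deckMap_segment g bot bot fun p => rfl
  have ht := deckMap_segment g top top fun p => rfl
  have hv (k : Fin 2 → ℤ) : chainQuotMap (thickTorusCover.deckMap relSpine (.ofAdd g))
      (pathClass _ ((vert k).comp (segmentPath 0 1))) =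
        pathClass _ ((vert (g + k)).comp (segmentPath 0 1)) := by
    rw [chainQuotMap_pathClass]
    congr 1
    ext t
    refine Subtype.ext (Prod.ext ?_ rfl)
    exact (pt_add g k).symm
  simp only [loopChain, map_sub, map_add, hb, ht, hv, pt_add, add_zero]
  rw [← pathClass_segment_add top 0 (pt g), ← pathClass_segment_add bot 0 (pt g)]
  abel

theorem loopChain_zero : loopChain 0 = 0 := by
  have h := loopChain_add 0 0
  rw [ofAdd_zero, LatticeCover.deckMap_one] at h
  have : chainQuotMap (𝟙 Cover) (loopChain 0) = loopChain 0 := by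
    refine DFunLike.congr_fun (f := chainQuotMap (𝟙 Cover)) (g := AddMonoidHom.id _)
      (ChainQuot.hom_ext fun γ => ?_) _
    rw [chainQuotMap_pathClass]
    rfl
  rw [this, add_zero] at h
  exact left_eq_add.1 h

/-- The class of the loop over a generator of the lattice. -/
noncomputable def gen (i : Fin 2) : thickTorusCover.H1 relSpine :=
  (thickTorusCover.exists_toChain_eq (chainBoundary_loopChain (Pi.single i 1))).choose

theorem toChain_gen (i : Fin 2) :
    thickTorusCover.toChain relSpine (gen i) = loopChain (Pi.single i 1) :=
  (thickTorusCover.exists_toChain_eq (chainBoundary_loopChain (Pi.single i 1))).choose_spec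

/-- Going around a lattice square in the two possible ways. -/
theorem gen_relation : augVar 2 1 • gen 0 = augVar 2 0 • gen 1 := by
  apply thickTorusCover.toChain_injective
  have h : loopChain (Pi.single 0 1) + chainQuotMap (thickTorusCover.deckMap relSpine
      (.ofAdd (Pi.single 0 1))) (loopChain (Pi.single 1 1)) =
      loopChain (Pi.single 1 1) + chainQuotMap (thickTorusCover.deckMap relSpine
      (.ofAdd (Pi.single 1 1))) (loopChain (Pi.single 0 1)) := by
    rw [← loopChain_add, ← loopChain_add, add_comm]
  rw [augVar, augVar, sub_smul, sub_smul, one_smul, one_smul, map_sub, map_sub,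
    LatticeCover.toChain_single_smul, LatticeCover.toChain_single_smul, toChain_gen, toChain_gen,
    sub_eq_sub_iff_add_eq_add, add_comm, ← h, add_comm]

/-- The chains of the classes in the submodule generated by `gen`. -/
noncomputable abbrev genChains : AddSubgroup (ChainQuot Cover) :=
  (Submodule.span (LatticeRing 2) (range gen)).toAddSubgroup.map (thickTorusCover.toChain relSpine)

theorem loopChain_mem (g : Fin 2 → ℤ) : loopChain g ∈ genChains := by
  let S : AddSubgroup (Fin 2 → ℤ) :=
    { carrier := {g | loopChain g ∈ genChains}
      zero_mem' := by
        rw [mem_ofPred_eq, loopChain_zero]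
        exact zero_mem _
      add_mem' := fun {g h} hg hh => by
        rw [mem_ofPred_eq, loopChain_add]
        exact add_mem hg (thickTorusCover.chainQuotMap_deckMap_mem _ _ hh)
      neg_mem' := fun {g} hg => by
        have h := loopChain_add (-g) g
        rw [neg_add_cancel, loopChain_zero] at h
        rw [mem_ofPred_eq, eq_neg_of_add_eq_zero_left h.symm]
        exact neg_mem (thickTorusCover.chainQuotMap_deckMap_mem _ _ hg) }
  have : g ∈ S := by
    rw [pi_eq_sum_univ' g]
    refine sum_mem fun i _ => S.zsmul_mem ?_ _
    exact ⟨gen i, Submodule.subset_span ⟨i, rfl⟩, toChain_gen i⟩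
  exact this

theorem mem_of_lt_one {x : Cover} (h : x.1.2 < 1) (s : I) :
    (x.1.1, s * x.1.2) ∈ thickTorusCover.proj ⁻¹' relSpine := by
  rw [mem_iff]
  obtain hg | h0 | h1 := (mem_iff _).1 x.2
  · exact .inl hg
  · exact .inr (.inl (by simp [h0]))
  · exact absurd h1 h.ne

theorem mem_of_pos {x : Cover} (h : 0 < x.1.2) (s : I) :
    (x.1.1, σ (σ s * σ x.1.2)) ∈ thickTorusCover.proj ⁻¹' relSpine := by
  rw [mem_iff]
  obtain hg | h0 | h1 := (mem_iff _).1 x.2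
  · exact .inl hg
  · exact absurd h0 h.ne'
  · exact .inr (.inr (by simp [h1]))

/-- The vertical path from the bottom to a point below the top. -/
def lower {x : Cover} (h : x.1.2 < 1) : C(I, Cover) :=
  ⟨fun s => (⟨_, mem_of_lt_one h s⟩ : (thickTorusCover.proj ⁻¹' relSpine : Set _)),
    (by fun_prop : Continuous fun s : I => (x.1.1, s * x.1.2)).subtype_mk _⟩

/-- The vertical path from a point above the bottom to the top. -/
def upper {x : Cover} (h : 0 < x.1.2) : C(I, Cover) :=
  ⟨fun s => (⟨_, mem_of_pos h s⟩ : (thickTorusCover.proj ⁻¹' relSpine : Set _)),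
    (by fun_prop : Continuous fun s : I => (x.1.1, σ (σ s * σ x.1.2))).subtype_mk _⟩

/-- A standard path from the origin to a point of the covering, as a chain: along the bottom and up
if the point is below the top, and up at the origin and along the top otherwise. -/
noncomputable def basePath (x : Cover) : ChainQuot Cover :=
  open Classical in
  if h : x.1.2 < 1 then pathClass _ (bot.comp (segmentPath 0 x.1.1)) + pathClass _ (lower h)
  else pathClass _ ((vert 0).comp (segmentPath 0 1)) + pathClass _ (top.comp (segmentPath 0 x.1.1))

theorem continuous_height : Continuous fun x : Cover => x.1.2 :=
  continuous_snd.comp continuous_subtype_val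

theorem continuous_base : Continuous fun x : Cover => x.1.1 :=
  continuous_fst.comp continuous_subtype_val

/-- The part below the top retracts to the bottom. -/
theorem pathClass_below (γ : C(I, Cover)) (h : ∀ t, (γ t).1.2 < 1) :
    pathClass _ γ = basePath (γ 1) - basePath (γ 0) := by
  let δ : C(I, Fin 2 → ℝ) := ⟨fun t => (γ t).1.1, continuous_base.comp γ.continuous⟩
  let K : C(I × I, Cover) :=
    ⟨fun x => (⟨_, mem_of_lt_one (h x.1) x.2⟩ : (thickTorusCover.proj ⁻¹' relSpine : Set _)),
      ((continuous_base.comp (γ.continuous.comp continuous_fst)).prodMk (continuous_snd.mul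
        (continuous_height.comp (γ.continuous.comp continuous_fst)))).subtype_mk _⟩
  have hK := pathClass_homotopy K (γ := bot.comp δ) (δ := γ) (τ₀ := lower (h 0)) (τ₁ := lower (h 1))
    (fun t => Subtype.ext (Prod.ext rfl (zero_mul _)))
    (fun t => Subtype.ext (Prod.ext rfl (one_mul _))) (fun t => rfl) (fun t => rfl)
  rw [pathClass_comp_eq_segment, ← sub_eq_zero] at hK
  have hs := pathClass_segment_add bot 0 (δ 0) (δ 1)
  rw [basePath, basePath, dif_pos (h 0), dif_pos (h 1), ← sub_eq_zero, ← neg_eq_zero, ← hK]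
  rw [eq_sub_of_add_eq' hs]
  simp only [δ, ContinuousMap.coe_mk]
  abel

/-- The part above the bottom retracts to the top. -/
theorem pathClass_above (γ : C(I, Cover)) (h : ∀ t, 0 < (γ t).1.2) :
    pathClass _ γ =
      (pathClass _ (top.comp (segmentPath 0 (γ 1).1.1)) - pathClass _ (upper (h 1))) -
      (pathClass _ (top.comp (segmentPath 0 (γ 0).1.1)) - pathClass _ (upper (h 0))) := by
  let δ : C(I, Fin 2 → ℝ) := ⟨fun t => (γ t).1.1, continuous_base.comp γ.continuous⟩
  let K : C(I × I, Cover) :=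
    ⟨fun x => (⟨_, mem_of_pos (h x.1) x.2⟩ : (thickTorusCover.proj ⁻¹' relSpine : Set _)),
      ((continuous_base.comp (γ.continuous.comp continuous_fst)).prodMk (continuous_symm.comp
        ((continuous_symm.comp continuous_snd).mul (continuous_symm.comp
        (continuous_height.comp (γ.continuous.comp continuous_fst)))))).subtype_mk _⟩
  have hK := pathClass_homotopy K (γ := γ) (δ := top.comp δ) (τ₀ := upper (h 0)) (τ₁ := upper (h 1))
    (fun t => Subtype.ext (Prod.ext rfl (show σ (σ 0 * σ _) = _ by simp)))
    (fun t => Subtype.ext (Prod.ext rfl (show σ (σ 1 * σ _) = 1 by simp)))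
    (fun t => rfl) (fun t => rfl)
  rw [pathClass_comp_eq_segment] at hK
  have hs := pathClass_segment_add top 0 (δ 0) (δ 1)
  rw [eq_sub_of_add_eq hK]
  change _ + pathClass _ (top.comp (segmentPath (δ 0) (δ 1))) - _ = _
  rw [eq_sub_of_add_eq' hs]
  simp only [δ, ContinuousMap.coe_mk]
  abel

/-- Above the bottom, the standard path agrees with the path through the top, up to loops. -/
theorem basePath_sub_mem {x : Cover} (h : 0 < x.1.2) :
    pathClass _ ((vert 0).comp (segmentPath 0 1)) +
      (pathClass _ (top.comp (segmentPath 0 x.1.1)) - pathClass _ (upper h)) - basePath x ∈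
        genChains := by
  by_cases h1 : x.1.2 < 1
  · obtain ⟨g, hg⟩ : ∃ g, x.1.1 = pt g := by
      obtain hg | h0 | h1' := (mem_iff _).1 x.2
      · exact hg
      · exact absurd h0 h.ne'
      · exact absurd h1' h1.ne
    have e0 : pathClass _ (lower h1) = pathClass _ ((vert g).comp (segmentPath 0 (x.1.2 : ℝ))) := by
      congr 1
      ext s
      refine Subtype.ext (Prod.ext hg (Subtype.ext ?_))
      have e : (0 : ℝ) + (s : ℝ) * ((x.1.2 : ℝ) - 0) = (s * x.1.2 : I) := by simp
      change ((s * x.1.2 : I) : ℝ) = projIcc 0 1 zero_le_one ((0 : ℝ) + (s : ℝ) * ((x.1.2 : ℝ) - 0))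
      rw [e, projIcc_val zero_le_one]
    have e1 : pathClass _ (upper h) = pathClass _ ((vert g).comp (segmentPath (x.1.2 : ℝ) 1)) := by
      congr 1
      ext s
      refine Subtype.ext (Prod.ext hg (Subtype.ext ?_))
      have e : (x.1.2 : ℝ) + (s : ℝ) * (1 - (x.1.2 : ℝ)) = (σ (σ s * σ x.1.2) : I) := by
        simp only [coe_symm_eq, Icc.coe_mul]
        ring
      change ((σ (σ s * σ x.1.2) : I) : ℝ) =
        projIcc 0 1 zero_le_one ((x.1.2 : ℝ) + (s : ℝ) * (1 - (x.1.2 : ℝ)))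
      rw [e, projIcc_val zero_le_one]
    have hs := pathClass_segment_add (vert g) 0 (x.1.2 : ℝ) 1
    rw [basePath, dif_pos h1, e0, e1]
    convert loopChain_mem g using 1
    rw [loopChain, ← hs, hg]
    abel
  · have e : upper h = .const _ x := by
      ext s
      have : x.1.2 = 1 := le_antisymm x.1.2.2.2 (not_lt.1 h1)
      refine Subtype.ext (Prod.ext rfl (show σ (σ s * σ x.1.2) = x.1.2 from ?_))
      simp [this]
    rw [basePath, dif_neg h1, e, pathClass_const]
    simp

theorem span_gen : Submodule.span (LatticeRing 2) (range gen) = ⊤ := by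
  refine thickTorusCover.span_eq_top basePath fun x => ?_
  by_cases h : x.1.2 < 1
  · refine ⟨{x : Cover | x.1.2 < 1}, isOpen_Iio.preimage continuous_height, h, fun γ hγ => ?_⟩
    rw [pathClass_below γ hγ, sub_self]
    exact zero_mem _
  · refine ⟨{x : Cover | 0 < x.1.2}, isOpen_Ioi.preimage continuous_height,
      lt_of_lt_of_le zero_lt_one (not_lt.1 h), fun γ hγ => ?_⟩
    rw [pathClass_above γ hγ]
    convert sub_mem (basePath_sub_mem (hγ 1)) (basePath_sub_mem (hγ 0)) using 1
    abel

end RelSpine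

end

/-! ### The `1`-skeleton of the cubical lattice -/

section

open AlgebraicTopology unitInterval

namespace CubicalSkeleton

/-- The preimage of the spine of `T³` in `ℝ³`, the `1`-skeleton of the cubical lattice. -/
abbrev Cover : TopCat.{0} := (torusCover 3).lift torusSpine

theorem mem_iff (x : Fin 3 → ℝ) : x ∈ (torusCover 3).proj ⁻¹' torusSpine ↔
    ∃ i, ∀ j, j ≠ i → ∃ n : ℤ, x j = n := by
  have h (j) : torusProj 3 x j = 0 ↔ ∃ n : ℤ, x j = n := by
    refine (AddCircle.coe_eq_zero_iff (1 : ℝ)).trans ?_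
    simp [eq_comm]
  simp_rw [← h]
  rfl

/-- A lattice point, as a point of space. -/
def pt (g : Fin 3 → ℤ) : Fin 3 → ℝ := fun i => g i

theorem pt_add (g h : Fin 3 → ℤ) : pt (g + h) = pt g + pt h := by ext i; simp [pt]

theorem pt_single (i : Fin 3) (n : ℤ) : pt (Pi.single i n) = Pi.single i (n : ℝ) := by
  ext j
  by_cases h : j = i
  · subst h; simp [pt]
  · simp [pt, h]

/-- The line through a lattice point in a coordinate direction. -/
noncomputable def line (g : Fin 3 → ℤ) (i : Fin 3) : C(ℝ, Cover) :=
  ⟨fun t => (⟨pt g + (Pi.single i t : Fin 3 → ℝ),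
        (mem_iff _).2 ⟨i, fun j hj => ⟨g j, by simp [pt, hj]⟩⟩⟩ :
      ((torusCover 3).proj ⁻¹' torusSpine : Set _)),
    (continuous_const.add (continuous_single (A := fun _ : Fin 3 => ℝ) i) :
      Continuous fun t : ℝ => pt g + (Pi.single i t : Fin 3 → ℝ)).subtype_mk _⟩

theorem line_val (g : Fin 3 → ℤ) (i : Fin 3) (t : ℝ) :
    (line g i t).1 = pt g + (Pi.single i t : Fin 3 → ℝ) := rfl

theorem line_add_single (g : Fin 3 → ℤ) (i : Fin 3) (n : ℤ) (t : ℝ) :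
    line (g + Pi.single i n) i t = line g i (n + t) := by
  refine Subtype.ext ?_
  rw [line_val, line_val, pt_add, pt_single, Pi.single_add, add_assoc]

/-- The segment of length `n` from `g` in direction `i`. -/
noncomputable def run (g : Fin 3 → ℤ) (i : Fin 3) (n : ℤ) : ChainQuot Cover :=
  pathClass _ ((line g i).comp (segmentPath 0 (n : ℝ)))

theorem run_zero (g : Fin 3 → ℤ) (i : Fin 3) : run g i 0 = 0 := by
  rw [run, Int.cast_zero, pathClass_segment_self]

theorem pathClass_line_add_single (g : Fin 3 → ℤ) (i : Fin 3) (n : ℤ) (s t : ℝ) :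
    pathClass _ ((line (g + Pi.single i n) i).comp (segmentPath s t)) =
      pathClass _ ((line g i).comp (segmentPath (n + s) (n + t))) := by
  congr 1
  ext u
  refine (line_add_single g i n _).trans (congrArg _ ?_)
  simp [segmentPath]
  ring

theorem run_add (g : Fin 3 → ℤ) (i : Fin 3) (n m : ℤ) :
    run g i (n + m) = run g i n + run (g + Pi.single i n) i m := by
  rw [run, run, run, pathClass_line_add_single, add_zero, pathClass_segment_add, Int.cast_add]

theorem deckMap_run (h g : Fin 3 → ℤ) (i : Fin 3) (n : ℤ) :
    chainQuotMap ((torusCover 3).deckMap torusSpine (.ofAdd h)) (run g i n) = run (h + g) i n := by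
  rw [run, chainQuotMap_pathClass, run]
  congr 1
  ext t
  refine Subtype.ext ?_
  refine Eq.trans (b := pt h + (pt g + (Pi.single i (segmentPath 0 (n : ℝ) t) : Fin 3 → ℝ))) rfl ?_
  rw [← add_assoc, ← pt_add]
  rfl

/-- The boundary of a lattice square at the origin. -/
noncomputable def square (i j : Fin 3) : ChainQuot Cover :=
  run 0 i 1 + run (Pi.single i 1) j 1 - run (Pi.single j 1) i 1 - run 0 j 1

theorem chainBoundary_run (g : Fin 3 → ℤ) (i : Fin 3) : chainBoundary _ (run g i 1) =
    Finsupp.single (line (g + Pi.single i 1) 0 0) 1 - Finsupp.single (line g 0 0) 1 := by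
  have e0 : line g i 0 = line g 0 0 := Subtype.ext (by simp [line_val])
  have e1 : line g i 1 = line (g + Pi.single i 1) 0 0 :=
    Subtype.ext (by simp [line_val, pt_add, pt_single])
  rw [run, chainBoundary_pathClass, ← e0, ← e1]
  simp [segmentPath]

theorem chainBoundary_square (i j : Fin 3) : chainBoundary _ (square i j) = 0 := by
  simp only [square, map_sub, map_add, chainBoundary_run, zero_add]
  rw [add_comm (Pi.single j 1 : Fin 3 → ℤ) (Pi.single i 1)]
  abel

/-- The directions spanning the three lattice squares at the origin. -/
def directions : Fin 3 → Fin 3 × Fin 3 := ![(0, 1), (0, 2), (1, 2)]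

/-- The class of a lattice square at the origin. -/
noncomputable def gen (b : Fin 3) : (torusCover 3).H1 torusSpine :=
  ((torusCover 3).exists_toChain_eq
    (chainBoundary_square (directions b).1 (directions b).2)).choose

theorem toChain_gen (b : Fin 3) : (torusCover 3).toChain torusSpine (gen b) =
    square (directions b).1 (directions b).2 :=
  ((torusCover 3).exists_toChain_eq
    (chainBoundary_square (directions b).1 (directions b).2)).choose_spec

/-- The boundary of the boundary of a lattice cube vanishes. -/
theorem gen_relation :
    augVar 3 2 • gen 0 - augVar 3 1 • gen 1 + augVar 3 0 • gen 2 = 0 := by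
  apply (torusCover 3).toChain_injective
  have h10 : (Pi.single 1 1 + Pi.single 0 1 : Fin 3 → ℤ) = Pi.single 0 1 + Pi.single 1 1 :=
    add_comm _ _
  have h20 : (Pi.single 2 1 + Pi.single 0 1 : Fin 3 → ℤ) = Pi.single 0 1 + Pi.single 2 1 :=
    add_comm _ _
  have h21 : (Pi.single 2 1 + Pi.single 1 1 : Fin 3 → ℤ) = Pi.single 1 1 + Pi.single 2 1 :=
    add_comm _ _
  simp only [augVar, sub_smul, one_smul, map_sub, map_add, map_zero,
    LatticeCover.toChain_single_smul, toChain_gen, directions, square, deckMap_run,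
    Matrix.cons_val, add_zero, h10, h20, h21]
  abel

/-- The chains of the classes in the submodule generated by `gen`. -/
noncomputable abbrev genChains : AddSubgroup (ChainQuot Cover) :=
  (Submodule.span (LatticeRing 3) (range gen)).toAddSubgroup.map ((torusCover 3).toChain torusSpine)

theorem square_mem (i j : Fin 3) : square i j ∈ genChains := by
  have hswap (i j) : square i j = - square j i := by rw [square, square]; abel
  have hself (i) : square i i = 0 := by rw [square]; abel
  have h (b) : square (directions b).1 (directions b).2 ∈ genChains :=
    ⟨gen b, Submodule.subset_span ⟨b, rfl⟩, toChain_gen b⟩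
  have h01 : square 0 1 ∈ genChains := h 0
  have h02 : square 0 2 ∈ genChains := h 1
  have h12 : square 1 2 ∈ genChains := h 2
  fin_cases i <;> fin_cases j
  · exact hself 0 ▸ zero_mem _
  · exact h01
  · exact h02
  · exact hswap 1 0 ▸ neg_mem h01
  · exact hself 1 ▸ zero_mem _
  · exact h12
  · exact hswap 2 0 ▸ neg_mem h02
  · exact hswap 2 1 ▸ neg_mem h12
  · exact hself 2 ▸ zero_mem _

/-- A lattice strip is a union of lattice squares. -/
theorem strip_mem (g : Fin 3 → ℤ) (i j : Fin 3) (n : ℤ) :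
    run g j 1 + run (g + Pi.single j 1) i n - run g i n - run (g + Pi.single i n) j 1 ∈
      genChains := by
  let D (n : ℤ) := run g j 1 + run (g + Pi.single j 1) i n - run g i n - run (g + Pi.single i n) j 1
  have step (n : ℤ) : D (n + 1) - D n ∈ genChains := by
    have h := neg_mem ((torusCover 3).chainQuotMap_deckMap_mem _ (.ofAdd (g + Pi.single i n))
      (square_mem i j))
    convert h using 1
    simp only [D, square, map_sub, map_add, deckMap_run, run_add _ _ n 1, add_zero]
    rw [add_right_comm g (Pi.single j 1), Pi.single_add, ← add_assoc]
    abel_nf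
  change D n ∈ genChains
  induction n using Int.induction_on with
  | zero =>
    simp only [D, run_zero, Pi.single_zero, add_zero]
    convert zero_mem genChains using 1
    abel
  | succ n ih => simpa using add_mem (step n) ih
  | pred n ih => simpa using sub_mem ih (step (-n - 1))

/-- The chain of the path from the origin that follows the coordinate directions in turn. -/
noncomputable def stair (g : Fin 3 → ℤ) : ChainQuot Cover :=
  run 0 0 (g 0) + run (Pi.single 0 (g 0)) 1 (g 1) +
    run (Pi.single 0 (g 0) + Pi.single 1 (g 1)) 2 (g 2)

/-- A unit step completes a standard path to a standard path, up to lattice squares. -/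
theorem run_sub_stair_mem (g : Fin 3 → ℤ) (i : Fin 3) :
    run g i 1 - (stair (g + Pi.single i 1) - stair g) ∈ genChains := by
  have hg : g = Pi.single 0 (g 0) + Pi.single 1 (g 1) + Pi.single 2 (g 2) := by
    ext j; fin_cases j <;> simp
  fin_cases i
  · have h1 := strip_mem (Pi.single 0 (g 0)) 1 0 (g 1)
    have h2 := strip_mem (Pi.single 0 (g 0) + Pi.single 1 (g 1)) 2 0 (g 2)
    rw [← hg] at h2
    convert neg_mem (add_mem h1 h2) using 1
    simp only [stair, Pi.add_apply, Fin.zero_eta, Pi.single_eq_same, ne_eq, one_ne_zero,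
      not_false_eq_true, Pi.single_eq_of_ne, add_zero, Fin.reduceEq, run_add 0 0 (g 0) 1,
      zero_add, Pi.single_add]
    rw [add_right_comm (Pi.single 0 (g 0) : Fin 3 → ℤ) (Pi.single 0 1) (Pi.single 1 (g 1))]
    abel
  · have h2 := strip_mem (Pi.single 0 (g 0) + Pi.single 1 (g 1)) 2 1 (g 2)
    rw [← hg] at h2
    convert neg_mem h2 using 1
    simp only [stair, Pi.add_apply, Fin.mk_one, Pi.single_eq_same, ne_eq, zero_ne_one,
      not_false_eq_true, Pi.single_eq_of_ne, add_zero, Fin.reduceEq, run_add _ 1 (g 1) 1,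
      Pi.single_add, ← add_assoc]
    abel
  · convert zero_mem genChains using 1
    simp only [stair, Pi.add_apply, Fin.reduceFinMk, Pi.single_eq_same, ne_eq,
      not_false_eq_true, Pi.single_eq_of_ne, add_zero, Fin.reduceEq, run_add _ 2 (g 2) 1, ← hg]
    abel

/-- The open star of a lattice point. -/
def star (g : Fin 3 → ℤ) : Set Cover := {x | ∀ i, |x.1 i - g i| < 1}

theorem isOpen_star (g : Fin 3 → ℤ) : IsOpen (star g) := by
  rw [star, Set.ofPred_forall]
  have hc (i) : Continuous fun x : Cover => x.1 i :=
    (continuous_apply i).comp continuous_subtype_val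
  exact isOpen_iInter_of_finite fun i =>
    isOpen_lt ((hc i).sub continuous_const).abs continuous_const

theorem exists_eq_line {g : Fin 3 → ℤ} {x : Cover} (h : x ∈ star g) :
    ∃ i, x = line g i (x.1 i - g i) := by
  obtain ⟨i, hi⟩ := (mem_iff _).1 x.2
  refine ⟨i, Subtype.ext (funext fun j => ?_)⟩
  rw [line_val]
  by_cases hj : j = i
  · subst hj; simp [pt]
  · obtain ⟨n, hn⟩ := hi j hj
    have := h j
    rw [hn] at this
    have h1 : |n - g j| < 1 := by exact_mod_cast this
    have h2 : n = g j := by rw [Int.abs_lt_one_iff] at h1; omega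
    simp [pt, hj, hn, h2]

theorem ray_mem {g : Fin 3 → ℤ} {x : Cover} (h : x ∈ star g) (s : I) :
    pt g + (s : ℝ) • (x.1 - pt g) ∈ (torusCover 3).proj ⁻¹' torusSpine := by
  obtain ⟨i, hi⟩ := exists_eq_line h
  rw [mem_iff]
  refine ⟨i, fun j hj => ⟨g j, ?_⟩⟩
  rw [hi, line_val]
  simp [pt, hj]

/-- The straight path from a lattice point to a point of its open star. -/
noncomputable def ray {g : Fin 3 → ℤ} {x : Cover} (h : x ∈ star g) : C(I, Cover) :=
  ⟨fun s => (⟨_, ray_mem h s⟩ : ((torusCover 3).proj ⁻¹' torusSpine : Set _)),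
    (by fun_prop : Continuous fun s : I => pt g + (s : ℝ) • (x.1 - pt g)).subtype_mk _⟩

/-- The open star of a lattice point retracts to it along rays. -/
theorem pathClass_star {g : Fin 3 → ℤ} (γ : C(I, Cover)) (h : ∀ t, γ t ∈ star g) :
    pathClass _ γ = pathClass _ (ray (h 1)) - pathClass _ (ray (h 0)) := by
  have hc : Continuous fun x : I × I => (γ x.1).1 :=
    continuous_subtype_val.comp (γ.continuous.comp continuous_fst)
  let K : C(I × I, Cover) :=
    ⟨fun x => (⟨_, ray_mem (h x.1) x.2⟩ : ((torusCover 3).proj ⁻¹' torusSpine : Set _)),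
      (by fun_prop : Continuous fun x : I × I =>
        pt g + (x.2 : ℝ) • ((γ x.1).1 - pt g)).subtype_mk _⟩
  have hK := pathClass_homotopy K (γ := .const _ (line g 0 0)) (δ := γ) (τ₀ := ray (h 0))
    (τ₁ := ray (h 1))
    (fun t => Subtype.ext (show pt g + ((0 : I) : ℝ) • ((γ t).1 - pt g) =
      pt g + (Pi.single 0 0 : Fin 3 → ℝ) by simp))
    (fun t => Subtype.ext (show pt g + ((1 : I) : ℝ) • ((γ t).1 - pt g) = (γ t).1 by simp))
    (fun t => rfl) (fun t => rfl)
  rw [pathClass_const, zero_add] at hK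
  rw [hK]
  abel

theorem pathClass_ray {g : Fin 3 → ℤ} {x : Cover} (h : x ∈ star g) {i : Fin 3} {t : ℝ}
    (hx : x = line g i t) :
    pathClass _ (ray h) = pathClass _ ((line g i).comp (segmentPath 0 t)) := by
  congr 1
  ext1 s
  refine Subtype.ext ?_
  refine Eq.trans (b := pt g + (s : ℝ) • (x.1 - pt g)) rfl ?_
  refine Eq.trans ?_ (b := pt g + (Pi.single i (0 + (s : ℝ) * (t - 0)) : Fin 3 → ℝ)) rfl
  rw [hx, line_val, add_sub_cancel_left, zero_add, sub_zero, ← smul_eq_mul, Pi.single_smul]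

theorem mem_star_floor (x : Cover) : x ∈ star (fun i => ⌊x.1 i⌋) := fun i => by
  rw [← Int.fract, abs_of_nonneg (Int.fract_nonneg _)]
  exact Int.fract_lt_one _

/-- A standard path from the origin to a point of the skeleton, as a chain. -/
noncomputable def basePath (x : Cover) : ChainQuot Cover :=
  stair (fun i => ⌊x.1 i⌋) + pathClass _ (ray (mem_star_floor x))

theorem basePath_eq {g : Fin 3 → ℤ} {x : Cover} (h : x ∈ star g) (hg : g = fun i => ⌊x.1 i⌋) :
    basePath x = stair g + pathClass _ (ray h) := by
  subst hg
  rfl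

/-- In the open star of `g`, the standard path may be replaced by a path through `g`. -/
theorem basePath_sub_mem {g : Fin 3 → ℤ} {x : Cover} (h : x ∈ star g) :
    stair g + pathClass _ (ray h) - basePath x ∈ genChains := by
  obtain ⟨i, hi⟩ := exists_eq_line h
  have habs := abs_lt.1 (h i)
  set t := x.1 i - g i with ht
  by_cases h0 : 0 ≤ t
  · have hg : g = fun i => ⌊x.1 i⌋ := by
      funext j
      rw [eq_comm, Int.floor_eq_iff, hi, line_val]
      by_cases hj : j = i
      · subst hj; simp [pt]; constructor <;> linarith
      · simp [pt, hj]
    rw [basePath_eq h hg, sub_self]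
    exact zero_mem _
  · let f := g + Pi.single i (-1)
    have hfg : g = f + Pi.single i 1 := by
      rw [add_assoc, ← Pi.single_add]; simp
    have hx : x = line f i (1 + t) := by
      rw [hi, hfg, line_add_single]; simp
    have hf : f = fun i => ⌊x.1 i⌋ := by
      funext j
      rw [eq_comm, Int.floor_eq_iff, hx, line_val]
      by_cases hj : j = i
      · subst hj; simp [pt]; constructor <;> linarith
      · simp [pt, hj]
    have hs : x ∈ star f := hf ▸ mem_star_floor x
    rw [basePath_eq hs hf, pathClass_ray hs hx, pathClass_ray h hi]
    have e := pathClass_line_add_single f i 1 0 t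
    rw [← hfg, Int.cast_one, add_zero] at e
    rw [e, ← pathClass_segment_add (line f i) 0 1 (1 + t)]
    have h1 := neg_mem (run_sub_stair_mem f i)
    rw [← hfg, run, Int.cast_one] at h1
    convert h1 using 1
    abel

theorem span_gen : Submodule.span (LatticeRing 3) (range gen) = ⊤ := by
  refine (torusCover 3).span_eq_top basePath fun x =>
    ⟨_, isOpen_star _, mem_star_floor x, fun γ hγ => ?_⟩
  rw [pathClass_star γ hγ]
  convert sub_mem (basePath_sub_mem (hγ 1)) (basePath_sub_mem (hγ 0)) using 1
  abel

end CubicalSkeleton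

end

/-! ### Forms that satisfy the linear conditions of the curves -/

section

open MvPolynomial

/-- A polynomial that vanishes on the hyperplane `xₗ = 0` is divisible by `xₗ`. -/
theorem X_dvd_of_forall_eval_eq_zero {σ : Type*} (H : MvPolynomial σ ℤ) (l : σ)
    (h : ∀ x : σ → ℤ, x l = 0 → eval x H = 0) : X l ∣ H := by
  classical
  have h0 : aeval (Function.update (X : σ → MvPolynomial σ ℤ) l 0) H = 0 := by
    refine MvPolynomial.funext fun x => ?_
    have e : (aeval x).comp (aeval (Function.update (X : σ → MvPolynomial σ ℤ) l 0)) =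
        (aeval (Function.update x l 0) : MvPolynomial σ ℤ →ₐ[ℤ] ℤ) := by
      ext s
      by_cases hs : s = l
      · subst hs; simp
      · simp [hs]
    rw [map_zero, ← h (Function.update x l 0) (by simp)]
    exact DFunLike.congr_fun e H
  have h1 : X l ∣ H - aeval (Function.update (X : σ → MvPolynomial σ ℤ) l 0) H := by
    rw [← Ideal.mem_span_singleton, ← Ideal.Quotient.eq]
    have : (Ideal.Quotient.mkₐ ℤ (Ideal.span {(X l : MvPolynomial σ ℤ)})) =
        (Ideal.Quotient.mkₐ ℤ (Ideal.span {(X l : MvPolynomial σ ℤ)})).comp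
          (aeval (Function.update (X : σ → MvPolynomial σ ℤ) l 0)) := by
      ext s
      by_cases hs : s = l
      · subst hs
        simp
      · simp [hs]
    exact DFunLike.congr_fun this H
  rwa [h0, sub_zero] at h1

/-- A polynomial of degree less than `#S` that vanishes on the hyperplanes `xᵢ = m xₗ`, `m ∈ S`,
vanishes identically. -/
theorem eq_zero_of_eval_multiples {σ : Type*} [DecidableEq σ] {H : MvPolynomial σ ℤ} {i l : σ}
    (hil : l ≠ i) (S : Finset ℤ) (hS : H.totalDegree < S.card)
    (h : ∀ m ∈ S, ∀ x : σ → ℤ, x l ≠ 0 → x i = m * x l → eval x H = 0) : H = 0 := by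
  suffices X l * H = 0 from (mul_eq_zero.1 this).resolve_left (X_ne_zero l)
  refine MvPolynomial.funext fun x => ?_
  rw [map_mul, eval_X, map_zero, mul_eq_zero]
  refine or_iff_not_imp_left.2 fun hx => ?_
  -- the restriction of `H` to the line through `x` in direction `i`
  let u : Polynomial ℤ := aeval (fun s => if s = i then Polynomial.X else Polynomial.C (x s)) H
  have hu (t : ℤ) : u.eval t = eval (Function.update x i t) H := by
    have e : (Polynomial.aeval t).comp
        (aeval (fun s => if s = i then Polynomial.X else Polynomial.C (x s))) =
        (aeval (Function.update x i t) : MvPolynomial σ ℤ →ₐ[ℤ] ℤ) := by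
      ext s
      by_cases hs : s = i
      · subst hs; simp
      · simp [hs]
    exact DFunLike.congr_fun e H
  have hdeg : u.natDegree ≤ H.totalDegree := by
    refine (aeval_natDegree_le H le_rfl _ (n := 1) fun s => ?_).trans_eq (mul_one _)
    split_ifs <;> simp
  have hz : u = 0 := by
    refine Polynomial.eq_zero_of_natDegree_lt_card_of_eval_eq_zero' u
      (S.image fun m => m * x l) ?_ ?_
    · simp only [Finset.mem_image, forall_exists_index, and_imp, forall_apply_eq_imp_iff₂]
      intro m hm
      rw [hu]
      exact h m hm _ (by simpa [hil] using hx) (by simp [hil])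
    · rw [Finset.card_image_of_injective _ (mul_left_injective₀ hx)]
      exact hdeg.trans_lt hS
  have := hu (x i)
  rwa [hz, Polynomial.eval_zero, Function.update_eq_self, eq_comm] at this

theorem totalDegree_X_mul {σ : Type*} (i : σ) {g : MvPolynomial σ ℤ} (hg : g ≠ 0) :
    (X i * g).totalDegree = g.totalDegree + 1 := by
  rw [totalDegree_mul_of_isDomain (X_ne_zero i) hg, totalDegree_X, add_comm]

/-- In two variables: the conditions coming from the directions `(1, -m)`, `m = 0, …, k`, and
`(0, 1)` cut out the multiples of the relation `(x₁, -x₀)` in degrees at most `k`. -/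
theorem exists_eq_mul_of_eval_two {j k : ℕ} (hjk : j ≤ k) {F : Fin 2 → MvPolynomial (Fin 2) ℤ}
    (hF : ∀ b, (F b).totalDegree ≤ j) (h0 : ∀ x : Fin 2 → ℤ, x 1 = 0 → eval x (F 0) = 0)
    (h : ∀ m : Fin (k + 1), ∀ x : Fin 2 → ℤ, x 0 = m * x 1 →
      m * eval x (F 0) + eval x (F 1) = 0) :
    ∃ g, F 0 = X 1 * g ∧ F 1 = -(X 0 * g) := by
  obtain ⟨g, hg⟩ := X_dvd_of_forall_eval_eq_zero (F 0) 1 h0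
  refine ⟨g, hg, eq_neg_of_add_eq_zero_right ?_⟩
  refine eq_zero_of_eval_multiples (i := 0) (l := 1) (by decide)
    (Finset.univ.image fun m : Fin (k + 1) => (m : ℤ)) ?_ ?_
  · rw [Finset.card_image_of_injective _ fun a b hab => Fin.ext (by simpa using hab),
      Finset.card_univ, Fintype.card_fin]
    refine (totalDegree_add _ _).trans_lt (max_lt ?_ ((hF 1).trans_lt (by omega)))
    by_cases hz : g = 0
    · simp [hz]
    have := hF 0
    rw [hg, totalDegree_X_mul _ hz] at this
    rw [totalDegree_X_mul _ hz]
    omega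
  · simp only [Finset.mem_image, Finset.mem_univ, true_and, forall_exists_index,
      forall_apply_eq_imp_iff]
    intro m x _ hx
    have := h m x hx
    rw [hg] at this
    simp only [map_mul, eval_X, map_add] at this ⊢
    rw [hx]
    linear_combination this

/-- In three variables: the conditions coming from the three coordinate directions and the
directions `(1, 0, -m)` and `(0, 1, -m)`, `m = 1, …, k`, cut out the multiples of the relation
`(x₂, -x₁, x₀)` in degrees at most `k`. -/
theorem exists_eq_mul_of_eval_three {j k : ℕ} (hj : 1 ≤ j) (hjk : j ≤ k)
    {F : Fin 3 → MvPolynomial (Fin 3) ℤ} (hF : ∀ b, (F b).totalDegree ≤ j)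
    (h0 : ∀ x : Fin 3 → ℤ, x 0 = 0 → eval x (F 2) = 0)
    (h1 : ∀ x : Fin 3 → ℤ, x 1 = 0 → eval x (F 1) = 0)
    (h2 : ∀ x : Fin 3 → ℤ, x 2 = 0 → eval x (F 0) = 0)
    (h02 : ∀ m : Fin k, ∀ x : Fin 3 → ℤ, x 0 = (m + 1) * x 2 →
      (m + 1) * eval x (F 0) - eval x (F 2) = 0)
    (h12 : ∀ m : Fin k, ∀ x : Fin 3 → ℤ, x 1 = (m + 1) * x 2 →
      (m + 1) * eval x (F 0) + eval x (F 1) = 0) :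
    ∃ g, F 0 = X 2 * g ∧ F 1 = -(X 1 * g) ∧ F 2 = X 0 * g := by
  obtain ⟨g, hg⟩ := X_dvd_of_forall_eval_eq_zero (F 0) 2 h2
  obtain ⟨g', hg'⟩ := X_dvd_of_forall_eval_eq_zero (F 1) 1 h1
  obtain ⟨g'', hg''⟩ := X_dvd_of_forall_eval_eq_zero (F 2) 0 h0
  have hdeg {b i : Fin 3} {p : MvPolynomial (Fin 3) ℤ} (h : F b = X i * p) : p.totalDegree < k := by
    by_cases hz : p = 0
    · rw [hz, totalDegree_zero]; omega
    have := hF b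
    rw [h, totalDegree_X_mul _ hz] at this
    omega
  have hcard : (Finset.univ.image fun m : Fin k => (m + 1 : ℤ)).card = k := by
    rw [Finset.card_image_of_injective _ fun a b hab => Fin.ext (by simpa using hab),
      Finset.card_univ, Fintype.card_fin]
  have e1 : g + g' = 0 := by
    refine eq_zero_of_eval_multiples (i := 1) (l := 2) (by decide)
      (Finset.univ.image fun m : Fin k => (m + 1 : ℤ)) ?_ ?_
    · rw [hcard]
      exact (totalDegree_add _ _).trans_lt (max_lt (hdeg hg) (hdeg hg'))
    · simp only [Finset.mem_image, Finset.mem_univ, true_and, forall_exists_index,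
        forall_apply_eq_imp_iff]
      intro m x hx0 hx
      have := h12 m x hx
      rw [hg, hg'] at this
      simp only [map_mul, eval_X, map_add] at this ⊢
      rw [hx] at this
      refine (mul_left_cancel₀ (mul_ne_zero (a := (m + 1 : ℤ)) (by positivity) hx0) ?_)
      linear_combination this
  have e2 : g - g'' = 0 := by
    refine eq_zero_of_eval_multiples (i := 0) (l := 2) (by decide)
      (Finset.univ.image fun m : Fin k => (m + 1 : ℤ)) ?_ ?_
    · rw [hcard]
      exact (totalDegree_sub _ _).trans_lt (max_lt (hdeg hg) (hdeg hg''))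
    · simp only [Finset.mem_image, Finset.mem_univ, true_and, forall_exists_index,
        forall_apply_eq_imp_iff]
      intro m x hx0 hx
      have := h02 m x hx
      rw [hg, hg''] at this
      simp only [map_mul, eval_X, map_sub] at this ⊢
      rw [hx] at this
      refine (mul_left_cancel₀ (mul_ne_zero (a := (m + 1 : ℤ)) (by positivity) hx0) ?_)
      linear_combination this
  refine ⟨g, hg, ?_, ?_⟩
  · rw [hg', eq_neg_of_add_eq_zero_right e1, mul_neg]
  · rw [hg'', sub_eq_zero.1 e2]

end

/-! ### Projections along a direction -/

section

open AlgebraicTopology unitInterval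

/-- The number of lattice points in a parallelogram with sides `n` or `i`, as an oriented area. -/
theorem MapsToParallelogram.latticeTotal_eq {X : TopCat.{0}} {F : C(X, ℂ)}
    (hF : ∀ x p, F x ≠ latticePoint p) {c : ChainQuot X} {a A B : ℂ}
    (h : MapsToParallelogram F c a A B) (hre : -1 < a.re ∧ a.re < 0) (him : -1 < a.im ∧ a.im < 0)
    (hA : A = Complex.I ∨ ∃ n : ℕ, A = n) (hB : B = Complex.I ∨ ∃ n : ℕ, B = n) :
    latticeTotal hF c = 2 * Real.pi * Complex.I * (A.re * B.im - A.im * B.re : ℝ) := by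
  obtain rfl | ⟨n, rfl⟩ := hA <;> obtain rfl | ⟨m, rfl⟩ := hB
  · rw [h.latticeTotal_degenerate hF hre him (.inr (by simp))]
    simp
  · rw [h.latticeTotal_rectangle' hF hre him]
    simp
    ring
  · rw [h.latticeTotal_rectangle hF hre him]
    simp
    ring
  · rw [h.latticeTotal_degenerate hF hre him (.inl (by simp))]
    simp

/-- The coordinate `xᵢ - vᵢ x_q`, which is constant along the direction `v` if `v_q = 1`. -/
def slantCoord {d : ℕ} {R : Type*} [CommRing R] (v : Fin d → ℤ) (q i : Fin d) :
    (Fin d → R) →+ R where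
  toFun x := x i - v i * x q
  map_zero' := by simp
  map_add' x y := by simp only [Pi.add_apply]; ring

theorem slantCoord_apply {d : ℕ} {R : Type*} [CommRing R] (v : Fin d → ℤ) (q i : Fin d)
    (x : Fin d → R) : slantCoord v q i x = x i - v i * x q := rfl

theorem slantCoord_intCast {d : ℕ} (v : Fin d → ℤ) (q i : Fin d) (g : Fin d → ℤ) :
    slantCoord v q i (fun j => (g j : ℝ)) = (slantCoord v q i g : ℤ) := by
  simp [slantCoord_apply]

theorem slantCoord_smul {d : ℕ} (v : Fin d → ℤ) (q i : Fin d) (t : ℝ) (x : Fin d → ℝ) :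
    slantCoord v q i (t • x) = t * slantCoord v q i x := by
  simp [slantCoord_apply]
  ring

@[fun_prop]
theorem continuous_slantCoord {d : ℕ} (v : Fin d → ℤ) (q i : Fin d) :
    Continuous (slantCoord v q i : (Fin d → ℝ) →+ ℝ) := by
  change Continuous fun x : Fin d → ℝ => x i - v i * x q
  fun_prop

theorem mem_range_torusCurve {d : ℕ} {v : Fin d → ℤ} {q : Fin d} (hq : v q = 1) {c p : Torus d} :
    p ∈ range (torusCurve v c) ↔ ∀ i, p i - v i • p q = c i - v i • c q := by
  constructor
  · rintro ⟨t, rfl⟩ i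
    change c i + v i • t - v i • (c q + v q • t) = _
    rw [hq, one_smul, smul_add]
    abel
  · intro h
    refine ⟨p q - c q, funext fun i => ?_⟩
    change c i + v i • (p q - c q) = p i
    rw [smul_sub, sub_eq_iff_eq_add.1 (h i)]
    abel

theorem mem_range_torusCurve_torusProj {d : ℕ} {v : Fin d → ℤ} {q : Fin d} (hq : v q = 1)
    {c x : Fin d → ℝ} : torusProj d x ∈ range (torusCurve v (torusProj d c)) ↔
      ∀ i, i ≠ q → ∃ n : ℤ, slantCoord v q i x - slantCoord v q i c = n := by
  rw [mem_range_torusCurve hq]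
  have key (i) : torusProj d x i - v i • torusProj d x q =
      torusProj d c i - v i • torusProj d c q ↔
      ∃ n : ℤ, slantCoord v q i x - slantCoord v q i c = n := by
    have e (y : Fin d → ℝ) : torusProj d y i - v i • torusProj d y q =
        ((slantCoord v q i y : ℝ) : UnitAddCircle) := by
      rw [slantCoord_apply, ← zsmul_eq_mul]
      rfl
    rw [e, e, ← sub_eq_zero, ← AddCircle.coe_sub, AddCircle.coe_eq_zero_iff]
    simp [eq_comm]
  simp_rw [key]
  refine ⟨fun h i _ => h i, fun h i => ?_⟩
  by_cases hi : i = q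
  · subst hi
    exact ⟨0, by simp [slantCoord_apply, hq]⟩
  · exact h i hi

theorem torusCurve_injective {d : ℕ} {v : Fin d → ℤ} {q : Fin d} (hq : v q = 1) (c : Torus d) :
    Function.Injective (torusCurve v c) := fun s t h => by
  have h : c q + v q • s = c q + v q • t := congrFun h q
  simpa [hq] using h

theorem isEmbedding_torusCurve {d : ℕ} {v : Fin d → ℤ} {q : Fin d} (hq : v q = 1) (c : Torus d) :
    Topology.IsEmbedding (torusCurve v c) :=
  ((torusCurve v c).continuous.isClosedEmbedding (torusCurve_injective hq c)).isEmbedding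

theorem coe_unitAddCircle_ne {a b : ℝ} (ha : 0 ≤ a ∧ a < 1) (hb : 0 ≤ b ∧ b < 1) (hab : a ≠ b) :
    (a : UnitAddCircle) ≠ b := fun h => hab <|
  (AddCircle.coe_eq_coe_iff_of_mem_Ico (p := 1) (a := 0) (by simpa using ha)
    (by simpa using hb)).1 h

/-- The pair of integral slanted coordinates. -/
def slantPair {d : ℕ} (v : Fin d → ℤ) (q a b : Fin d) : (Fin d → ℤ) →+ ℤ × ℤ :=
  (slantCoord v q a).prod (slantCoord v q b)

/-- Every weight of the deck group that vanishes on `v` factors through the slanted coordinates. -/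
theorem exists_weight {v : Fin 3 → ℤ} {q a b : Fin 3} (habq : ∀ i, i = q ∨ i = a ∨ i = b)
    (hqa : a ≠ q) (hqb : b ≠ q) (hab : a ≠ b) {x : Fin 3 → ℤ}
    (hx : x q = -(v a * x a) - v b * x b) :
    ∃ w : ℤ × ℤ →+ ℤ, ∀ i, w (slantPair v q a b (Pi.single i 1)) = x i := by
  refine ⟨(AddMonoidHom.mulLeft (x a)).coprod (AddMonoidHom.mulLeft (x b)), fun i => ?_⟩
  obtain rfl | rfl | rfl := habq i
  · simp [slantPair, slantCoord_apply, hqa, hqb, hx]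
    ring
  · simp [slantPair, slantCoord_apply, hqa.symm, hab.symm]
  · simp [slantPair, slantCoord_apply, hqb.symm, hab]

namespace CubicalSkeleton

variable {A : Set (Torus 3)} {v : Fin 3 → ℤ} {c : Fin 3 → ℝ} {q a b : Fin 3}

variable (A v c q a b) in
/-- The projection of `ℝ³` along `v` to the plane, with the line through `c` sent to `0`. -/
noncomputable def planeMap : C((torusCover 3).lift A, ℂ) :=
  ⟨fun x : (torusCover 3).proj ⁻¹' A =>
      ((slantCoord v q a x.1 - slantCoord v q a c : ℝ) : ℂ) +
        ((slantCoord v q b x.1 - slantCoord v q b c : ℝ) : ℂ) * Complex.I, by fun_prop⟩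

theorem planeMap_apply (x : (torusCover 3).lift A) : planeMap A v c q a b x =
    ((slantCoord v q a x.1 - slantCoord v q a c : ℝ) : ℂ) +
      ((slantCoord v q b x.1 - slantCoord v q b c : ℝ) : ℂ) * Complex.I := rfl

theorem planeMap_ne (hq : v q = 1) (habq : ∀ i, i = q ∨ i = a ∨ i = b)
    (hA : Disjoint A (range (torusCurve v (torusProj 3 c)))) (x : (torusCover 3).lift A)
    (p : ℤ × ℤ) : planeMap A v c q a b x ≠ latticePoint p := fun h => by
  refine disjoint_left.1 hA x.2 ((mem_range_torusCurve_torusProj hq).2 fun i hi => ?_)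
  have hre := congrArg Complex.re h
  have him := congrArg Complex.im h
  rw [planeMap_apply, latticePoint_re] at hre
  rw [planeMap_apply, latticePoint_im] at him
  obtain rfl | rfl | rfl := habq i
  · exact absurd rfl hi
  · exact ⟨p.1, by simpa using hre⟩
  · exact ⟨p.2, by simpa using him⟩

theorem planeMap_deckMap (g : Multiplicative (Fin 3 → ℤ)) (x : (torusCover 3).lift A) :
    planeMap A v c q a b ((torusCover 3).deckMap A g x) =
      planeMap A v c q a b x + latticePoint (slantPair v q a b g.toAdd) := by
  have e (i : Fin 3) : slantCoord v q i ((torusCover 3).deckMap A g x).1 =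
      (slantCoord v q i g.toAdd : ℤ) + slantCoord v q i x.1 := by
    rw [← slantCoord_intCast, ← map_add]
    rfl
  rw [planeMap_apply, planeMap_apply, e, e]
  apply Complex.ext
  · simp [latticePoint_re, slantPair]
    ring
  · simp [latticePoint_im, slantPair]
    ring

variable (v q a b) in
/-- The image of a coordinate vector under the projection to the plane. -/
noncomputable def planeVector (i : Fin 3) : ℂ :=
  (slantCoord v q a (Pi.single i 1 : Fin 3 → ℤ) : ℤ) +
    (slantCoord v q b (Pi.single i 1 : Fin 3 → ℤ) : ℤ) * Complex.I

theorem mapsToParallelogram_square (hA : torusSpine ⊆ A) (i j : Fin 3) :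
    MapsToParallelogram (planeMap A v c q a b)
      (chainQuotMap ((torusCover 3).inclMap hA) (square i j))
      (-(slantCoord v q a c : ℝ) - (slantCoord v q b c : ℝ) * Complex.I)
      (planeVector v q a b i) (planeVector v q a b j) := by
  have hs (g : Fin 3 → ℤ) (i : Fin 3) (t : ℝ) (k : Fin 3) : slantCoord v q k (line g i t).1 =
      (slantCoord v q k g : ℤ) + t * (slantCoord v q k (Pi.single i 1 : Fin 3 → ℤ) : ℤ) := by
    have e : (Pi.single i t : Fin 3 → ℝ) =
        t • fun l => ((Pi.single i 1 : Fin 3 → ℤ) l : ℝ) := by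
      ext l
      by_cases h : l = i
      · subst h; simp
      · simp [h]
    rw [line_val, map_add, e, slantCoord_smul, slantCoord_intCast,
      show pt g = fun l => (g l : ℝ) from rfl, slantCoord_intCast]
  have hF (g : Fin 3 → ℤ) (i : Fin 3) (t : ℝ) :
      planeMap A v c q a b ((torusCover 3).inclMap hA (line g i t)) =
      (-(slantCoord v q a c : ℝ) - (slantCoord v q b c : ℝ) * Complex.I) +
        ((slantCoord v q a g : ℤ) + (slantCoord v q b g : ℤ) * Complex.I) +
        t * planeVector v q a b i := by
    rw [planeMap_apply]
    have e (k) : slantCoord v q k ((torusCover 3).inclMap hA (line g i t)).1 =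
      slantCoord v q k (line g i t).1 := rfl
    rw [e, e, hs, hs, planeVector]
    push_cast
    ring
  let path (g : Fin 3 → ℤ) (i : Fin 3) : C(I, (torusCover 3).lift A) :=
    ((torusCover 3).inclMap hA).hom.comp ((line g i).comp (segmentPath 0 ((1 : ℤ) : ℝ)))
  refine ⟨path 0 i, path (Pi.single i 1) j, path (Pi.single j 1) i, path 0 j, ?_,
    fun t => ?_, fun t => ?_, fun t => ?_, fun t => ?_⟩
  · simp only [square, run, map_sub, map_add, chainQuotMap_pathClass]
    rfl
  all_goals
    refine (hF _ _ _).trans ?_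
    simp only [segmentPath_apply, planeVector, map_zero]
    simp
    ring

/-- For every weight `x` orthogonal to `v` there is a test from the winding numbers around the curve
with direction `v`. Its constant coefficient on a lattice square is `2πi` times the oriented area of
the projection of the square. -/
theorem exists_test (hG : torusSpine ⊆ A) (hq : v q = 1) (habq : ∀ i, i = q ∨ i = a ∨ i = b)
    (hqa : a ≠ q) (hqb : b ≠ q) (hab : a ≠ b)
    (hA : Disjoint A (range (torusCurve v (torusProj 3 c)))) (hvb : v b = 0) (hva : v a ≤ 0)
    (hca : 0 < slantCoord v q a c ∧ slantCoord v q a c < 1)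
    (hcb : 0 < slantCoord v q b c ∧ slantCoord v q b c < 1)
    {x : Fin 3 → ℤ} (hx : x q = -(v a * x a)) :
    ∃ Ψ : SeriesTest (d := 3) ((torusCover 3).H1 A), (fun i => Ψ.weight (Pi.single i 1)) = x ∧
      ∀ n, PowerSeries.constantCoeff (Ψ.toFun ((torusCover 3).H1Map hG (gen n))) =
        2 * Real.pi * Complex.I *
          (slantCoord v q a (Pi.single (directions n).1 1 : Fin 3 → ℤ) *
              slantCoord v q b (Pi.single (directions n).2 1 : Fin 3 → ℤ) -
            slantCoord v q b (Pi.single (directions n).1 1 : Fin 3 → ℤ) *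
              slantCoord v q a (Pi.single (directions n).2 1 : Fin 3 → ℤ) : ℤ) := by
  obtain ⟨w, hw⟩ := exists_weight (v := v) habq hqa hqb hab (x := x) (by rw [hx, hvb]; ring)
  have hF := planeMap_ne (c := c) hq habq hA
  refine ⟨(torusCover 3).latticeTest (planeMap A v c q a b) hF (slantPair v q a b)
    planeMap_deckMap w, funext hw, fun n => ?_⟩
  have hside (i : Fin 3) : planeVector v q a b i = Complex.I ∨
      ∃ n : ℕ, planeVector v q a b i = n := by
    obtain rfl | rfl | rfl := habq i
    · refine .inr ⟨(v a).natAbs, ?_⟩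
      have : ((v a).natAbs : ℂ) = ((-v a : ℤ) : ℂ) := by
        rw [← Int.cast_natCast, Int.ofNat_natAbs_of_nonpos hva]
      simp [planeVector, slantCoord_apply, hqa, hqb, hvb, this]
    · exact .inr ⟨1, by simp [planeVector, slantCoord_apply, hqa.symm, hab.symm]⟩
    · exact .inl (by simp [planeVector, slantCoord_apply, hqb.symm, hab])
  rw [LatticeCover.constantCoeff_latticeTest, LatticeCover.toChain_H1Map, toChain_gen,
    (mapsToParallelogram_square hG _ _).latticeTotal_eq hF ?_ ?_ (hside _) (hside _)]
  · simp [planeVector]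
  · simp; exact hca.symm
  · simp; exact hcb.symm

end CubicalSkeleton

end

/-! ### The link in `T³` -/

namespace CubicalSkeleton

/-- Base points of the components in `T³`. -/
noncomputable def base (k : ℕ) : Fin 3 ⊕ (Fin k ⊕ Fin k) → Fin 3 → ℝ
  | .inl i => ![![0, 1 / 2, 1 / 2], ![1 / 2, 0, 1 / 4], ![3 / 4, 3 / 4, 0]] i
  | .inr (.inl j) => ![0, (j + 1) / (2 * k + 2), 1 / 2]
  | .inr (.inr j) => ![(j + 1) / (2 * k + 2), 0, 1 / 4]

/-- The components in `T³`. -/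
noncomputable def component (k : ℕ) (i : Fin 3 ⊕ (Fin k ⊕ Fin k)) : C(UnitAddCircle, Torus 3) :=
  torusCurve (torusDirection k i) (torusProj 3 (base k i))

variable {k : ℕ} {p : Torus 3}

theorem of_mem_component_zero (h : p ∈ range (component k (.inl 0))) :
    p 1 = ((1 / 2 : ℝ) : UnitAddCircle) ∧ p 2 = ((1 / 2 : ℝ) : UnitAddCircle) := by
  have := (mem_range_torusCurve (q := 0) rfl).1 h
  exact ⟨by simpa [torusDirection, torusProj, base] using this 1,
    by simpa [torusDirection, torusProj, base] using this 2⟩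

theorem of_mem_component_one (h : p ∈ range (component k (.inl 1))) :
    p 0 = ((1 / 2 : ℝ) : UnitAddCircle) ∧ p 2 = ((1 / 4 : ℝ) : UnitAddCircle) := by
  have := (mem_range_torusCurve (q := 1) rfl).1 h
  exact ⟨by simpa [torusDirection, torusProj, base] using this 0,
    by simpa [torusDirection, torusProj, base] using this 2⟩

theorem of_mem_component_two (h : p ∈ range (component k (.inl 2))) :
    p 0 = ((3 / 4 : ℝ) : UnitAddCircle) ∧ p 1 = ((3 / 4 : ℝ) : UnitAddCircle) := by
  have := (mem_range_torusCurve (q := 2) rfl).1 h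
  exact ⟨by simpa [torusDirection, torusProj, base] using this 0,
    by simpa [torusDirection, torusProj, base] using this 1⟩

theorem of_mem_component_inl {j : Fin k} (h : p ∈ range (component k (.inr (.inl j)))) :
    p 1 = (((j + 1) / (2 * k + 2) : ℝ) : UnitAddCircle) ∧
      p 2 + (j + 1 : ℤ) • p 0 = ((1 / 2 : ℝ) : UnitAddCircle) := by
  have := (mem_range_torusCurve (q := 0) rfl).1 h
  exact ⟨by simpa [torusDirection, torusProj, base] using this 1,
    by simpa [torusDirection, torusProj, base, sub_smul, add_smul, sub_neg_eq_add, sub_eq_add_neg]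
      using this 2⟩

theorem of_mem_component_inr {j : Fin k} (h : p ∈ range (component k (.inr (.inr j)))) :
    p 0 = (((j + 1) / (2 * k + 2) : ℝ) : UnitAddCircle) ∧
      p 2 + (j + 1 : ℤ) • p 1 = ((1 / 4 : ℝ) : UnitAddCircle) := by
  have := (mem_range_torusCurve (q := 1) rfl).1 h
  exact ⟨by simpa [torusDirection, torusProj, base] using this 0,
    by simpa [torusDirection, torusProj, base, sub_smul, add_smul, sub_neg_eq_add, sub_eq_add_neg]
      using this 2⟩

theorem offset_bounds (j : Fin k) : (0 : ℝ) < (j + 1) / (2 * k + 2) ∧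
    ((j + 1) / (2 * k + 2) : ℝ) < 1 / 2 := by
  have h : ((j : ℕ) : ℝ) + 1 ≤ k := by exact_mod_cast j.2
  refine ⟨by positivity, ?_⟩
  rw [div_lt_iff₀ (by positivity)]
  linarith

theorem offset_ne {j : Fin k} {a : ℝ} (ha : 1 / 2 ≤ a ∧ a < 1) :
    (((j + 1) / (2 * k + 2) : ℝ) : UnitAddCircle) ≠ a :=
  coe_unitAddCircle_ne ⟨(offset_bounds j).1.le, by linarith [(offset_bounds j).2]⟩
    ⟨by linarith [ha.1], ha.2⟩ (by linarith [(offset_bounds j).2, ha.1])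

theorem offset_injective : Function.Injective fun j : Fin k =>
    (((j + 1) / (2 * k + 2) : ℝ) : UnitAddCircle) := fun i j h => by
  by_contra hij
  refine coe_unitAddCircle_ne ⟨(offset_bounds i).1.le, by linarith [(offset_bounds i).2]⟩
    ⟨(offset_bounds j).1.le, by linarith [(offset_bounds j).2]⟩ (fun h' => hij ?_) h
  have h0 : (2 * k + 2 : ℝ) ≠ 0 := by positivity
  rw [div_left_inj' h0] at h'
  exact Fin.ext (by exact_mod_cast add_right_cancel h')

theorem quarter_ne_half_multiple (n : ℤ) :
    ((1 / 2 : ℝ) : UnitAddCircle) + n • ((1 / 2 : ℝ) : UnitAddCircle) ≠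
      ((1 / 4 : ℝ) : UnitAddCircle) := fun h => by
  have h1 : (2 : ℤ) • ((1 / 2 : ℝ) : UnitAddCircle) = 0 := by
    rw [← AddCircle.coe_zsmul, AddCircle.coe_eq_zero_iff]
    exact ⟨1, by norm_num⟩
  have h2 := congrArg (fun z : UnitAddCircle => (2 : ℤ) • z) h
  simp only [smul_add, smul_comm (2 : ℤ) n, h1, smul_zero, add_zero] at h2
  rw [← AddCircle.coe_zsmul, eq_comm, AddCircle.coe_eq_zero_iff] at h2
  obtain ⟨m, hm⟩ := h2
  have h3 : ((2 * m : ℤ) : ℝ) = (1 : ℤ) := by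
    push_cast
    simp at hm
    linarith
  have : 2 * m = 1 := by exact_mod_cast h3
  omega

theorem half_ne_quarter : ((1 / 2 : ℝ) : UnitAddCircle) ≠ ((1 / 4 : ℝ) : UnitAddCircle) :=
  coe_unitAddCircle_ne (by norm_num) (by norm_num) (by norm_num)

theorem half_ne_three_quarters :
    ((1 / 2 : ℝ) : UnitAddCircle) ≠ ((3 / 4 : ℝ) : UnitAddCircle) :=
  coe_unitAddCircle_ne (by norm_num) (by norm_num) (by norm_num)

theorem disjoint_component {i j : Fin 3 ⊕ (Fin k ⊕ Fin k)} (hij : i ≠ j) :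
    Disjoint (range (component k i)) (range (component k j)) := by
  have d01 : Disjoint (range (component k (.inl 0))) (range (component k (.inl 1))) :=
    disjoint_left.2 fun p h h' => half_ne_quarter
      ((of_mem_component_zero h).2.symm.trans (of_mem_component_one h').2)
  have d02 : Disjoint (range (component k (.inl 0))) (range (component k (.inl 2))) :=
    disjoint_left.2 fun p h h' => half_ne_three_quarters
      ((of_mem_component_zero h).1.symm.trans (of_mem_component_two h').2)
  have d12 : Disjoint (range (component k (.inl 1))) (range (component k (.inl 2))) :=
    disjoint_left.2 fun p h h' => half_ne_three_quarters
      ((of_mem_component_one h).1.symm.trans (of_mem_component_two h').1)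
  have d0l (j) : Disjoint (range (component k (.inl 0))) (range (component k (.inr (.inl j)))) :=
    disjoint_left.2 fun p h h' => offset_ne (by norm_num)
      ((of_mem_component_inl h').1.symm.trans (of_mem_component_zero h).1)
  have d0r (j) : Disjoint (range (component k (.inl 0))) (range (component k (.inr (.inr j)))) :=
    disjoint_left.2 fun p h h' => by
      have := (of_mem_component_inr h').2
      rw [(of_mem_component_zero h).1, (of_mem_component_zero h).2] at this
      exact quarter_ne_half_multiple _ this
  have d1l (j) : Disjoint (range (component k (.inl 1))) (range (component k (.inr (.inl j)))) :=
    disjoint_left.2 fun p h h' => by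
      have := (of_mem_component_inl h').2
      rw [(of_mem_component_one h).1, (of_mem_component_one h).2, ← eq_sub_iff_add_eq] at this
      refine quarter_ne_half_multiple (-(j + 1)) ?_
      rw [this, neg_smul, sub_eq_add_neg]
  have d1r (j) : Disjoint (range (component k (.inl 1))) (range (component k (.inr (.inr j)))) :=
    disjoint_left.2 fun p h h' => offset_ne (by norm_num)
      ((of_mem_component_inr h').1.symm.trans (of_mem_component_one h).1)
  have d2l (j) : Disjoint (range (component k (.inl 2))) (range (component k (.inr (.inl j)))) :=
    disjoint_left.2 fun p h h' => offset_ne (by norm_num)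
      ((of_mem_component_inl h').1.symm.trans (of_mem_component_two h).2)
  have d2r (j) : Disjoint (range (component k (.inl 2))) (range (component k (.inr (.inr j)))) :=
    disjoint_left.2 fun p h h' => offset_ne (by norm_num)
      ((of_mem_component_inr h').1.symm.trans (of_mem_component_two h).1)
  -- both curves would have `x₂ + ij / (2k + 2)` equal to their own constant
  have dlr (i j) :
      Disjoint (range (component k (.inr (.inl i)))) (range (component k (.inr (.inr j)))) :=
    disjoint_left.2 fun p h h' => half_ne_quarter <| by
      rw [← (of_mem_component_inl h).2, ← (of_mem_component_inr h').2,
        (of_mem_component_inl h).1, (of_mem_component_inr h').1, ← AddCircle.coe_zsmul,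
        ← AddCircle.coe_zsmul]
      congr 2
      simp only [zsmul_eq_mul]
      push_cast
      ring
  rcases i with i | i | i <;> rcases j with j | j | j
  · fin_cases i <;> fin_cases j <;>
      first
      | exact absurd rfl hij | exact d01 | exact d02 | exact d12
      | exact d01.symm | exact d02.symm | exact d12.symm
  · fin_cases i <;> first | exact d0l j | exact d1l j | exact d2l j
  · fin_cases i <;> first | exact d0r j | exact d1r j | exact d2r j
  · fin_cases j <;> first | exact (d0l i).symm | exact (d1l i).symm | exact (d2l i).symm
  · refine disjoint_left.2 fun p h h' => hij ?_
    rw [offset_injective ((of_mem_component_inl h).1.symm.trans (of_mem_component_inl h').1)]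
  · exact dlr i j
  · fin_cases j <;> first | exact (d0r i).symm | exact (d1r i).symm | exact (d2r i).symm
  · exact (dlr j i).symm
  · refine disjoint_left.2 fun p h h' => hij ?_
    rw [offset_injective ((of_mem_component_inr h).1.symm.trans (of_mem_component_inr h').1)]

theorem exists_direction_eq_one (i : Fin 3 ⊕ (Fin k ⊕ Fin k)) :
    ∃ q, torusDirection k i q = 1 := by
  rcases i with i | i | i
  · exact ⟨i, by simp [torusDirection]⟩
  · exact ⟨0, rfl⟩
  · exact ⟨1, rfl⟩

theorem isLink_component : IsLink (component k) := by
  refine ⟨fun i => ?_, fun i j => disjoint_component⟩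
  obtain ⟨q, hq⟩ := exists_direction_eq_one i
  exact isEmbedding_torusCurve hq _

theorem disjoint_compl_component (i : Fin 3 ⊕ (Fin k ⊕ Fin k)) :
    Disjoint (linkSupport (component k))ᶜ (range (component k i)) :=
  disjoint_compl_left.mono_right (subset_iUnion (fun i => range (component k i)) i)

theorem torusSpine_subset : torusSpine ⊆ (linkSupport (component k))ᶜ := by
  rintro p ⟨l, hl⟩ hp
  have h2 : (0 : UnitAddCircle) ≠ ((1 / 2 : ℝ) : UnitAddCircle) :=
    coe_unitAddCircle_ne (a := 0) (by norm_num) (by norm_num) (by norm_num)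
  have h4 : (0 : UnitAddCircle) ≠ ((1 / 4 : ℝ) : UnitAddCircle) :=
    coe_unitAddCircle_ne (a := 0) (by norm_num) (by norm_num) (by norm_num)
  have h34 : (0 : UnitAddCircle) ≠ ((3 / 4 : ℝ) : UnitAddCircle) :=
    coe_unitAddCircle_ne (a := 0) (by norm_num) (by norm_num) (by norm_num)
  have hj (j : Fin k) : (0 : UnitAddCircle) ≠ (((j + 1) / (2 * k + 2) : ℝ) : UnitAddCircle) :=
    coe_unitAddCircle_ne (a := 0) (by norm_num)
      ⟨(offset_bounds j).1.le, by linarith [(offset_bounds j).2]⟩ (offset_bounds j).1.ne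
  obtain ⟨i, hi⟩ := mem_iUnion.1 hp
  -- two of the coordinates vanish on the spine, and no two of them vanish on the link
  have hz : (p 0 = 0 ∨ p 1 = 0) ∧ (p 0 = 0 ∨ p 2 = 0) ∧ (p 1 = 0 ∨ p 2 = 0) := by
    fin_cases l
    · exact ⟨.inr (hl 1 (by decide)), .inr (hl 2 (by decide)), .inr (hl 2 (by decide))⟩
    · exact ⟨.inl (hl 0 (by decide)), .inl (hl 0 (by decide)), .inr (hl 2 (by decide))⟩
    · exact ⟨.inl (hl 0 (by decide)), .inl (hl 0 (by decide)), .inl (hl 1 (by decide))⟩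
  rcases i with i | j | j
  · fin_cases i
    · obtain ⟨e, e'⟩ := of_mem_component_zero hi
      exact hz.2.2.elim (fun h => h2 (h.symm.trans e)) fun h => h2 (h.symm.trans e')
    · obtain ⟨e, e'⟩ := of_mem_component_one hi
      exact hz.2.1.elim (fun h => h2 (h.symm.trans e)) fun h => h4 (h.symm.trans e')
    · obtain ⟨e, e'⟩ := of_mem_component_two hi
      exact hz.1.elim (fun h => h34 (h.symm.trans e)) fun h => h34 (h.symm.trans e')
  · obtain ⟨e, e'⟩ := of_mem_component_inl hi
    have h1 : p 1 ≠ 0 := fun h => hj j (h.symm.trans e)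
    rw [hz.1.resolve_right h1, hz.2.2.resolve_left h1, smul_zero, add_zero] at e'
    exact h2 e'
  · obtain ⟨e, e'⟩ := of_mem_component_inr hi
    have h1 : p 0 ≠ 0 := fun h => hj j (h.symm.trans e)
    rw [hz.1.resolve_left h1, hz.2.1.resolve_left h1, smul_zero, add_zero] at e'
    exact h4 e'

theorem grMap_injective_torus {j : ℕ} (hj : 1 ≤ j) (hjk : j ≤ k) :
    Function.Injective
      (grMap (augIdeal 3) ((torusCover 3).H1Map (torusSpine_subset (k := k))) j) := by
  refine grMap_injective_of_tests span_gen _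
    (id : SeriesTest (d := 3) ((torusCover 3).H1 (linkSupport (component k))ᶜ) → _) j
    fun F hF ht => ?_
  -- the condition of one curve, with the common factor `2πi` removed
  have key {i : Fin 3 ⊕ (Fin k ⊕ Fin k)} {q a b : Fin 3} (hq : torusDirection k i q = 1)
      (habq : ∀ i, i = q ∨ i = a ∨ i = b) (hqa : a ≠ q) (hqb : b ≠ q) (hab : a ≠ b)
      (hvb : torusDirection k i b = 0) (hva : torusDirection k i a ≤ 0)
      (hca : 0 < slantCoord (torusDirection k i) q a (base k i) ∧
        slantCoord (torusDirection k i) q a (base k i) < 1)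
      (hcb : 0 < slantCoord (torusDirection k i) q b (base k i) ∧
        slantCoord (torusDirection k i) q b (base k i) < 1)
      {x : Fin 3 → ℤ} (hx : x q = -(torusDirection k i a * x a)) :
      ∑ n, MvPolynomial.eval x (F n) *
        (slantCoord (torusDirection k i) q a (Pi.single (directions n).1 1 : Fin 3 → ℤ) *
            slantCoord (torusDirection k i) q b (Pi.single (directions n).2 1 : Fin 3 → ℤ) -
          slantCoord (torusDirection k i) q b (Pi.single (directions n).1 1 : Fin 3 → ℤ) *
            slantCoord (torusDirection k i) q a (Pi.single (directions n).2 1 : Fin 3 → ℤ)) =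
        0 := by
    obtain ⟨Ψ, rfl, hΨ⟩ := exists_test torusSpine_subset hq habq hqa hqb hab
      (disjoint_compl_component i) hvb hva hca hcb hx
    have := ht Ψ
    simp only [id, hΨ, mul_left_comm _ (2 * Real.pi * Complex.I : ℂ)] at this
    rw [← Finset.mul_sum, mul_eq_zero, or_iff_right Complex.two_pi_I_ne_zero] at this
    exact_mod_cast this
  have e : ∃ g, F 0 = MvPolynomial.X 2 * g ∧ F 1 = -(MvPolynomial.X 1 * g) ∧
      F 2 = MvPolynomial.X 0 * g := by
    refine exists_eq_mul_of_eval_three hj hjk (fun b => (hF b).totalDegree_le)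
      (fun x hx => ?_) (fun x hx => ?_) (fun x hx => ?_) (fun m x hx => ?_) fun m x hx => ?_
    · have := key (i := .inl 0) (q := 0) (a := 1) (b := 2) rfl (by decide) (by decide) (by decide)
        (by decide) rfl le_rfl (by simp [slantCoord_apply, torusDirection, base]; norm_num)
        (by simp [slantCoord_apply, torusDirection, base]; norm_num) (x := x)
        (by simpa [torusDirection] using hx)
      simpa [Fin.sum_univ_three, slantCoord_apply, torusDirection, directions] using this
    · have := key (i := .inl 1) (q := 1) (a := 0) (b := 2) rfl (by decide) (by decide) (by decide)
        (by decide) rfl le_rfl (by simp [slantCoord_apply, torusDirection, base]; norm_num)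
        (by simp [slantCoord_apply, torusDirection, base]; norm_num) (x := x)
        (by simpa [torusDirection] using hx)
      simpa [Fin.sum_univ_three, slantCoord_apply, torusDirection, directions] using this
    · have := key (i := .inl 2) (q := 2) (a := 0) (b := 1) rfl (by decide) (by decide) (by decide)
        (by decide) rfl le_rfl (by simp [slantCoord_apply, torusDirection, base]; norm_num)
        (by simp [slantCoord_apply, torusDirection, base]; norm_num) (x := x)
        (by simpa [torusDirection] using hx)
      simpa [Fin.sum_univ_three, slantCoord_apply, torusDirection, directions] using this
    · have hb := offset_bounds m
      have := key (i := .inr (.inl m)) (q := 0) (a := 2) (b := 1) rfl (by decide) (by decide)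
        (by decide) (by decide) rfl (by simp [torusDirection])
        (by simp [slantCoord_apply, torusDirection, base]; norm_num)
        (by simpa [slantCoord_apply, torusDirection, base] using ⟨hb.1, by linarith [hb.2]⟩)
        (x := x) (by simp [torusDirection]; linear_combination hx)
      simp [Fin.sum_univ_three, slantCoord_apply, torusDirection, directions] at this
      linear_combination this
    · have hb := offset_bounds m
      have := key (i := .inr (.inr m)) (q := 1) (a := 2) (b := 0) rfl (by decide) (by decide)
        (by decide) (by decide) rfl (by simp [torusDirection])
        (by simp [slantCoord_apply, torusDirection, base]; norm_num)
        (by simpa [slantCoord_apply, torusDirection, base] using ⟨hb.1, by linarith [hb.2]⟩)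
        (x := x) (by simp [torusDirection]; linear_combination hx)
      simp [Fin.sum_univ_three, slantCoord_apply, torusDirection, directions] at this
      linear_combination -this
  obtain ⟨g, h0, h1, h2⟩ := e
  rw [Fin.sum_univ_three, h0, h1, h2]
  have := congrArg (fun y => MvPolynomial.aeval (augVar 3) g • y) gen_relation
  simp only [smul_add, smul_sub, smul_smul, smul_zero] at this
  rw [← this]
  simp only [map_mul, map_neg, MvPolynomial.aeval_X, neg_smul, mul_comm (augVar 3 _)]
  rw [sub_eq_add_neg]

end CubicalSkeleton

/-! ### The link in `T² × I` -/

section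

open AlgebraicTopology unitInterval

namespace RelSpine

/-- The index of the coordinate in which a direction equals `1`, and of the other coordinate. -/
def axes (k : ℕ) : Option (Fin (k + 1)) → Fin 2 × Fin 2
  | some _ => (0, 1)
  | none => (1, 0)

/-- Base points of the components in `T² × I`. -/
noncomputable def base (k : ℕ) (i : Option (Fin (k + 1))) : Fin 2 → ℝ :=
  Pi.single (axes k i).2 (1 / 2)

/-- The position of a component among the `k + 2` levels. -/
def levelIndex (k : ℕ) : Option (Fin (k + 1)) → ℕ
  | some j => j + 2
  | none => 1

variable {k : ℕ}

theorem levelIndex_bounds (i : Option (Fin (k + 1))) :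
    0 < levelIndex k i ∧ levelIndex k i < k + 3 := by
  cases i <;> simp [levelIndex]
  omega

theorem levelIndex_injective : Function.Injective (levelIndex k) := by
  rintro (_ | i) (_ | j) h
  · rfl
  · simp [levelIndex] at h
  · simp [levelIndex] at h
  · simp [levelIndex] at h
    rw [Fin.ext h]

theorem level_bounds (i : Option (Fin (k + 1))) :
    0 < (levelIndex k i / (k + 3) : ℝ) ∧ (levelIndex k i / (k + 3) : ℝ) < 1 := by
  have h1 : (0 : ℝ) < levelIndex k i := by exact_mod_cast (levelIndex_bounds i).1
  have h2 : (levelIndex k i : ℝ) < k + 3 := by exact_mod_cast (levelIndex_bounds i).2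
  exact ⟨by positivity, (div_lt_one (by positivity)).2 h2⟩

/-- Levels of the components in `T² × I`. -/
noncomputable def level (k : ℕ) (i : Option (Fin (k + 1))) : I :=
  ⟨levelIndex k i / (k + 3), (level_bounds i).1.le, (level_bounds i).2.le⟩

theorem level_injective : Function.Injective (level k) := fun i j h => by
  have h := congrArg Subtype.val h
  have h0 : (k + 3 : ℝ) ≠ 0 := by positivity
  rw [level, level, div_left_inj' h0] at h
  exact levelIndex_injective (by exact_mod_cast h)

theorem level_mem (i : Option (Fin (k + 1))) : 0 < level k i ∧ level k i < 1 := level_bounds i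

/-- The components in `T² × I`. -/
noncomputable def component (k : ℕ) (i : Option (Fin (k + 1))) : C(UnitAddCircle, ThickTorus) :=
  levelCurve (relDirection k i) (torusProj 2 (base k i)) (level k i)

theorem relDirection_axes (i : Option (Fin (k + 1))) : relDirection k i (axes k i).1 = 1 := by
  cases i <;> rfl

theorem eq_axes (i : Option (Fin (k + 1))) (l : Fin 2) : l = (axes k i).1 ∨ l = (axes k i).2 := by
  cases i <;> fin_cases l <;> simp [axes]

theorem axes_ne (i : Option (Fin (k + 1))) : (axes k i).1 ≠ (axes k i).2 := by
  cases i <;> simp [axes]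

theorem mem_range_component {i : Option (Fin (k + 1))} {p : ThickTorus} :
    p ∈ range (component k i) ↔
      p.1 ∈ range (torusCurve (relDirection k i) (torusProj 2 (base k i))) ∧ p.2 = level k i := by
  constructor
  · rintro ⟨t, rfl⟩
    exact ⟨⟨t, rfl⟩, rfl⟩
  · rintro ⟨⟨t, ht⟩, h⟩
    exact ⟨t, Prod.ext ht h.symm⟩

theorem isLink_component : IsLink (component k) := by
  refine ⟨fun i => ?_, fun i j hij => disjoint_left.2 fun p h h' => hij ?_⟩
  · refine ((component k i).continuous.isClosedEmbedding fun s t h => ?_).isEmbedding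
    exact torusCurve_injective (relDirection_axes i) _ (congrArg Prod.fst h)
  · exact level_injective ((mem_range_component.1 h).2.symm.trans (mem_range_component.1 h').2)

/-- The coordinate of the torus that is constant along a component. -/
def slant (k : ℕ) (i : Option (Fin (k + 1))) {R : Type*} [CommRing R] : (Fin 2 → R) →+ R :=
  slantCoord (relDirection k i) (axes k i).1 (axes k i).2

theorem slant_base (i : Option (Fin (k + 1))) : slant k i (base k i) = 1 / 2 := by
  simp [slant, slantCoord_apply, base, axes_ne]

theorem not_mem_of_slant {i : Option (Fin (k + 1))} {x : Fin 2 → ℝ} {s : I}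
    (h : (torusProj 2 x, s) ∉ range (component k i)) (hs : s = level k i) (n : ℤ) :
    slant k i x - slant k i (base k i) ≠ n := fun hn => h <| by
  refine mem_range_component.2 ⟨(mem_range_torusCurve_torusProj (relDirection_axes i)).2
    fun l hl => ⟨n, ?_⟩, hs⟩
  rw [(eq_axes i l).resolve_left hl]
  exact hn

theorem relSpine_subset : relSpine ⊆ (linkSupport (component k))ᶜ := by
  intro p hp hp'
  obtain ⟨i, hi⟩ := mem_iUnion.1 hp'
  have hi := mem_range_component.1 hi
  have hl := level_mem i
  obtain h | h | h := hp
  · have := (mem_range_torusCurve (relDirection_axes i)).1 hi.1 (axes k i).2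
    rw [h] at this
    have e : torusProj 2 (base k i) (axes k i).1 = 0 ∧
        torusProj 2 (base k i) (axes k i).2 = ((1 / 2 : ℝ) : UnitAddCircle) :=
      ⟨by simp [torusProj, base, axes_ne], by simp [torusProj, base]⟩
    rw [e.1, e.2] at this
    simp only [Pi.zero_apply, smul_zero, sub_zero] at this
    exact coe_unitAddCircle_ne (a := 0) (b := 1 / 2) (by norm_num) (by norm_num) (by norm_num) this
  · exact hl.1.ne (h.symm.trans hi.2)
  · exact hl.2.ne (hi.2.symm.trans h)

/-- The preimage of the complement of the link in `ℝ² × I`. -/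
abbrev LinkCover (k : ℕ) : TopCat.{0} := thickTorusCover.lift (linkSupport (component k))ᶜ

/-- The projection of `ℝ² × I` along a component to a strip in the plane, with the component sent
to `0`. -/
noncomputable def stripMap (i : Option (Fin (k + 1))) : C(LinkCover k, ℂ) :=
  ⟨fun x : thickTorusCover.proj ⁻¹' (linkSupport (component k))ᶜ =>
      ((slant k i x.1.1 - slant k i (base k i) : ℝ) : ℂ) +
        ((x.1.2 - level k i : ℝ) : ℂ) * Complex.I, by unfold slant; fun_prop⟩

theorem stripMap_apply (i : Option (Fin (k + 1))) (x : LinkCover k) : stripMap i x =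
    ((slant k i x.1.1 - slant k i (base k i) : ℝ) : ℂ) +
      ((x.1.2 - level k i : ℝ) : ℂ) * Complex.I := rfl

theorem stripMap_ne (i : Option (Fin (k + 1))) (x : LinkCover k) (p : ℤ × ℤ) :
    stripMap i x ≠ latticePoint p := fun h => by
  have hre := congrArg Complex.re h
  have him := congrArg Complex.im h
  rw [stripMap_apply, latticePoint_re] at hre
  rw [stripMap_apply, latticePoint_im] at him
  simp at hre him
  have hl := level_bounds i
  have hs : (x.1.2 : ℝ) = level k i := by
    have h1 : ((level k i : I) : ℝ) = levelIndex k i / (k + 3) := rfl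
    have h2 := x.1.2.2.1
    have h3 := x.1.2.2.2
    have h4 : (-1 : ℝ) < p.2 := by linarith
    have h5 : (p.2 : ℝ) < 1 := by linarith
    have h6 : p.2 = 0 := by
      have h4 : -1 < p.2 := by exact_mod_cast h4
      have h5 : p.2 < 1 := by exact_mod_cast h5
      omega
    rw [h6] at him
    simpa [sub_eq_zero] using him
  refine not_mem_of_slant (s := x.1.2) (fun hx => ?_) (Subtype.ext hs) p.1 hre
  exact x.2 (mem_iUnion.2 ⟨i, hx⟩)

/-- The slanted coordinate of a translation, as a horizontal lattice point. -/
def slantLattice (k : ℕ) (i : Option (Fin (k + 1))) : (Fin 2 → ℤ) →+ ℤ × ℤ :=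
  (AddMonoidHom.inl ℤ ℤ).comp (slant k i)

theorem stripMap_deckMap (i : Option (Fin (k + 1))) (g : Multiplicative (Fin 2 → ℤ))
    (x : LinkCover k) : stripMap i (thickTorusCover.deckMap _ g x) =
      stripMap i x + latticePoint (slantLattice k i g.toAdd) := by
  have e : slant k i (thickTorusCover.deckMap _ g x).1.1 =
      (slant k i g.toAdd : ℤ) + slant k i x.1.1 := by
    rw [slant, slant, ← slantCoord_intCast, ← map_add]
    rfl
  rw [stripMap_apply, stripMap_apply, e]
  change _ + ((x.1.2 - level k i : ℝ) : ℂ) * Complex.I = _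
  apply Complex.ext
  · simp [latticePoint_re, slantLattice]
    ring
  · simp [latticePoint_im, slantLattice]

theorem mapsToParallelogram_loopChain (i : Option (Fin (k + 1))) (g : Fin 2 → ℤ) :
    MapsToParallelogram (stripMap i)
      (chainQuotMap (thickTorusCover.inclMap relSpine_subset) (loopChain g))
      (-(slant k i (base k i) : ℝ) - ((level k i : ℝ) : ℂ) * Complex.I) Complex.I
      (slant k i g : ℤ) := by
  let path (φ : C(I, Cover)) : C(I, LinkCover k) :=
    (thickTorusCover.inclMap relSpine_subset).hom.comp φ
  have hF (x : Cover) : stripMap i (thickTorusCover.inclMap relSpine_subset x) =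
      ((slant k i x.1.1 - slant k i (base k i) : ℝ) : ℂ) +
        ((x.1.2 - level k i : ℝ) : ℂ) * Complex.I := rfl
  have hpt (t : ℝ) : slant k i (t • pt g) = t * (slant k i g : ℤ) := by
    rw [slant, slant, slantCoord_smul, ← slantCoord_intCast]
    rfl
  have hpt' : slant k i (pt g) = (slant k i g : ℤ) := by simpa using hpt 1
  have hpt0 : pt 0 = 0 := by ext i; simp [pt]
  refine ⟨path ((vert 0).comp (segmentPath 0 1)), path (top.comp (segmentPath 0 (pt g))),
    path ((vert g).comp (segmentPath 0 1)), path (bot.comp (segmentPath 0 (pt g))), ?_,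
    fun t => ?_, fun t => ?_, fun t => ?_, fun t => ?_⟩
  · simp only [loopChain, map_sub, map_add, chainQuotMap_pathClass]
    rfl
  all_goals
    refine (hF _).trans ?_
    simp only [ContinuousMap.comp_apply, segmentPath_apply, vert_val, top_val, bot_val, hpt0]
    simp [hpt, hpt']
    ring

/-- For every weight `x` orthogonal to the direction of a component there is a test from the winding
numbers around it. Its constant coefficient on a loop is `2πi` times the oriented area that the
projection of the loop encloses. -/
theorem exists_test (i : Option (Fin (k + 1))) (hi : relDirection k i (axes k i).2 ≤ 0)
    {x : Fin 2 → ℤ} (hx : x (axes k i).1 = -(relDirection k i (axes k i).2 * x (axes k i).2)) :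
    ∃ Ψ : SeriesTest (d := 2) (thickTorusCover.H1 (linkSupport (component k))ᶜ),
      (fun l => Ψ.weight (Pi.single l 1)) = x ∧
      ∀ n, PowerSeries.constantCoeff (Ψ.toFun (thickTorusCover.H1Map relSpine_subset (gen n))) =
        -(2 * Real.pi * Complex.I) * (slant k i (Pi.single n 1 : Fin 2 → ℤ) : ℤ) := by
  refine ⟨thickTorusCover.latticeTest (stripMap i) (stripMap_ne i) (slantLattice k i)
    (stripMap_deckMap i)
    ((AddMonoidHom.mulLeft (x (axes k i).2)).comp (AddMonoidHom.fst ℤ ℤ)), ?_, fun n => ?_⟩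
  · funext l
    obtain rfl | rfl := eq_axes i l
    · simp [LatticeCover.latticeTest, slantLattice, slant, slantCoord_apply, hx,
        (axes_ne i).symm]
      ring
    · simp [LatticeCover.latticeTest, slantLattice, slant, slantCoord_apply, axes_ne]
  have hside : ∃ m : ℕ, (((slant k i (Pi.single n 1 : Fin 2 → ℤ) : ℤ) : ℂ)) = m := by
    obtain rfl | rfl := eq_axes i n
    · refine ⟨(relDirection k i (axes k i).2).natAbs, ?_⟩
      rw [← Int.cast_natCast, Int.ofNat_natAbs_of_nonpos hi]
      simp [slant, slantCoord_apply, (axes_ne i).symm]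
    · exact ⟨1, by simp [slant, slantCoord_apply, axes_ne]⟩
  have hl := level_bounds i
  rw [LatticeCover.constantCoeff_latticeTest, LatticeCover.toChain_H1Map, toChain_gen,
    (mapsToParallelogram_loopChain i _).latticeTotal_eq (stripMap_ne i) ?_ ?_ (.inl rfl)
      (.inr hside)]
  · simp
  · rw [slant_base]; norm_num
  · simp
    exact hl.symm

theorem grMap_injective_thickTorus {j : ℕ} (hjk : j ≤ k) : Function.Injective
    (grMap (augIdeal 2) (thickTorusCover.H1Map (relSpine_subset (k := k))) j) := by
  refine grMap_injective_of_tests span_gen _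
    (id : SeriesTest (d := 2) (thickTorusCover.H1 (linkSupport (component k))ᶜ) → _) j
    fun F hF ht => ?_
  -- the condition of one curve, with the common factor `-2πi` removed
  have key (i : Option (Fin (k + 1))) (hi : relDirection k i (axes k i).2 ≤ 0) {x : Fin 2 → ℤ}
      (hx : x (axes k i).1 = -(relDirection k i (axes k i).2 * x (axes k i).2)) :
      ∑ n, MvPolynomial.eval x (F n) * slant k i (Pi.single n 1 : Fin 2 → ℤ) = 0 := by
    obtain ⟨Ψ, rfl, hΨ⟩ := exists_test i hi hx
    have := ht Ψ
    simp only [id, hΨ, mul_left_comm _ (-(2 * Real.pi * Complex.I) : ℂ)] at this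
    rw [← Finset.mul_sum, mul_eq_zero, neg_eq_zero,
      or_iff_right Complex.two_pi_I_ne_zero] at this
    exact_mod_cast this
  obtain ⟨g, h0, h1⟩ : ∃ g, F 0 = MvPolynomial.X 1 * g ∧ F 1 = -(MvPolynomial.X 0 * g) := by
    refine exists_eq_mul_of_eval_two hjk (fun b => (hF b).totalDegree_le) (fun x hx => ?_)
      fun m x hx => ?_
    · have := key none le_rfl (x := x) (by simpa [relDirection, axes] using hx)
      simpa [slant, slantCoord_apply, relDirection, axes] using this
    · have := key (some m) (by simp [relDirection, axes]) (x := x)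
        (by simpa [relDirection, axes] using hx)
      simp [slant, slantCoord_apply, relDirection, axes] at this
      linear_combination this
  rw [Fin.sum_univ_two, h0, h1, map_neg, map_mul, map_mul, MvPolynomial.aeval_X,
    MvPolynomial.aeval_X, mul_comm, mul_comm (augVar 2 0), mul_smul, neg_smul, mul_smul,
    gen_relation, add_neg_cancel]

end RelSpine

end

theorem mainTheorem4 :
    (∀ k : ℕ, ∃ (c : Option (Fin (k + 1)) → Torus 2) (h : Option (Fin (k + 1)) → unitInterval),
      Function.Injective h ∧ (∀ i, 0 < h i ∧ h i < 1) ∧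
      IsLink (fun i => levelCurve (relDirection k i) (c i) (h i)) ∧
      ∃ hG : relSpine ⊆ (linkSupport fun i => levelCurve (relDirection k i) (c i) (h i))ᶜ,
        ∀ j : ℕ, 1 ≤ j → j ≤ k →
          Function.Injective (grMap (augIdeal 2) (thickTorusCover.H1Map hG) j)) ∧
    (∀ k : ℕ, ∃ c : Fin 3 ⊕ (Fin k ⊕ Fin k) → Torus 3,
      IsLink (fun i => torusCurve (torusDirection k i) (c i)) ∧
      ∃ hG : torusSpine ⊆ (linkSupport fun i => torusCurve (torusDirection k i) (c i))ᶜ,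
        ∀ j : ℕ, 1 ≤ j → j ≤ k →
          Function.Injective (grMap (augIdeal 3) ((torusCover 3).H1Map hG) j)) :=
  ⟨fun k => ⟨fun i => torusProj 2 (RelSpine.base k i), RelSpine.level k,
      RelSpine.level_injective, RelSpine.level_mem, RelSpine.isLink_component,
      RelSpine.relSpine_subset, fun _ _ hjk => RelSpine.grMap_injective_thickTorus hjk⟩,
    fun k => ⟨fun i => torusProj 3 (CubicalSkeleton.base k i), CubicalSkeleton.isLink_component,
      CubicalSkeleton.torusSpine_subset,
      fun _ hj hjk => CubicalSkeleton.grMap_injective_torus hj hjk⟩⟩
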